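/- **Model.** Let $0<p_L<b<p_H<1$ and $0<q<1$ with $q p_H+(1-q)p_L>b$. A state $\omega\in\{H,L\}$ is drawn with $P(H)=q$; given $\omega$, the variables $t^1,\dots,t^N\in\{0,1\}$ are i.i.d. with mean $p_\omega$. $N$ agents arrive in a uniformly random order $\sigma$ that they do not observe (agent $i$ arrives at stage $\sigma(i)$). The agent at stage $j$ sees the reward $r^{j-1}$ of the preceding agent (if any) and a private message $(m_a,m_s,m_p)$: a recommended arm $m_a\in\{R,S\}$, a label $m_s\in\{s_1,\dots,s_4\}$ and a subsidy $m_p\ge 0$, paid if she pulls $m_a$. She pulls an arm; her reward is $r^j=t^j$ for the risky arm $R$ and $r^j=b$ for the safe arm $S$. A mediator chooses the message at each stage from all previous rewards and the outcome of a coin $cf\in\{0,1\}$ with $P(cf=1)=\delta$; state, rewards $t$, order and coin are drawn independently (except that $t$ depends on $\omega$). **The innkeeper mediator $INKP(N,\beta,\delta,K)$.** 1. *Stages $i\le K$.* The message is $(R,s_1,0)$ at stage 1; at stages $2\le i\le K$ it is $(R,s_1,0)$ if $E(t^i\mid r^{i-1})>b$ and $(S,s_1,0)$ otherwise, where the conditional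 expectation is for the known stage $i$ under obedience of the earlier agents. 2. *Stage $K+1$.* If the first $K$ agents all pulled $R$, their average reward is at least $\frac{p_H+p_L}{2}$, and $cf=0$, then the messages at all stages $i>K$ are $(R,s_3,0)$. Otherwise switching begins, with the number of switches equal to $0$. 3. *Switching.* As long as the number of switches is less than $2K$, the message at stage $i$ is $(R,s_2,0)$ if $r^{i-1}=1$; $(S,s_2,\frac{\beta}{2K})$ if $r^{i-1}=0$; $(R,s_2,\frac{\beta}{2K})$ if $r^{i-1}=b$. In the last two cases the number of switches increases by one. The mediator also records the first $K$ risky rewards $r^{i-1}$ seen at these stages $i$. 4. *Exploitation.* Once there have been $2K$ switches, all further messages are $(R,s_3,0)$ if the average of the $K$ recorded rewards is at least $\frac{p_H+p_L}{2}$, and $(S,s_3,0)$ otherwise. 5. *Deviations.* If an agent disobeys before messages with label $s_3$ have begun, every later message is $(R,s_4,0)$ or $(S,s_4,0)$, whichever arm is best (with $S$ in case of a tie) for an arbitrary given belief $\nu(i,r^{i-1})\in[0,1]$ that the state is $H$ at this event of probability zero. Deviations after messages with label $s_3$ have begun are ignored. **Properties.** A mediator is *incentive compatible* if for every agent, every coin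 outcome and every sequence of previous rewards, obedient or not, $E(m_a\mid m,r)+m_p\ge E(a\mid m,r)$ for both arms $a$, where $m=(m_a,m_s,m_p)$ is the message, $r$ the reward of the predecessor, $E(S\mid\cdot)=b$, and $E(R\mid m,r)$ is the conditional expectation of $t^{\sigma(i)}$ for agent $i$, who does not know her stage, given that everybody obeys. (If $(m,r)$ has probability zero, condition on $m$ alone; if $m$ has probability zero, use the belief $\nu$.) It is *$\beta$-budget balanced* if for every coin outcome, every realization of $t^1,\dots,t^N$ and all actions of the agents the subsidies offered add up to at most $\beta$. It is *$\varepsilon$-optimal* if it is incentive compatible and, when everybody obeys, $E\big(\frac1N\sum_{j=1}^N r^j\mid H\big)\ge(1-\varepsilon)p_H$ and $E\big(\frac1N\sum_{j=1}^N r^j\mid L\big)\ge(1-\varepsilon)b$. **Theorem.** For all $\varepsilon,\beta>0$ there exist integers $N'\ge K>0$ and $\delta\in[0,1]$ such that for every $N\ge N'$ and every system $\nu$ of beliefs with values in $[0,1]$, the mediator $INKP(N,\beta,\delta,K)$ is incentive compatible, $\beta$-budget balanced and $\varepsilon$-optimal. -/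

import Mathlib

noncomputable section

namespace Innkeeper

/-- The two arms. -/
inductive Arm
  | risky
  | safe
  deriving DecidableEq

/-- The two states of nature. -/
inductive State
  | H
  | L
  deriving DecidableEq

instance : Fintype State := ⟨{.H, .L}, fun x => by cases x <;> simp⟩

/-- The observable rewards `{0, 1, b}`: the rewards `0` and `1` come from the risky arm and the
reward `b` comes from the safe arm, so that a reward reveals which arm was pulled. -/
inductive Reward
  | zero
  | one
  | safe
  deriving DecidableEq

/-- The numerical parameters of the model: success probabilities of the risky arm in the two
states, reward of the safe arm, prior probability of `H`. -/
structure Model where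
  pH : ℝ
  pL : ℝ
  b : ℝ
  q : ℝ

/-- Success probability of the risky arm in a state. -/
def Model.success (m : Model) : State → ℝ
  | .H => m.pH
  | .L => m.pL

/-- Prior probability of a state. -/
def Model.prior (m : Model) : State → ℝ
  | .H => m.q
  | .L => 1 - m.q

/-- Mean reward of the risky arm for someone who believes in `H` with probability `x`. -/
def Model.mean (m : Model) (x : ℝ) : ℝ := x * m.pH + (1 - x) * m.pL

/-- The numerical value of a reward. -/
def Model.value (m : Model) : Reward → ℝ
  | .zero => 0
  | .one => 1
  | .safe => m.b

/-- The arm that produced a reward. -/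
def Reward.arm : Reward → Arm
  | .zero => .risky
  | .one => .risky
  | .safe => .safe

/-- The reward of pulling an arm when the risky arm would give `t` (`true` is `1`). -/
def payoff : Arm → Bool → Reward
  | .safe, _ => .safe
  | .risky, true => .one
  | .risky, false => .zero

/-- Bernoulli weights. -/
def bern (p : ℝ) (x : Bool) : ℝ := if x then p else 1 - p

/-! ### Finite probability -/

/-- Probability of `A` for the weights `w` on a finite sample space. -/
def prob {Ω : Type*} [Fintype Ω] (w : Ω → ℝ) (A : Set Ω) : ℝ := ∑ x, A.indicator w x

/-- Expectation of `X` conditional on `A` (used only if `A` has positive probability). -/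
def condMean {Ω : Type*} [Fintype Ω] (w : Ω → ℝ) (X : Ω → ℝ) (A : Set Ω) : ℝ :=
  (∑ x, A.indicator (fun y => w y * X y) x) / prob w A

/-- A finite 0-1 sequence, extended by zeros. -/
def ext {n : ℕ} (t : Fin n → Bool) (j : ℕ) : Bool := if h : j < n then t ⟨j, h⟩ else false

/-- The history of rewards (most recent first) after `n` stages, if at each stage the arm
`act past` is pulled and the risky arm would give `t j` at the stage with `j` predecessors. -/
def play (act : List Reward → Arm) (t : ℕ → Bool) : ℕ → List Reward
  | 0 => []
  | n + 1 => payoff (act (play act t n)) (t n) :: play act t n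

/-! ### Behaviour without intervention -/

/-- Weights of the state and the first `n` risky rewards: i.i.d. conditional on the state. -/
def weight (m : Model) {n : ℕ} (x : State × (Fin n → Bool)) : ℝ :=
  m.prior x.1 * ∏ j, bern (m.success x.1) (x.2 j)

/-- `E(t^{n+2} | r^{n+1})`: the mean of the risky reward for the agent with `n + 1` predecessors,
conditional on the reward of the last of them, if the predecessors played according to `act`. -/
def successorMean (m : Model) (act : List Reward → Arm) (n : ℕ) (r : Option Reward) : ℝ :=
  condMean (weight m (n := n + 2)) (fun x => m.value (payoff .risky (ext x.2 (n + 1))))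
    {x | (play act (ext x.2) (n + 1)).head? = r}

/-- The behaviour of agents who know nothing but their stage and the reward of their immediate
predecessor, defined stage by stage: `prePolicy m n` describes the agents with at most `n`
predecessors. -/
def prePolicy (m : Model) : ℕ → List Reward → Arm
  | 0, _ => .risky
  | n + 1, past =>
    if past.length ≤ n then prePolicy m n past
    else if m.b < successorMean m (prePolicy m n) n past.head? then .risky else .safe

/-- The arm preferred, without intervention, by the agent whose predecessors got `past`. -/
def preArm (m : Model) (past : List Reward) : Arm := prePolicy m past.length past

/-! ### Mediators -/

/-- The phases `s₁, s₂, s₃, s₄` that are announced in a message. -/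
inductive Phase
  | preIntervention
  | switching
  | exploitation
  | deviation
  deriving DecidableEq

/-- A message: recommended arm, announced phase, subsidy for following the recommendation. -/
structure Message where
  arm : Arm
  phase : Phase
  subsidy : ℝ

/-- A mediator for `N` agents: it flips a coin that shows `1` (`true`) with probability `bias`,
and its message at each stage depends on the coin and on all previous rewards (most recent
first). -/
structure Mediator (N : ℕ) where
  bias : ℝ
  msg : Bool → List Reward → Message

/-- The variables of the innkeeper mediator. `exploit = some a` stands for
`exploit_flag = true, exploit_value = a`. -/
structure Memory where
  exploit : Option Arm
  deviated : Bool
  switches : ℕ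
  rCount : ℕ
  rSum : ℝ

/-- The values of the variables at the start. -/
def Memory.init : Memory := ⟨none, false, 0, 0, 0⟩

/-- The update of the sample of risky rewards in the switching phase, when the predecessor's
reward was `r`. -/
def Memory.sample (m : Model) (K : ℕ) (mem : Memory) (r : Reward) : Memory :=
  if mem.rCount < K ∧ r.arm = .risky then
    { mem with rCount := mem.rCount + 1, rSum := mem.rSum + m.value r }
  else mem

/-- One more switch is recommended. -/
def Memory.switch (mem : Memory) : Memory := { mem with switches := mem.switches + 1 }

/-- One stage of the innkeeper mediator: from the values of the variables, the coin `cf` and the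
previous rewards, compute the new values and the message.  The number `ν n r` is the probability
of `H` given that a deviation is announced, for the agent with `n` predecessors the last of whom
got the reward `r`. -/
def step (m : Model) (β : ℝ) (K : ℕ) (ν : ℕ → Reward → ℝ) (cf : Bool) (mem : Memory) :
    List Reward → Memory × Message
  | [] => (mem, ⟨.risky, .preIntervention, 0⟩)
  | r :: rest =>
    let past := r :: rest
    match mem.exploit with
    | some a => (mem, ⟨a, .exploitation, 0⟩)
    | none =>
      if mem.deviated then
        (mem, ⟨if m.b < m.mean (ν past.length r) then .risky else .safe, .deviation, 0⟩)
      else if past.length < K then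
        (mem, ⟨preArm m past, .preIntervention, 0⟩)
      else if past.length = K ∧ (∀ s ∈ past, s.arm = .risky) ∧
          (m.pH + m.pL) / 2 ≤ (past.map m.value).sum / K ∧ cf = false then
        ({ mem with exploit := some .risky }, ⟨.risky, .exploitation, 0⟩)
      else if mem.switches < 2 * K then
        match r with
        | .one => (mem.sample m K r, ⟨.risky, .switching, 0⟩)
        | .zero => ((mem.sample m K r).switch, ⟨.safe, .switching, β / (2 * K)⟩)
        | .safe => ((mem.sample m K r).switch, ⟨.risky, .switching, β / (2 * K)⟩)
      else if (m.pH + m.pL) / 2 ≤ mem.rSum / K then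
        ({ mem with exploit := some .risky }, ⟨.risky, .exploitation, 0⟩)
      else
        ({ mem with exploit := some .safe }, ⟨.safe, .exploitation, 0⟩)

/-- The values of the variables after the given rewards (most recent first); a deviation is
recorded when the arm that was pulled is not the recommended one. -/
def memory (m : Model) (β : ℝ) (K : ℕ) (ν : ℕ → Reward → ℝ) (cf : Bool) : List Reward → Memory
  | [] => .init
  | r :: past =>
    let out := step m β K ν cf (memory m β K ν cf past) past
    { out.1 with deviated := out.1.deviated || decide (r.arm ≠ out.2.arm) }

/-- The innkeeper mediator `INKP(N, β, δ, K)`, with off-path beliefs `ν`. -/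
def INKP (m : Model) (ν : ℕ → Reward → ℝ) (N : ℕ) (β δ : ℝ) (K : ℕ) : Mediator N where
  bias := δ
  msg cf past := (step m β K ν cf (memory m β K ν cf past) past).2

/-! ### The game in which recommendations are obeyed -/

/-- An outcome: state, coin, risky rewards by stage, and order of arrival `σ` (agent `i` arrives
at stage `σ i`). -/
abbrev Outcome (N : ℕ) := State × Bool × (Fin N → Bool) × Equiv.Perm (Fin N)

variable {N : ℕ}

/-- The law of the outcome: the state has the prior distribution, the risky rewards are i.i.d.
conditional on the state, the coin and the uniformly random order of arrival are independent of
everything else. -/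
def law (m : Model) (M : Mediator N) (x : Outcome N) : ℝ :=
  weight m (x.1, x.2.2.1) * bern M.bias x.2.1 * (1 / (N.factorial : ℝ))

/-- The rewards (most recent first) at the first `n` stages, if recommendations are obeyed. -/
def history (M : Mediator N) (x : Outcome N) (n : ℕ) : List Reward :=
  play (fun past => (M.msg x.2.1 past).arm) (ext x.2.2.1) n

/-- The message received by agent `i`. -/
def message (M : Mediator N) (i : Fin N) (x : Outcome N) : Message :=
  M.msg x.2.1 (history M x (x.2.2.2 i))

/-- The reward of the predecessor of agent `i` (`none` for the agent who arrives first). -/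
def predecessor (M : Mediator N) (i : Fin N) (x : Outcome N) : Option Reward :=
  (history M x (x.2.2.2 i)).head?

/-- The risky reward `t^{σ(i)}` at the stage of agent `i`. -/
def riskyReward (m : Model) (i : Fin N) (x : Outcome N) : ℝ :=
  m.value (payoff .risky (x.2.2.1 (x.2.2.2 i)))

/-- The event that agent `i` receives the message `g`. -/
def receives (M : Mediator N) (i : Fin N) (g : Message) : Set (Outcome N) :=
  {x | message M i x = g}

/-- The event that agent `i` receives the message `g` and sees the predecessor's reward `r`. -/
def observes (M : Mediator N) (i : Fin N) (g : Message) (r : Option Reward) : Set (Outcome N) :=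
  {x | message M i x = g ∧ predecessor M i x = r}

open Classical in
/-- `E(t^{σ(i)} | mdr(h), h_{last})`: the mean of the risky arm for agent `i`, who does not know
at which stage she arrives, conditional on what she observes after the coin `cf` and the rewards
`past`.  If what she observes has probability zero when recommendations are obeyed, only the
message is used; a message which itself has probability zero is evaluated with the belief `ν`. -/
def agentMean (m : Model) (ν : ℕ → Reward → ℝ) (M : Mediator N) (i : Fin N) (cf : Bool)
    (past : List Reward) : ℝ :=
  let g := M.msg cf past
  if 0 < prob (law m M) (observes M i g past.head?) then
    condMean (law m M) (riskyReward m i) (observes M i g past.head?)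
  else if 0 < prob (law m M) (receives M i g) then
    condMean (law m M) (riskyReward m i) (receives M i g)
  else
    match past with
    | [] => m.mean m.q
    | r :: _ => m.mean (ν past.length r)

/-- Expected reward, without subsidy, of an arm for agent `i`. -/
def armMean (m : Model) (ν : ℕ → Reward → ℝ) (M : Mediator N) (i : Fin N) (cf : Bool)
    (past : List Reward) : Arm → ℝ
  | .risky => agentMean m ν M i cf past
  | .safe => m.b

/-- Incentive compatibility: for each agent, after any coin and any rewards of predecessors
(obedient or not), the recommended arm with its subsidy is at least as good as any arm. -/
def IncentiveCompatible (m : Model) (ν : ℕ → Reward → ℝ) (M : Mediator N) : Prop :=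
  ∀ (i : Fin N) (cf : Bool) (past : List Reward), past.length < N → ∀ a : Arm,
    armMean m ν M i cf past a ≤
      armMean m ν M i cf past (M.msg cf past).arm + (M.msg cf past).subsidy

/-- Budget balance: for any coin, any risky rewards `t` and any actions of the agents (obedient
or not), the subsidies promised add up to at most `β`. -/
def BudgetBalanced (β : ℝ) (M : Mediator N) : Prop :=
  ∀ (cf : Bool) (t : Fin N → Bool) (act : List Reward → Arm),
    ∑ j : Fin N, (M.msg cf (play act (ext t) j)).subsidy ≤ β

/-- The average reward per agent, if recommendations are obeyed. -/
def averageReward (m : Model) (M : Mediator N) (x : Outcome N) : ℝ :=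
  ((history M x N).map m.value).sum / N

/-- `ε`-optimality: incentive compatibility, together with lower bounds for the expected average
reward in the two states. -/
def EpsOptimal (m : Model) (ν : ℕ → Reward → ℝ) (ε : ℝ) (M : Mediator N) : Prop :=
  IncentiveCompatible m ν M ∧
  (1 - ε) * m.pH ≤ condMean (law m M) (averageReward m M) {x | x.1 = .H} ∧
  (1 - ε) * m.b ≤ condMean (law m M) (averageReward m M) {x | x.1 = .L}

end Innkeeper

end

open Innkeeper

noncomputable section

namespace Innkeeper

/-! ### Expectations over obedient histories -/

/-! An agent's stage is uniform, so her posterior is a matter of counting. If `f ω` is the expected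
number of stages with a given message and preceding reward in state ω, the risky arm is worth at
least `c` to her iff `gain m c f ≥ 0` (`condMean_observation`). Incentive compatibility thus becomes
a list of sign conditions (`incentiveCompatible_of_gain`).

Before the intervention the recommendation is right at every stage, and gains of one sign add up
(`gain_pre_message`). In that phase the safe arm is absorbing. The probability that everybody has
pulled the risky arm is a power of `m.success ω`, and in state L it stays above some c > 0 at all
stages (`exists_preRisky_ge`): a reward 0 stops experimentation only while L still has enough
weight.

The switching phase is the heart of the scheme. Once completed it has produced exactly K messages
after 0 and K messages after b, in either state (`regime`). So these messages reveal little more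
than the fact that switching began. The coin is biased so that this fact alone makes the two arms
equally attractive (`exists_bias`); any positive subsidy then outweighs the small error due to
unfinished switching. A martingale (`drift_switchCount`) shows that messages after 1 number about K
p/(1-p) per switching phase. This is larger in H, so they need no subsidy (`Tuned.gain_switch`).

In the exploitation phase Chebyshev's inequality bounds the probability of the wrong arm by O(1/K)
(`exploits_safe_le`, `exploits_risky_le`). After a reward of the exploited arm itself, the message
is seen about N times in the right state and a small fraction of N times in the wrong one. After a
reward of the other arm it is seen at most once, at the onset. As 2K is even, this happens exactly
when the last of the first K agents pulled the other arm (`turnCount_eq`), and the analysis of the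
first phase controls that event.

Optimality follows because switching is short (`pending_le`) and the estimate is reliable. The
constants are chosen in the order c, error e, K, bias δ, switching error η, number of agents. -/

/-- The indicator of a proposition. -/
def ind (P : Prop) : ℝ := open Classical in if P then 1 else 0

lemma ind_of {P : Prop} (h : P) : ind P = 1 := by simp [ind, h]

lemma ind_not {P : Prop} (h : ¬ P) : ind P = 0 := by simp [ind, h]

@[simp] lemma ind_true : ind True = 1 := ind_of trivial

@[simp] lemma ind_false : ind False = 0 := ind_not not_false

lemma ind_nonneg (P : Prop) : 0 ≤ ind P := by unfold ind; split_ifs <;> norm_num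

lemma ind_le_one (P : Prop) : ind P ≤ 1 := by unfold ind; split_ifs <;> norm_num

lemma ind_mono {P Q : Prop} (h : P → Q) : ind P ≤ ind Q := by
  by_cases hP : P
  · rw [ind_of hP, ind_of (h hP)]
  · rw [ind_not hP]; exact ind_nonneg Q

/-- Every reward in the history comes from the arm that `act` prescribes. -/
def Obedient (act : List Reward → Arm) : List Reward → Prop
  | [] => True
  | r :: h => r.arm = act h ∧ Obedient act h

/-- Expectation of `F` at the history of `n` stages, if the arms are chosen by `act` and the risky
arm is successful with probability `p`, independently at each stage. -/
def expect (p : ℝ) (act : List Reward → Arm) : ℕ → (List Reward → ℝ) → ℝ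
  | 0, F => F []
  | n + 1, F => expect p act n fun h =>
      p * F (payoff (act h) true :: h) + (1 - p) * F (payoff (act h) false :: h)

lemma payoff_arm (a : Arm) (x : Bool) : (payoff a x).arm = a := by
  cases a <;> cases x <;> rfl

section expect

variable {p : ℝ} {act : List Reward → Arm} {n : ℕ} {F G : List Reward → ℝ}

lemma expect_mono (hp0 : 0 ≤ p) (hp1 : p ≤ 1)
    (h : ∀ l, Obedient act l → l.length = n → F l ≤ G l) :
    expect p act n F ≤ expect p act n G := by
  induction n generalizing F G with
  | zero => exact h [] trivial rfl
  | succ n ih =>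
    refine ih fun l hl hn => ?_
    have h1 := h (payoff (act l) true :: l) ⟨payoff_arm _ _, hl⟩ (by simp [hn])
    have h2 := h (payoff (act l) false :: l) ⟨payoff_arm _ _, hl⟩ (by simp [hn])
    have := mul_le_mul_of_nonneg_left h1 hp0
    have := mul_le_mul_of_nonneg_left h2 (sub_nonneg.2 hp1)
    linarith

lemma expect_congr (h : ∀ l, Obedient act l → l.length = n → F l = G l) :
    expect p act n F = expect p act n G := by
  induction n generalizing F G with
  | zero => exact h [] trivial rfl
  | succ n ih =>
    refine ih fun l hl hn => ?_
    rw [h (payoff (act l) true :: l) ⟨payoff_arm _ _, hl⟩ (by simp [hn]),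
      h (payoff (act l) false :: l) ⟨payoff_arm _ _, hl⟩ (by simp [hn])]

lemma expect_const (c : ℝ) : expect p act n (fun _ => c) = c := by
  induction n with
  | zero => rfl
  | succ n ih =>
    rw [expect, ← ih]; congr 1; funext h; rw [ih]; ring

lemma expect_add :
    expect p act n (fun h => F h + G h) = expect p act n F + expect p act n G := by
  induction n generalizing F G with
  | zero => rfl
  | succ n ih => simp only [expect]; rw [← ih]; congr 1; funext h; ring

lemma expect_mul (c : ℝ) : expect p act n (fun h => c * F h) = c * expect p act n F := by
  induction n generalizing F with
  | zero => rfl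
  | succ n ih => simp only [expect]; rw [← ih]; congr 1; funext h; ring

lemma expect_sub :
    expect p act n (fun h => F h - G h) = expect p act n F - expect p act n G := by
  have h1 := expect_add (p := p) (act := act) (n := n) (F := F) (G := fun h => (-1) * G h)
  rw [expect_mul] at h1
  have h2 : (fun h => F h - G h) = fun h => F h + (-1) * G h := by funext h; ring
  rw [h2, h1]; ring

lemma expect_nonneg (hp0 : 0 ≤ p) (hp1 : p ≤ 1)
    (h : ∀ l, Obedient act l → l.length = n → 0 ≤ F l) : 0 ≤ expect p act n F := by
  rw [← expect_const (p := p) (act := act) (n := n) 0]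
  exact expect_mono hp0 hp1 h

/-- The step of the recursion for functions of the extended history that are known explicitly. -/
lemma expect_succ (h : ∀ l, Obedient act l → l.length = n →
      p * F (payoff (act l) true :: l) + (1 - p) * F (payoff (act l) false :: l) = G l) :
    expect p act (n + 1) F = expect p act n G :=
  expect_congr h

lemma expect_succ_of_tail (h : ∀ r l, Obedient act (r :: l) → l.length = n → F (r :: l) = G l) :
    expect p act (n + 1) F = expect p act n G := by
  refine expect_succ fun l hl hn => ?_
  rw [h _ l ⟨payoff_arm _ _, hl⟩ hn, h _ l ⟨payoff_arm _ _, hl⟩ hn]; ring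

lemma expect_act_congr {act' : List Reward → Arm}
    (h : ∀ l, Obedient act l → l.length < n → act l = act' l) :
    expect p act n F = expect p act' n F := by
  induction n generalizing F with
  | zero => rfl
  | succ n ih =>
    rw [expect, expect, ← ih fun l hl hn => h l hl (by omega)]
    exact expect_congr fun l hl hn => by rw [h l hl (by omega)]

/-- Since 0 < p < 1, every obedient history has positive probability. -/
lemma expect_pos (hp0 : 0 < p) (hp1 : p < 1) {l : List Reward} (hl : Obedient act l)
    (h0 : ∀ l, 0 ≤ F l) (hF : 0 < F l) : 0 < expect p act l.length F := by
  induction l generalizing F with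
  | nil => exact hF
  | cons r l ih =>
    refine ih hl.2 (fun l => ?_) ?_
    · have := h0 (payoff (act l) true :: l)
      have := h0 (payoff (act l) false :: l)
      have : 0 ≤ 1 - p := by linarith
      positivity
    · have h1 := h0 (payoff (act l) true :: l)
      have h2 := h0 (payoff (act l) false :: l)
      have hq : 0 < 1 - p := by linarith
      have : r = payoff (act l) true ∨ r = payoff (act l) false := by
        rw [← hl.1]; cases r <;> simp [Reward.arm, payoff]
      rcases this with h | h
      · rw [h] at hF; positivity
      · rw [h] at hF; positivity

/-- Sum of `f` over all initial segments of a history. -/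
def cumul (f : List Reward → ℝ) : List Reward → ℝ
  | [] => f []
  | r :: h => f (r :: h) + cumul f h

/-- Expected counts over all stages become the expectation of one function of the final history, so
that they can be bounded path by path. -/
lemma sum_expect (n : ℕ) :
    ∑ j ∈ Finset.range (n + 1), expect p act j F = expect p act n (cumul F) := by
  induction n with
  | zero => simp [expect, cumul]
  | succ n ih =>
    rw [Finset.sum_range_succ, ih]
    have h1 : expect p act (n + 1) (cumul F)
        = expect p act (n + 1) (fun h => F h + cumul F h.tail) := by
      refine expect_congr fun l _ hn => ?_
      cases l with
      | nil => simp at hn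
      | cons r l => rfl
    rw [h1, expect_add, expect_succ_of_tail (F := fun h => cumul F h.tail) (G := cumul F)
      (fun r l _ _ => rfl)]
    ring

end expect

lemma obedient_congr {act act' : List Reward → Arm} {l : List Reward}
    (h : ∀ l', Obedient act l' → l'.length < l.length → act l' = act' l') (hl : Obedient act l) :
    Obedient act' l := by
  induction l with
  | nil => trivial
  | cons r l ih =>
    refine ⟨?_, ih (fun l' h1 h2 => h l' h1 (by simp; omega)) hl.2⟩
    rw [← h l hl.2 (by simp)]; exact hl.1

/-! ### Sums over sequences of risky rewards -/

lemma bern_sum (p : ℝ) : ∑ x, bern p x = 1 := by simp [bern]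

lemma ext_snoc_lt {n : ℕ} (t : Fin n → Bool) (x : Bool) {j : ℕ} (hj : j < n) :
    ext (Fin.snoc t x : Fin (n + 1) → Bool) j = ext t j := by
  have : j < n + 1 := by omega
  simp [ext, hj, this, Fin.snoc]

lemma ext_snoc_eq {n : ℕ} (t : Fin n → Bool) (x : Bool) :
    ext (Fin.snoc t x : Fin (n + 1) → Bool) n = x := by
  simp [ext, Fin.snoc]

lemma sum_snoc {n : ℕ} (p : ℝ) (f : (Fin (n + 1) → Bool) → ℝ) :
    ∑ t, (∏ j, bern p (t j)) * f t
      = ∑ t : Fin n → Bool, (∏ j, bern p (t j)) * ∑ x, bern p x * f (Fin.snoc t x) := by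
  rw [← (Fin.snocEquiv fun _ => Bool).sum_comp, Fintype.sum_prod_type, Finset.sum_comm]
  refine Finset.sum_congr rfl fun t _ => ?_
  rw [Finset.mul_sum]
  refine Finset.sum_congr rfl fun x _ => ?_
  simp [Fin.snocEquiv, Fin.prod_univ_castSucc]
  ring

/-- Marginalization: a function of the first `n` rewards. -/
lemma sum_marginal {n N : ℕ} (hn : n ≤ N) (p : ℝ) (f : (ℕ → Bool) → ℝ)
    (hf : ∀ s t : ℕ → Bool, (∀ j < n, s j = t j) → f s = f t) :
    ∑ t : Fin N → Bool, (∏ j, bern p (t j)) * f (ext t)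
      = ∑ t : Fin n → Bool, (∏ j, bern p (t j)) * f (ext t) := by
  induction N, hn using Nat.le_induction with
  | base => rfl
  | succ N hN ih =>
    rw [sum_snoc, ← ih]
    refine Finset.sum_congr rfl fun t _ => ?_
    congr 1
    rw [← one_mul (f (ext t)), ← bern_sum p, Finset.sum_mul]
    refine Finset.sum_congr rfl fun x _ => ?_
    rw [hf _ _ fun j hj => ext_snoc_lt t x (show j < N by omega)]

lemma play_congr (act : List Reward → Arm) {s t : ℕ → Bool} {n : ℕ}
    (h : ∀ j < n, s j = t j) : play act s n = play act t n := by
  induction n with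
  | zero => rfl
  | succ n ih => rw [play, play, ih fun j hj => h j (by omega), h n (by omega)]

lemma sum_play_eq_expect (p : ℝ) (act : List Reward → Arm) (n : ℕ) (F : List Reward → ℝ) :
    ∑ t : Fin n → Bool, (∏ j, bern p (t j)) * F (play act (ext t) n) = expect p act n F := by
  induction n generalizing F with
  | zero => simp [play, expect]
  | succ n ih =>
    rw [sum_snoc, expect, ← ih]
    refine Finset.sum_congr rfl fun t _ => ?_
    congr 1
    have h : ∀ x, play act (ext (Fin.snoc t x : Fin (n + 1) → Bool)) (n + 1)
        = payoff (act (play act (ext t) n)) x :: play act (ext t) n := fun x => by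
      rw [play, ext_snoc_eq, play_congr act fun j hj => ext_snoc_lt t x hj]
    simp [h, bern]

lemma sum_play {n N : ℕ} (hn : n ≤ N) (p : ℝ) (act : List Reward → Arm) (F : List Reward → ℝ) :
    ∑ t : Fin N → Bool, (∏ j, bern p (t j)) * F (play act (ext t) n) = expect p act n F := by
  rw [sum_marginal hn p (fun t => F (play act t n)) fun s t h => by rw [play_congr act h],
    sum_play_eq_expect]

/-- The history of n stages is a function of the first n draws, hence independent of the draw at the
next stage. -/
lemma sum_play_mul {n N : ℕ} (hn : n < N) (p : ℝ) (act : List Reward → Arm)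
    (F : List Reward → ℝ) (f : Bool → ℝ) :
    ∑ t : Fin N → Bool, (∏ j, bern p (t j)) * (f (ext t n) * F (play act (ext t) n))
      = (∑ x, bern p x * f x) * expect p act n F := by
  rw [sum_marginal (n := n + 1) hn p (fun t => f (t n) * F (play act t n)) fun s t h => by
    rw [play_congr act fun j hj => h j (by omega), h n (by omega)], sum_snoc,
    ← sum_play_eq_expect, Finset.mul_sum]
  refine Finset.sum_congr rfl fun t _ => ?_
  simp_rw [ext_snoc_eq, play_congr act fun j hj => ext_snoc_lt t _ hj]
  rw [mul_left_comm, Finset.sum_mul]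
  congr 1
  exact Finset.sum_congr rfl fun x _ => by ring

/-! ### The law of the outcome -/

/-- Composition with a transposition shows that all agents have the same sum. Adding over the agents
evaluates it. -/
lemma sum_perm_apply {N : ℕ} (i : Fin N) (f : Fin N → ℝ) :
    ∑ σ : Equiv.Perm (Fin N), f (σ i) * (1 / (N.factorial : ℝ)) = (1 / (N : ℝ)) * ∑ j, f j := by
  have hN : (N : ℝ) ≠ 0 := by
    have := i.pos
    positivity
  have h1 : ∀ k : Fin N, ∑ σ : Equiv.Perm (Fin N), f (σ k) = ∑ σ : Equiv.Perm (Fin N), f (σ i) :=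
    fun k => by
      rw [← Equiv.sum_comp (Equiv.mulRight (Equiv.swap i k))]
      simp
  have h2 : ∑ k, ∑ σ : Equiv.Perm (Fin N), f (σ k) = N.factorial * ∑ j, f j := by
    rw [Finset.sum_comm]
    simp_rw [Equiv.sum_comp]
    simp [Fintype.card_perm]
  simp_rw [h1] at h2
  simp at h2
  rw [← Finset.sum_mul]
  have : (N.factorial : ℝ) ≠ 0 := by positivity
  field_simp
  linarith

lemma sum_law {N : ℕ} (m : Model) (M : Mediator N) (i : Fin N)
    (f : State → Bool → (Fin N → Bool) → Fin N → ℝ) :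
    ∑ x : Outcome N, law m M x * f x.1 x.2.1 x.2.2.1 (x.2.2.2 i)
      = (1 / (N : ℝ)) * ∑ ω, m.prior ω * ∑ cf, bern M.bias cf *
          ∑ n, ∑ t, (∏ j, bern (m.success ω) (t j)) * f ω cf t n := by
  rw [Fintype.sum_prod_type, Finset.mul_sum]
  refine Finset.sum_congr rfl fun ω _ => ?_
  rw [Fintype.sum_prod_type, Finset.mul_sum, Finset.mul_sum]
  refine Finset.sum_congr rfl fun cf _ => ?_
  rw [Fintype.sum_prod_type]
  simp only [law, weight]
  have h : ∀ t : Fin N → Bool, ∑ σ : Equiv.Perm (Fin N),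
      m.prior ω * (∏ j, bern (m.success ω) (t j)) * bern M.bias cf * (1 / (N.factorial : ℝ))
        * f ω cf t (σ i) = (1 / (N : ℝ)) * (m.prior ω * (bern M.bias cf *
          ∑ n, (∏ j, bern (m.success ω) (t j)) * f ω cf t n)) := fun t => by
    rw [← Finset.mul_sum (f := fun n => f ω cf t n), mul_left_comm (bern M.bias cf),
      mul_left_comm (m.prior ω), mul_left_comm (1 / (N : ℝ)),
      mul_left_comm (1 / (N : ℝ)) (m.prior ω), mul_left_comm (1 / (N : ℝ)) (bern _ _),
      ← sum_perm_apply i (f ω cf t), Finset.mul_sum, Finset.mul_sum, Finset.mul_sum]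
    exact Finset.sum_congr rfl fun σ _ => by ring
  rw [Finset.sum_congr rfl fun t _ => h t, ← Finset.mul_sum, ← Finset.mul_sum, ← Finset.mul_sum,
    Finset.sum_comm]

/-- The inequalities between the parameters that are assumed throughout. -/
structure Model.Standing (m : Model) : Prop where
  pL_pos : 0 < m.pL
  pL_lt : m.pL < m.b
  lt_pH : m.b < m.pH
  pH_lt : m.pH < 1
  q_pos : 0 < m.q
  q_lt : m.q < 1
  prior_mean : m.b < m.q * m.pH + (1 - m.q) * m.pL

lemma sum_state (f : State → ℝ) : ∑ ω, f ω = f .H + f .L := by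
  have : (Finset.univ : Finset State) = {.H, .L} := rfl
  rw [this]; simp

namespace Model.Standing

variable {m : Model} (hm : m.Standing)
include hm

lemma success_pos (ω : State) : 0 < m.success ω := by
  have := hm.pL_pos; have := hm.pL_lt; have := hm.lt_pH
  cases ω <;> simp only [Model.success] <;> linarith

lemma success_lt (ω : State) : m.success ω < 1 := by
  have := hm.pH_lt; have := hm.pL_lt; have := hm.lt_pH
  cases ω <;> simp only [Model.success] <;> linarith

lemma prior_pos (ω : State) : 0 < m.prior ω := by
  have := hm.q_pos; have := hm.q_lt
  cases ω <;> simp only [Model.prior] <;> linarith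

lemma b_pos : 0 < m.b := hm.pL_pos.trans hm.pL_lt

end Model.Standing

/-- Sum over the states, weighted by the prior, of the advantage of the risky arm over the
alternative `c`, times `f`. -/
def gain (m : Model) (c : ℝ) (f : State → ℝ) : ℝ :=
  ∑ ω, m.prior ω * (m.success ω - c) * f ω

lemma gain_eq (m : Model) (c : ℝ) (f : State → ℝ) :
    gain m c f = m.q * (m.pH - c) * f .H - (1 - m.q) * (c - m.pL) * f .L := by
  simp only [gain, sum_state, Model.prior, Model.success]; ring

/-! ### What an agent knows -/

section agent

variable {N : ℕ} (m : Model) (M : Mediator N)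

/-- Expected number of stages at which `Φ` holds of the coin and the history, if the risky arm
succeeds with probability `p` and recommendations are obeyed. -/
def visits (p : ℝ) (Φ : Bool → List Reward → Prop) : ℝ :=
  ∑ cf, bern M.bias cf *
    ∑ n ∈ Finset.range N, expect p (fun h => (M.msg cf h).arm) n fun h => ind (Φ cf h)

variable {m M}

/-- The agent's stage is uniform, and the risky reward at that stage is independent of the message
and of the preceding reward. So the state enters only through the number of visits and the success
probability. -/
lemma sum_observation (i : Fin N) (Q : Message → Option Reward → Prop) (f : Bool → ℝ) :
    ∑ x, {x | Q (message M i x) (predecessor M i x)}.indicator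
        (fun y : Outcome N => law m M y * f (y.2.2.1 (y.2.2.2 i))) x
      = (1 / (N : ℝ)) * ∑ ω, m.prior ω * ((∑ x, bern (m.success ω) x * f x) *
          visits M (m.success ω) fun cf h => Q (M.msg cf h) h.head?) := by
  classical
  have h := sum_law m M i fun _ cf t n => f (t n) *
    ind (Q (M.msg cf (play (fun h => (M.msg cf h).arm) (ext t) n))
      (play (fun h => (M.msg cf h).arm) (ext t) n).head?)
  have h1 : ∀ x : Outcome N, {x | Q (message M i x) (predecessor M i x)}.indicator
        (fun y : Outcome N => law m M y * f (y.2.2.1 (y.2.2.2 i))) x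
      = law m M x * (f (x.2.2.1 (x.2.2.2 i)) *
          ind (Q (M.msg x.2.1 (play (fun h => (M.msg x.2.1 h).arm) (ext x.2.2.1) (x.2.2.2 i)))
            (play (fun h => (M.msg x.2.1 h).arm) (ext x.2.2.1) (x.2.2.2 i)).head?)) := by
    intro x
    by_cases hx : Q (message M i x) (predecessor M i x)
    · rw [Set.indicator_of_mem (by exact hx), ind_of (by exact hx), mul_one]
    · rw [Set.indicator_of_notMem (by exact hx), ind_not (by exact hx), mul_zero, mul_zero]
  rw [Finset.sum_congr rfl fun x _ => h1 x, h]
  congr 1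
  refine Finset.sum_congr rfl fun ω _ => ?_
  congr 1
  rw [visits, Finset.mul_sum]
  refine Finset.sum_congr rfl fun cf _ => ?_
  rw [mul_left_comm]
  congr 1
  rw [← Fin.sum_univ_eq_sum_range
    (fun n => expect _ _ n fun h => ind (Q (M.msg cf h) h.head?)), Finset.mul_sum]
  refine Finset.sum_congr rfl fun n _ => ?_
  rw [← sum_play_mul n.2]
  refine Finset.sum_congr rfl fun t _ => ?_
  have : ext t n = t n := by simp [ext]
  rw [this]

lemma prob_observation (i : Fin N) (Q : Message → Option Reward → Prop) :
    prob (law m M) {x | Q (message M i x) (predecessor M i x)}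
      = (1 / (N : ℝ)) * ∑ ω, m.prior ω *
          visits M (m.success ω) fun cf h => Q (M.msg cf h) h.head? := by
  have := sum_observation (m := m) (M := M) i Q fun _ => 1
  simp only [mul_one, bern_sum, one_mul] at this
  exact this

/-- Clearing the positive denominator leaves a positive multiple of the gain, which is linear in the
numbers of visits. -/
lemma condMean_observation (i : Fin N) (Q : Message → Option Reward → Prop)
    (hQ : 0 < prob (law m M) {x | Q (message M i x) (predecessor M i x)}) (c : ℝ) :
    (c ≤ condMean (law m M) (riskyReward m i) {x | Q (message M i x) (predecessor M i x)} ↔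
      0 ≤ gain m c fun ω => visits M (m.success ω) fun cf h => Q (M.msg cf h) h.head?) ∧
    (condMean (law m M) (riskyReward m i) {x | Q (message M i x) (predecessor M i x)} ≤ c ↔
      gain m c (fun ω => visits M (m.success ω) fun cf h => Q (M.msg cf h) h.head?) ≤ 0) := by
  have hN : (0 : ℝ) < 1 / N := by
    have := i.pos
    positivity
  have h := sum_observation (M := M) (m := m) i Q fun x => m.value (payoff .risky x)
  have h2 : ∀ p, ∑ x, bern p x * m.value (payoff .risky x) = p := fun p => by
    simp [bern, payoff, Model.value]
  simp only [h2] at h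
  rw [condMean, div_le_iff₀ hQ, le_div_iff₀ hQ]
  unfold riskyReward
  rw [h, prob_observation]
  set v := fun ω => visits M (m.success ω) fun cf h => Q (M.msg cf h) h.head? with hv
  have e : 1 / (N : ℝ) * ∑ ω, m.prior ω * (m.success ω * v ω)
      - c * (1 / (N : ℝ) * ∑ ω, m.prior ω * v ω) = 1 / (N : ℝ) * gain m c v := by
    simp only [gain, sum_state]; ring
  constructor
  · rw [← sub_nonneg, e]
    constructor
    · intro h; exact nonneg_of_mul_nonneg_right h hN
    · intro h; positivity
  · rw [← sub_nonpos, e]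
    constructor
    · intro h; exact nonpos_of_mul_nonpos_right h hN
    · intro h; exact mul_nonpos_of_nonneg_of_nonpos hN.le h

lemma visits_split (p : ℝ) (Φ : Bool → List Reward → Prop) :
    visits M p Φ = visits M p (fun cf h => Φ cf h ∧ h.head? = none)
      + visits M p (fun cf h => Φ cf h ∧ h.head? = some .zero)
      + visits M p (fun cf h => Φ cf h ∧ h.head? = some .one)
      + visits M p (fun cf h => Φ cf h ∧ h.head? = some .safe) := by
  simp only [visits]
  simp only [← Finset.sum_add_distrib, ← mul_add, ← expect_add]
  refine Finset.sum_congr rfl fun cf _ => ?_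
  congr 1
  refine Finset.sum_congr rfl fun n _ => ?_
  congr 1
  funext h
  rcases h with _ | ⟨_ | _ | _, h⟩ <;> simp

lemma gain_split (c : ℝ) (Φ : Bool → List Reward → Prop) :
    gain m c (fun ω => visits M (m.success ω) Φ)
      = gain m c (fun ω => visits M (m.success ω) fun cf h => Φ cf h ∧ h.head? = none)
      + gain m c (fun ω => visits M (m.success ω) fun cf h => Φ cf h ∧ h.head? = some .zero)
      + gain m c (fun ω => visits M (m.success ω) fun cf h => Φ cf h ∧ h.head? = some .one)
      + gain m c (fun ω => visits M (m.success ω) fun cf h => Φ cf h ∧ h.head? = some .safe) := by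
  simp only [gain_eq]
  rw [visits_split (p := m.success .H) Φ, visits_split (p := m.success .L) Φ]
  ring

variable {ν : ℕ → Reward → ℝ} {i : Fin N} {cf : Bool} {past : List Reward} {c : ℝ}

/-- When the pair of message and reward has probability zero, the agent conditions on the message
alone. The gain is then the sum over all possible preceding rewards, so a sign valid for each reward
covers this case too. -/
lemma le_agentMean (hpos : 0 < prob (law m M) (receives M i (M.msg cf past)))
    (h : ∀ r, 0 ≤ gain m c fun ω => visits M (m.success ω)
      fun cf' h => M.msg cf' h = M.msg cf past ∧ h.head? = r) :
    c ≤ agentMean m ν M i cf past := by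
  unfold agentMean
  by_cases h1 : 0 < prob (law m M) (observes M i (M.msg cf past) past.head?)
  · simp only [h1, if_true]
    exact ((condMean_observation i (fun g r => g = M.msg cf past ∧ r = past.head?) h1 c).1).2 (h _)
  · simp only [h1, if_false, hpos, if_true]
    refine ((condMean_observation i (fun g r => g = M.msg cf past) hpos c).1).2 ?_
    rw [gain_split]
    have := h none; have := h (some .zero); have := h (some .one); have := h (some .safe)
    linarith

lemma agentMean_le (hpos : 0 < prob (law m M) (receives M i (M.msg cf past)))
    (h : ∀ r, gain m c (fun ω => visits M (m.success ω)
      fun cf' h => M.msg cf' h = M.msg cf past ∧ h.head? = r) ≤ 0) :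
    agentMean m ν M i cf past ≤ c := by
  unfold agentMean
  by_cases h1 : 0 < prob (law m M) (observes M i (M.msg cf past) past.head?)
  · simp only [h1, if_true]
    exact ((condMean_observation i (fun g r => g = M.msg cf past ∧ r = past.head?) h1 c).2).2 (h _)
  · simp only [h1, if_false, hpos, if_true]
    refine ((condMean_observation i (fun g r => g = M.msg cf past) hpos c).2).2 ?_
    rw [gain_split]
    have := h none; have := h (some .zero); have := h (some .one); have := h (some .safe)
    linarith

end agent

/-! ### Behaviour without intervention -/

lemma ind_and_mul (P Q : Prop) : ind (P ∧ Q) = ind P * ind Q := by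
  by_cases hP : P <;> by_cases hQ : Q <;> simp [ind, hP, hQ]

lemma sum_risky_first (p : ℝ) (act : List Reward → Arm) (n : ℕ) (x : Bool)
    (Φ : List Reward → Prop) :
    expect p act (n + 1) (fun h => ind (h.head? = some (payoff .risky x) ∧ Φ h.tail))
      = bern p x * expect p act n fun h => ind (act h = .risky ∧ Φ h) := by
  rw [← expect_mul]
  refine expect_succ fun l _ _ => ?_
  cases h : act l <;> cases x <;> by_cases hΦ : Φ l <;>
    simp [payoff, bern, ind, hΦ]

variable {m : Model}

lemma prePolicy_eq_preArm {n : ℕ} {past : List Reward} (h : past.length ≤ n) :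
    prePolicy m n past = preArm m past := by
  induction n with
  | zero =>
    have : past.length = 0 := by omega
    rw [preArm, this]
  | succ n ih =>
    by_cases h1 : past.length ≤ n
    · rw [prePolicy, if_pos h1, ih h1]
    · have : past.length = n + 1 := by omega
      rw [preArm, this]

/-- The weighted advantage of the risky arm for the agent with `n` predecessors whose predecessor
got the reward `r`. -/
def preGain (m : Model) (n : ℕ) (r : Option Reward) : ℝ :=
  gain m m.b fun ω => expect (m.success ω) (preArm m) n fun h => ind (h.head? = r)

lemma successorMean_lt_iff (hm : m.Standing) (n : ℕ) (r : Option Reward) :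
    m.b < successorMean m (prePolicy m n) n r ↔ 0 < preGain m (n + 1) r := by
  have hE : ∀ ω, expect (m.success ω) (preArm m) (n + 1) (fun h => ind (h.head? = r))
      = expect (m.success ω) (prePolicy m n) (n + 1) (fun h => ind (h.head? = r)) := fun ω =>
    expect_act_congr fun l _ hl => (prePolicy_eq_preArm (by omega)).symm
  set v := fun ω => expect (m.success ω) (preArm m) (n + 1) (fun h => ind (h.head? = r)) with hv
  have key : ∀ f : Bool → ℝ, ∑ x, {x : State × (Fin (n + 2) → Bool) |
        (play (prePolicy m n) (ext x.2) (n + 1)).head? = r}.indicator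
        (fun x => weight m x * f (ext x.2 (n + 1))) x
      = ∑ ω, m.prior ω * ((∑ x, bern (m.success ω) x * f x) * v ω) := by
    intro f
    rw [Fintype.sum_prod_type]
    refine Finset.sum_congr rfl fun ω _ => ?_
    rw [hv]
    simp only
    rw [hE, ← sum_play_mul (N := n + 2) (by omega), Finset.mul_sum]
    refine Finset.sum_congr rfl fun t _ => ?_
    by_cases ht : (play (prePolicy m n) (ext t) (n + 1)).head? = r
    · rw [Set.indicator_of_mem (by exact ht), ind_of ht, weight]; ring
    · rw [Set.indicator_of_notMem (by exact ht), ind_not ht]; ring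
  have hnum := key fun x => m.value (payoff .risky x)
  have hden := key fun _ => 1
  have h2 : ∀ p, ∑ x, bern p x * m.value (payoff .risky x) = p := fun p => by
    simp [bern, payoff, Model.value]
  simp only [h2] at hnum
  simp only [mul_one, bern_sum, one_mul] at hden
  have hv0 : ∀ ω, 0 ≤ v ω := fun ω =>
    expect_nonneg (hm.success_pos ω).le (hm.success_lt ω).le fun _ _ _ => ind_nonneg _
  rw [successorMean, condMean, hnum]
  unfold prob
  rw [hden, preGain]
  change _ ↔ 0 < gain m m.b v
  have hH := hm.prior_pos .H
  have hL := hm.prior_pos .L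
  have e : gain m m.b v = ∑ ω, m.prior ω * (m.success ω * v ω) - m.b * ∑ ω, m.prior ω * v ω := by
    simp only [gain, sum_state]; ring
  -- On a null event the quotient is 0 by convention; as 0 < `m.b`, both sides of the equivalence
  -- are then false.
  rcases (show 0 ≤ ∑ ω, m.prior ω * v ω from Finset.sum_nonneg fun ω _ =>
    mul_nonneg (hm.prior_pos ω).le (hv0 ω)).eq_or_lt with h0 | h0
  · have hz : ∀ ω, v ω = 0 := fun ω => by
      have := (Finset.sum_eq_zero_iff_of_nonneg (fun ω _ =>
        mul_nonneg (hm.prior_pos ω).le (hv0 ω))).1 h0.symm ω (Finset.mem_univ _)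
      exact (mul_eq_zero.1 this).resolve_left (hm.prior_pos ω).ne'
    rw [← h0, e]
    simp [hz, hm.b_pos.le]
  · rw [lt_div_iff₀ h0, e, sub_pos]

lemma preArm_eq_risky_iff (hm : m.Standing) {past : List Reward} (h : past ≠ []) :
    preArm m past = .risky ↔ 0 < preGain m past.length past.head? := by
  obtain ⟨n, hn⟩ : ∃ n, past.length = n + 1 := ⟨past.length - 1, by
    have := List.length_pos_iff.2 h; omega⟩
  rw [preArm, hn, prePolicy, if_neg (by omega), ← successorMean_lt_iff hm]
  split_ifs with h1 <;> simp [h1]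

lemma preArm_nil : preArm m [] = .risky := rfl

lemma Arm.ne_risky {a : Arm} : a ≠ .risky ↔ a = .safe := by cases a <;> simp

lemma ind_head_split (n : ℕ) (hn : n ≠ 0) (p : ℝ) (act : List Reward → Arm)
    (Φ : List Reward → Prop) :
    expect p act n (fun h => ind (Φ h))
      = expect p act n (fun h => ind (h.head? = some .zero ∧ Φ h))
      + expect p act n (fun h => ind (h.head? = some .one ∧ Φ h))
      + expect p act n (fun h => ind (h.head? = some .safe ∧ Φ h)) := by
  rw [← expect_add, ← expect_add]
  refine expect_congr fun l _ hl => ?_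
  rcases l with _ | ⟨_ | _ | _, l⟩
  · simp at hl; omega
  all_goals simp

/-- The reward b only tells that the predecessor preferred the safe arm. The gain is therefore the
sum of the predecessor's own gains over the rewards that made her choose it, and each of those is
nonpositive. -/
lemma preGain_safe_nonpos (hm : m.Standing) (n : ℕ) : preGain m (n + 1) (some .safe) ≤ 0 := by
  have h1 : ∀ ω, expect (m.success ω) (preArm m) (n + 1) (fun h => ind (h.head? = some .safe))
      = expect (m.success ω) (preArm m) n (fun h => ind (preArm m h = .safe)) := fun ω =>
    expect_succ fun l _ _ => by cases h : preArm m l <;> simp [payoff, ind]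
  rcases Nat.eq_zero_or_pos n with rfl | hn
  · rw [preGain, gain_eq, h1, h1]
    simp [expect, preArm_nil, ind]
  -- At a fixed stage the choice is determined by the preceding reward, by the sign of a gain that
  -- does not involve the state.
  · have h2 : ∀ ω, ∀ r, expect (m.success ω) (preArm m) n
        (fun h => ind (h.head? = r ∧ preArm m h = .safe))
        = ind (preGain m n r ≤ 0) *
          expect (m.success ω) (preArm m) n fun h => ind (h.head? = r) := fun ω r => by
      rw [← expect_mul]
      refine expect_congr fun l _ hl => ?_
      rw [ind_and_mul, mul_comm]
      by_cases hr : l.head? = r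
      · congr 2
        rw [← hr, ← hl, ← Arm.ne_risky, ne_eq, preArm_eq_risky_iff hm, not_lt]
        rintro rfl; simp at hl; omega
      · rw [ind_not hr]; simp
    have h3 : ∀ r, ind (preGain m n r ≤ 0) * preGain m n r ≤ 0 := fun r => by
      by_cases hr : preGain m n r ≤ 0
      · rw [ind_of hr]; linarith
      · rw [ind_not hr]; simp
    have e : preGain m (n + 1) (some .safe)
        = ind (preGain m n (some .zero) ≤ 0) * preGain m n (some .zero)
        + ind (preGain m n (some .one) ≤ 0) * preGain m n (some .one)
        + ind (preGain m n (some .safe) ≤ 0) * preGain m n (some .safe) := by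
      conv_lhs => rw [preGain, gain_eq]
      rw [h1, h1, ind_head_split n hn.ne' (m.success .H), ind_head_split n hn.ne' (m.success .L)]
      simp only [h2]
      conv_rhs => enter [1, 1, 2]; rw [preGain, gain_eq]
      conv_rhs => enter [1, 2, 2]; rw [preGain, gain_eq]
      conv_rhs => enter [2, 2]; rw [preGain, gain_eq]
      ring
    rw [e]
    have := h3 (some .zero); have := h3 (some .one); have := h3 (some .safe)
    linarith

lemma preArm_safe_cons (hm : m.Standing) (h : List Reward) : preArm m (.safe :: h) = .safe := by
  rw [← Arm.ne_risky, ne_eq, preArm_eq_risky_iff hm (by simp), not_lt]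
  exact preGain_safe_nonpos hm _

/-! ### Runs of the risky arm without intervention -/

/-- All rewards come from the risky arm. -/
def AllRisky (h : List Reward) : Prop := ∀ s ∈ h, s.arm = .risky

lemma allRisky_cons {r : Reward} {h : List Reward} :
    AllRisky (r :: h) ↔ r.arm = .risky ∧ AllRisky h := by simp [AllRisky]

lemma allRisky_of_preArm (hm : m.Standing) {h : List Reward} (ho : Obedient (preArm m) h)
    (h1 : preArm m h = .risky) : AllRisky h := by
  induction h with
  | nil => simp [AllRisky]
  | cons r l ih =>
    have hr : r.arm = .risky := by
      cases r
      · rfl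
      · rfl
      · rw [preArm_safe_cons hm] at h1; simp at h1
    exact allRisky_cons.2 ⟨hr, ih ho.2 (ho.1 ▸ hr)⟩

/-- Once an agent without intervention pulls the safe arm, all later ones do. -/
lemma allRisky_iff (hm : m.Standing) {r : Reward} {l : List Reward}
    (ho : Obedient (preArm m) (r :: l)) : AllRisky (r :: l) ↔ r.arm = .risky := by
  rw [allRisky_cons]
  exact ⟨fun h => h.1, fun h => ⟨h, allRisky_of_preArm hm ho.2 (ho.1 ▸ h)⟩⟩

/-- Probability that the first `n` agents all pull the risky arm without intervention. -/
def preRisky (m : Model) (n : ℕ) (ω : State) : ℝ :=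
  expect (m.success ω) (preArm m) n fun h => ind (AllRisky h)

lemma preRisky_succ (hm : m.Standing) (n : ℕ) (ω : State) :
    preRisky m (n + 1) ω
      = expect (m.success ω) (preArm m) n fun h => ind (preArm m h = .risky) := by
  refine expect_succ_of_tail fun r l ho _ => ?_
  rw [ho.1.symm]
  congr 1
  exact propext (allRisky_iff hm ho)

lemma preRisky_zero (ω : State) : preRisky m 0 ω = 1 := by simp [preRisky, expect, AllRisky, ind]

lemma preRisky_one (hm : m.Standing) (ω : State) : preRisky m 1 ω = 1 := by
  rw [preRisky_succ hm]; simp [expect, preArm_nil, ind]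

lemma pre_head (hm : m.Standing) (n : ℕ) (ω : State) (x : Bool) :
    expect (m.success ω) (preArm m) (n + 1) (fun h => ind (h.head? = some (payoff .risky x)))
      = bern (m.success ω) x * preRisky m (n + 1) ω := by
  have := sum_risky_first (m.success ω) (preArm m) n x fun _ => True
  simpa [preRisky_succ hm] using this

lemma preGain_zero (hm : m.Standing) (n : ℕ) : preGain m (n + 1) (some .zero)
    = m.q * (m.pH - m.b) * ((1 - m.pH) * preRisky m (n + 1) .H)
      - (1 - m.q) * (m.b - m.pL) * ((1 - m.pL) * preRisky m (n + 1) .L) := by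
  have h := fun ω => pre_head hm n ω false
  simp only [payoff] at h
  rw [preGain, gain_eq, h, h]; simp [bern, Model.success]

lemma preGain_one (hm : m.Standing) (n : ℕ) : preGain m (n + 1) (some .one)
    = m.q * (m.pH - m.b) * (m.pH * preRisky m (n + 1) .H)
      - (1 - m.q) * (m.b - m.pL) * (m.pL * preRisky m (n + 1) .L) := by
  have h := fun ω => pre_head hm n ω true
  simp only [payoff] at h
  rw [preGain, gain_eq, h, h]; simp [bern, Model.success]

lemma preRisky_nonneg (hm : m.Standing) (n : ℕ) (ω : State) : 0 ≤ preRisky m n ω :=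
  expect_nonneg (hm.success_pos ω).le (hm.success_lt ω).le fun _ _ _ => ind_nonneg _

/-- The prior gain splits into a part from all-risky histories and a part from histories ending with
b. The latter is nonpositive. -/
lemma preRisky_gain (hm : m.Standing) (n : ℕ) :
    m.q * (m.pH - m.b) - (1 - m.q) * (m.b - m.pL)
      ≤ m.q * (m.pH - m.b) * preRisky m n .H - (1 - m.q) * (m.b - m.pL) * preRisky m n .L := by
  cases n with
  | zero => simp [preRisky_zero]
  | succ n =>
    have h := preGain_safe_nonpos hm n
    have h0 : ∀ ω, expect (m.success ω) (preArm m) (n + 1) (fun h => ind (h.head? = some .safe))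
        = 1 - preRisky m (n + 1) ω := fun ω => by
      have h1 := ind_head_split (n + 1) (by simp) (m.success ω) (preArm m) fun _ => True
      have h2 := pre_head hm n ω true
      have h3 := pre_head hm n ω false
      simp only [payoff, bern] at h2 h3
      simp only [and_true, ind_of trivial, expect_const] at h1
      simp at h3 h2
      rw [h2, h3] at h1
      linarith
    rw [preGain, gain_eq, h0, h0] at h
    linarith

/-- All-risky histories have positive gain by `preRisky_gain`. A success multiplies the term of H by
pH and the term of L by the smaller pL. -/
lemma preGain_one_pos (hm : m.Standing) (n : ℕ) : 0 < preGain m (n + 1) (some .one) := by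
  rw [preGain_one hm]
  have h := preRisky_gain hm (n + 1)
  have h1 := hm.prior_mean
  have h2 := preRisky_nonneg hm (n + 1) .H
  have h3 := hm.pL_pos; have h4 := hm.pL_lt; have h5 := hm.lt_pH
  have h6 : 0 ≤ m.q * (m.pH - m.b) * preRisky m (n + 1) .H :=
    mul_nonneg (mul_nonneg hm.q_pos.le (by linarith)) h2
  nlinarith

/-- A reward 1 always leads to the risky arm and b never does, so only the reaction to 0 is open; it
is the same in both states. -/
lemma preRisky_step (hm : m.Standing) (n : ℕ) :
    (0 < preGain m (n + 1) (some .zero) ∧ ∀ ω, preRisky m (n + 2) ω = preRisky m (n + 1) ω) ∨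
    (preGain m (n + 1) (some .zero) ≤ 0 ∧
      ∀ ω, preRisky m (n + 2) ω = m.success ω * preRisky m (n + 1) ω) := by
  have h1 : ∀ ω, preRisky m (n + 2) ω = m.success ω * preRisky m (n + 1) ω
      + ind (0 < preGain m (n + 1) (some .zero)) *
        ((1 - m.success ω) * preRisky m (n + 1) ω) := fun ω => by
    have h2 := pre_head hm n ω true
    have h3 := pre_head hm n ω false
    simp only [payoff, bern] at h2 h3
    simp at h2 h3
    rw [preRisky_succ hm, ← h2, ← h3, ← expect_mul, ← expect_add]
    refine expect_congr fun l _ hl => ?_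
    rcases l with _ | ⟨_ | _ | _, l⟩
    · simp at hl
    · have := preArm_eq_risky_iff hm (past := .zero :: l) (by simp)
      rw [hl] at this
      simp [this, ind]
    · have := (preArm_eq_risky_iff hm (past := .one :: l) (by simp)).2
        (hl ▸ preGain_one_pos hm n)
      simp [this, ind]
    · simp [preArm_safe_cons hm, ind]
  by_cases h0 : 0 < preGain m (n + 1) (some .zero)
  · refine Or.inl ⟨h0, fun ω => ?_⟩
    rw [h1, ind_of h0]; ring
  · refine Or.inr ⟨not_lt.1 h0, fun ω => ?_⟩
    rw [h1, ind_not h0]; ring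

lemma preRisky_eq_pow (hm : m.Standing) (n : ℕ) :
    ∃ k : ℕ, ∀ ω, preRisky m n ω = m.success ω ^ k := by
  rcases n with _ | n
  · exact ⟨0, fun ω => by simp [preRisky_zero]⟩
  induction n with
  | zero => exact ⟨0, fun ω => by simp [preRisky_one hm]⟩
  | succ n ih =>
    obtain ⟨k, hk⟩ := ih
    rcases preRisky_step hm n with ⟨_, h⟩ | ⟨_, h⟩
    · exact ⟨k, fun ω => by rw [h, hk]⟩
    · exact ⟨k + 1, fun ω => by rw [h, hk, pow_succ, mul_comm]⟩

/-- Either everybody pulls the risky arm without intervention, in both states, or the safe arm has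
a probability in state `H` that is bounded below. -/
lemma preRisky_dichotomy (hm : m.Standing) (n : ℕ) :
    (∀ ω, preRisky m n ω = 1) ∨ preRisky m n .H ≤ m.pH := by
  obtain ⟨k, hk⟩ := preRisky_eq_pow hm n
  rcases k with _ | k
  · exact Or.inl fun ω => by simp [hk]
  · right
    rw [hk]
    have h0 := hm.success_pos .H
    have h1 := hm.success_lt .H
    calc m.success .H ^ (k + 1) ≤ m.success .H ^ 1 :=
          pow_le_pow_of_le_one h0.le h1.le (by omega)
      _ = m.pH := by simp [Model.success]

/-- The risky arm is pulled without intervention at any stage with a probability in state `L` that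
is bounded below. -/
lemma exists_preRisky_ge (hm : m.Standing) : ∃ c, 0 < c ∧ ∀ n, c ≤ preRisky m n .L := by
  have h1 := hm.prior_mean
  have h3 := hm.pL_pos; have h4 := hm.pL_lt; have h5 := hm.lt_pH; have h6 := hm.pH_lt
  have h7 := hm.q_pos; have h8 := hm.q_lt
  have hl : 0 < (1 - m.q) * (m.b - m.pL) := mul_pos (by linarith) (by linarith)
  set l := (1 - m.q) * (m.b - m.pL) with hldef
  have hd : 0 < m.q * (m.pH - m.b) - l := by rw [hldef]; linarith
  set d := m.q * (m.pH - m.b) - l with hddef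
  -- If a reward 0 leads to the safe arm, the gain after 0 is nonpositive. Together with
  -- `preRisky_gain` this gives `l * preRisky m (n + 1) .L ≥ θ`.
  set θ := (1 - m.pH) * d / (1 - m.pL) with hθ
  have hL1 : 0 < 1 - m.pL := by linarith
  have hH1 : 0 < 1 - m.pH := by linarith
  have hθ0 : 0 < θ := by positivity
  -- The bound does not deteriorate with n: a factor pL is lost only when the previous value is at
  -- least θ.
  have key : ∀ n, min (m.pL * θ) l ≤ l * preRisky m (n + 1) .L := fun n => by
    induction n with
    | zero => simp [preRisky_one hm]
    | succ n ih =>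
      rcases preRisky_step hm n with ⟨_, h⟩ | ⟨h0, h⟩
      · rw [h]; exact ih
      · refine (min_le_left _ _).trans ?_
        rw [h, mul_left_comm]
        refine mul_le_mul_of_nonneg_left ?_ h3.le
        rw [hθ, div_le_iff₀ hL1]
        rw [preGain_zero hm] at h0
        have h9 := preRisky_gain hm (n + 1)
        have h10 := preRisky_nonneg hm (n + 1) .L
        have : (1 - m.pH) * d ≤ (1 - m.pH) * (m.q * (m.pH - m.b) * preRisky m (n + 1) .H) := by
          refine mul_le_mul_of_nonneg_left ?_ hH1.le
          have : 0 ≤ l * preRisky m (n + 1) .L := by positivity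
          linarith
        linarith
  refine ⟨min (m.pL * θ) l / l, by positivity, fun n => ?_⟩
  rw [div_le_iff₀ hl, mul_comm (preRisky m n .L)]
  cases n with
  | zero => simp [preRisky_zero]
  | succ n => exact key n

/-! ### The innkeeper mediator along a history -/

/-- The memory and the message after the given rewards. -/
def after (m : Model) (β : ℝ) (K : ℕ) (ν : ℕ → Reward → ℝ) (cf : Bool) (h : List Reward) :
    Memory × Message :=
  step m β K ν cf (memory m β K ν cf h) h

/-- The recommended arm after the given rewards. -/
def advice (m : Model) (β : ℝ) (K : ℕ) (ν : ℕ → Reward → ℝ) (cf : Bool) (h : List Reward) : Arm :=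
  (after m β K ν cf h).2.arm

/-- One stage of the switching phase, after the reward `r`. -/
def switchStep (m : Model) (β : ℝ) (K : ℕ) (mem : Memory) : Reward → Memory × Message
  | .one => (mem.sample m K .one, ⟨.risky, .switching, 0⟩)
  | .zero => ((mem.sample m K .zero).switch, ⟨.safe, .switching, β / (2 * K)⟩)
  | .safe => ((mem.sample m K .safe).switch, ⟨.risky, .switching, β / (2 * K)⟩)

/-- The arm exploited after the switching phase. -/
def verdict (m : Model) (K : ℕ) (mem : Memory) : Arm :=
  open Classical in if (m.pH + m.pL) / 2 ≤ mem.rSum / K then .risky else .safe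

/-- The criterion for immediate exploitation, evaluated at the first `K` rewards. -/
def Early (m : Model) (K : ℕ) (cf : Bool) (h : List Reward) : Prop :=
  (AllRisky h ∧ (m.pH + m.pL) / 2 ≤ (h.map m.value).sum / K) ∧ cf = false

/-- The first `K` rewards of a history. -/
def base (K : ℕ) (h : List Reward) : List Reward := h.drop (h.length - K)

lemma base_cons {K : ℕ} {r : Reward} {h : List Reward} (hK : K ≤ h.length) :
    base K (r :: h) = base K h := by
  have : (r :: h).length - K = (h.length - K) + 1 := by simp; omega
  rw [base, this, List.drop_succ_cons, base]

lemma base_self {K : ℕ} {h : List Reward} (hK : h.length = K) : base K h = h := by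
  simp [base, hK]

section

variable {m : Model} {β : ℝ} {K : ℕ} {ν : ℕ → Reward → ℝ} {cf : Bool}

lemma step_deviated (mem : Memory) (h : List Reward) :
    (step m β K ν cf mem h).1.deviated = mem.deviated := by
  rcases h with _ | ⟨r, h⟩
  · rfl
  · rcases h1 : mem.exploit with _ | a
    · cases r <;> simp only [step, h1, Memory.sample, Memory.switch] <;> split_ifs <;> rfl
    · simp [step, h1]

/-- The flag is set at every mismatch and never cleared. This includes the exploitation phase, where
it has no effect on the messages. -/
lemma obedient_iff (h : List Reward) :
    Obedient (advice m β K ν cf) h ↔ (memory m β K ν cf h).deviated = false := by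
  induction h with
  | nil => simp [Obedient, memory, Memory.init]
  | cons r h ih =>
    rw [Obedient, ih]
    simp only [memory, step_deviated, advice, after, Bool.or_eq_false_iff, decide_eq_false_iff_not,
      not_not]
    exact and_comm

lemma after_deviated {h : List Reward} (ho : Obedient (advice m β K ν cf) h) :
    (after m β K ν cf h).1.deviated = false := by
  rw [after, step_deviated]; exact (obedient_iff h).1 ho

lemma memory_cons {r : Reward} {h : List Reward} (ho : Obedient (advice m β K ν cf) (r :: h)) :
    memory m β K ν cf (r :: h) = (after m β K ν cf h).1 := by
  have h1 : (after m β K ν cf h).1.deviated = false := after_deviated ho.2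
  have h2 : r.arm = (after m β K ν cf h).2.arm := ho.1
  have : memory m β K ν cf (r :: h) = { (after m β K ν cf h).1 with
    deviated := (after m β K ν cf h).1.deviated || decide (r.arm ≠ (after m β K ν cf h).2.arm) } :=
    rfl
  rw [this, h1, ← h2]
  simp [← h1]

lemma memory_of_length_le {h : List Reward} (ho : Obedient (advice m β K ν cf) h)
    (hK : h.length ≤ K) : memory m β K ν cf h = Memory.init ∧
      (h.length < K → after m β K ν cf h = (Memory.init, ⟨preArm m h, .preIntervention, 0⟩)) := by
  induction h with
  | nil => exact ⟨rfl, fun _ => rfl⟩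
  | cons r h ih =>
    have h1 : memory m β K ν cf (r :: h) = Memory.init := by
      rw [memory_cons ho, (ih ho.2 (by simp at hK; omega)).2 (by simp at hK; omega)]
    refine ⟨h1, fun hlt => ?_⟩
    rw [after, h1]
    simp only [step, Memory.init]
    rw [if_pos hlt]
    rfl

lemma after_of_length_lt {h : List Reward} (ho : Obedient (advice m β K ν cf) h)
    (hK : h.length < K) :
    after m β K ν cf h = (Memory.init, ⟨preArm m h, .preIntervention, 0⟩) :=
  (memory_of_length_le ho hK.le).2 hK

lemma after_of_length_eq {r : Reward} {h : List Reward}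
    (ho : Obedient (advice m β K ν cf) (r :: h)) (hK : (r :: h).length = K) :
    (Early m K cf (r :: h) → after m β K ν cf (r :: h)
      = ({ Memory.init with exploit := some .risky }, ⟨.risky, .exploitation, 0⟩)) ∧
    (¬ Early m K cf (r :: h) → after m β K ν cf (r :: h) = switchStep m β K Memory.init r) := by
  have h0 : 0 < 2 * K := by simp at hK; omega
  rw [after, (memory_of_length_le ho hK.le).1]
  constructor
  · intro he
    have hx : Memory.init.exploit = none := rfl
    have hd : ¬ Memory.init.deviated = true := by simp [Memory.init]
    have hs : Memory.init.switches < 2 * K := h0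
    simp only [step, hx]
    rw [if_neg hd, if_neg (by omega), if_pos ⟨hK, he.1.1, he.1.2, he.2⟩]
  · intro he
    have hx : Memory.init.exploit = none := rfl
    have hd : ¬ Memory.init.deviated = true := by simp [Memory.init]
    have hs : Memory.init.switches < 2 * K := h0
    simp only [step, hx]
    rw [if_neg hd, if_neg (by omega),
      if_neg (fun h => he ⟨⟨h.2.1, h.2.2.1⟩, h.2.2.2⟩), if_pos hs]
    cases r <;> rfl

lemma after_cons {r : Reward} {h : List Reward} (ho : Obedient (advice m β K ν cf) (r :: h))
    (hK : K ≤ h.length) :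
    (∀ a, (after m β K ν cf h).1.exploit = some a →
      after m β K ν cf (r :: h) = ((after m β K ν cf h).1, ⟨a, .exploitation, 0⟩)) ∧
    ((after m β K ν cf h).1.exploit = none →
      ((after m β K ν cf h).1.switches < 2 * K →
        after m β K ν cf (r :: h) = switchStep m β K (after m β K ν cf h).1 r) ∧
      (¬ (after m β K ν cf h).1.switches < 2 * K →
        after m β K ν cf (r :: h)
          = ({ (after m β K ν cf h).1 with exploit := some (verdict m K (after m β K ν cf h).1) },
            ⟨verdict m K (after m β K ν cf h).1, .exploitation, 0⟩))) := by
  have h1 : after m β K ν cf (r :: h) = step m β K ν cf (after m β K ν cf h).1 (r :: h) := by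
    rw [after, memory_cons ho]
  have hd := after_deviated ho.2
  rw [h1]
  set mem := (after m β K ν cf h).1
  constructor
  · intro a ha
    simp [step, ha]
  · intro hn
    constructor
    · intro hs
      simp only [step, hn]
      rw [if_neg (by simp [hd]), if_neg (by simp; omega), if_neg (by simp; omega), if_pos hs]
      cases r <;> rfl
    · intro hs
      simp only [step, hn]
      rw [if_neg (by simp [hd]), if_neg (by simp; omega), if_neg (by simp; omega), if_neg hs,
        verdict]
      split_ifs <;> rfl

/-! ### Counting messages -/

/-- Number of messages of the switching phase that follow the reward `r`. -/
def switchCount (m : Model) (β : ℝ) (K : ℕ) (ν : ℕ → Reward → ℝ) (cf : Bool) (r : Reward) :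
    List Reward → ℝ :=
  cumul fun h => ind ((after m β K ν cf h).2.phase = .switching ∧ h.head? = some r)

/-- Number of messages of the exploitation phase that recommend the arm `a` to agents whose
predecessor pulled the other arm. -/
def turnCount (m : Model) (β : ℝ) (K : ℕ) (ν : ℕ → Reward → ℝ) (cf : Bool) (a : Arm) :
    List Reward → ℝ :=
  cumul fun h => ind ((after m β K ν cf h).2 = ⟨a, .exploitation, 0⟩ ∧
    ∃ r, h.head? = some r ∧ r.arm ≠ a)

/-- The relation between the number of switches, their distribution over the two kinds, and the
recommended arm, when the last agent before the switching phase pulled `start`. -/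
def Balanced (start : Arm) (s : ℕ) (zeros safes : ℝ) (arm : Arm) : Prop :=
  ∃ k : ℕ, (s = 2 * k ∧ zeros = k ∧ safes = k ∧ arm = start) ∨
    (s = 2 * k + 1 ∧ start = .risky ∧ arm = .safe ∧ zeros = k + 1 ∧ safes = k) ∨
    (s = 2 * k + 1 ∧ start = .safe ∧ arm = .risky ∧ zeros = k ∧ safes = k + 1)

/-- What is known at an obedient history of length at least `K`. -/
inductive Regime (m : Model) (β : ℝ) (K : ℕ) (ν : ℕ → Reward → ℝ) (cf : Bool) (start : Arm)
    (h : List Reward) : Prop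
  | early (he : Early m K cf (base K h)) (hs : start = .risky)
      (hx : (after m β K ν cf h).1.exploit = some .risky)
      (hg : (after m β K ν cf h).2 = ⟨.risky, .exploitation, 0⟩)
      (hc : ∀ r, switchCount m β K ν cf r h = 0) (ht : ∀ a, turnCount m β K ν cf a h = 0)
      (hr : (after m β K ν cf h).1.rCount ≤ K)
  | switching (he : ¬ Early m K cf (base K h)) (hx : (after m β K ν cf h).1.exploit = none)
      (hg : (after m β K ν cf h).2.phase = .switching)
      (hs : (after m β K ν cf h).1.switches ≤ 2 * K)
      (hb : Balanced start (after m β K ν cf h).1.switches (switchCount m β K ν cf .zero h)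
        (switchCount m β K ν cf .safe h) (after m β K ν cf h).2.arm)
      (ht : ∀ a, turnCount m β K ν cf a h = 0)
      (hr : (after m β K ν cf h).1.rCount ≤ K)
      (hz : (after m β K ν cf h).1.rCount = K ∨
        switchCount m β K ν cf .zero h ≤ (after m β K ν cf h).1.rCount)
  | exploiting (a : Arm) (he : ¬ Early m K cf (base K h))
      (hx : (after m β K ν cf h).1.exploit = some a)
      (hg : (after m β K ν cf h).2 = ⟨a, .exploitation, 0⟩)
      (hz : switchCount m β K ν cf .zero h = K) (hw : switchCount m β K ν cf .safe h = K)
      (ht : ∀ a', turnCount m β K ν cf a' h = ind (a' = a ∧ start ≠ a))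
      (hr : (after m β K ν cf h).1.rCount = K)
      (ha : a = verdict m K (after m β K ν cf h).1)

/-! ### Counters in the switching phase -/

lemma cumul_eq_zero {f : List Reward → ℝ} {act : List Reward → Arm} {h : List Reward}
    (ho : Obedient act h) (hf : ∀ l, Obedient act l → l.length ≤ h.length → f l = 0) :
    cumul f h = 0 := by
  induction h with
  | nil => exact hf [] trivial le_rfl
  | cons r h ih =>
    rw [cumul, hf _ ho le_rfl, ih ho.2 fun l h1 h2 => hf l h1 (by simp; omega), add_zero]

lemma switchCount_of_length_lt {h : List Reward} (ho : Obedient (advice m β K ν cf) h)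
    (hK : h.length < K) (r : Reward) : switchCount m β K ν cf r h = 0 :=
  cumul_eq_zero ho fun l hl h1 => by
    rw [after_of_length_lt hl (by omega)]; simp

lemma turnCount_of_length_lt {h : List Reward} (ho : Obedient (advice m β K ν cf) h)
    (hK : h.length < K) (a : Arm) : turnCount m β K ν cf a h = 0 :=
  cumul_eq_zero ho fun l hl h1 => by
    rw [after_of_length_lt hl (by omega)]; simp

lemma switchCount_cons (r s : Reward) (h : List Reward) :
    switchCount m β K ν cf s (r :: h)
      = ind ((after m β K ν cf (r :: h)).2.phase = .switching ∧ r = s)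
        + switchCount m β K ν cf s h := by
  simp [switchCount, cumul]

lemma turnCount_cons (r : Reward) (a : Arm) (h : List Reward) :
    turnCount m β K ν cf a (r :: h)
      = ind ((after m β K ν cf (r :: h)).2 = ⟨a, .exploitation, 0⟩ ∧ r.arm ≠ a)
        + turnCount m β K ν cf a h := by
  simp [turnCount, cumul]

lemma switchStep_phase (mem : Memory) (r : Reward) :
    (switchStep m β K mem r).2.phase = .switching := by cases r <;> rfl

lemma sample_exploit (mem : Memory) (r : Reward) :
    (mem.sample m K r).exploit = mem.exploit := by unfold Memory.sample; split_ifs <;> rfl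

lemma sample_switches (mem : Memory) (r : Reward) :
    (mem.sample m K r).switches = mem.switches := by unfold Memory.sample; split_ifs <;> rfl

lemma switchStep_exploit (mem : Memory) (r : Reward) :
    (switchStep m β K mem r).1.exploit = mem.exploit := by
  cases r <;> simp [switchStep, Memory.switch, sample_exploit]

lemma switchStep_sample (mem : Memory) (r : Reward) :
    (switchStep m β K mem r).1.rCount = (mem.sample m K r).rCount ∧
    (switchStep m β K mem r).1.rSum = (mem.sample m K r).rSum := by
  cases r <;> simp [switchStep, Memory.switch]

lemma sample_rCount_le {mem : Memory} {r : Reward} (h : mem.rCount ≤ K) :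
    (mem.sample m K r).rCount ≤ K := by
  unfold Memory.sample; split_ifs with h1
  · exact h1.1
  · exact h

lemma sample_rCount_zero {mem : Memory} (h : mem.rCount ≤ K) :
    (mem.sample m K .zero).rCount = K ∨ (mem.sample m K .zero).rCount = mem.rCount + 1 := by
  unfold Memory.sample
  by_cases h1 : mem.rCount < K
  · right; simp [h1, Reward.arm]
  · left; simp [h1]; omega

/-- The effect of a stage of the switching phase on the balance. -/
lemma Balanced.step {start : Arm} {mem : Memory} {r : Reward} {z w : ℝ}
    (h : Balanced start mem.switches z w r.arm) :
    Balanced start (switchStep m β K mem r).1.switches (ind (r = .zero) + z) (ind (r = .safe) + w)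
      (switchStep m β K mem r).2.arm := by
  obtain ⟨k, ⟨hs, hz, hw, ha⟩ | ⟨hs, hst, ha, hz, hw⟩ | ⟨hs, hst, ha, hz, hw⟩⟩ := h
  · cases r
    · refine ⟨k, Or.inr (Or.inl ?_)⟩
      simp [switchStep, Memory.switch, sample_switches, hs, hz, hw, ← ha, Reward.arm, add_comm]
    · refine ⟨k, Or.inl ?_⟩
      simp [switchStep, sample_switches, hs, hz, hw, ← ha, Reward.arm]
    · refine ⟨k, Or.inr (Or.inr ?_)⟩
      simp [switchStep, Memory.switch, sample_switches, hs, hz, hw, ← ha, Reward.arm, add_comm]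
  · cases r
    · simp [Reward.arm] at ha
    · simp [Reward.arm] at ha
    · refine ⟨k + 1, Or.inl ?_⟩
      simp [switchStep, Memory.switch, sample_switches, hs, hz, hw, hst, add_comm]; omega
  · cases r
    · refine ⟨k + 1, Or.inl ?_⟩
      simp [switchStep, Memory.switch, sample_switches, hs, hz, hw, hst, add_comm]; omega
    · refine ⟨k, Or.inr (Or.inr ?_)⟩
      simp [switchStep, sample_switches, hs, hz, hw, hst]
    · simp [Reward.arm] at ha

lemma switchStep_switches_le {mem : Memory} {r : Reward} (h : mem.switches < 2 * K) :
    (switchStep m β K mem r).1.switches ≤ 2 * K := by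
  cases r <;> simp [switchStep, Memory.switch, sample_switches] <;> omega

/-- Every 0 that causes a switch is also recorded while the sample is incomplete. Hence K such zeros
force a full sample of K rewards. -/
lemma rCount_step {mem : Memory} {r : Reward} {z : ℝ} (h : mem.rCount ≤ K)
    (hz : mem.rCount = K ∨ z ≤ mem.rCount) :
    (switchStep m β K mem r).1.rCount = K ∨
      ind (r = .zero) + z ≤ (switchStep m β K mem r).1.rCount := by
  rw [(switchStep_sample mem r).1]
  rcases hz with hz | hz
  · left
    unfold Memory.sample
    rw [if_neg (by omega), hz]
  · by_cases hr : r = .zero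
    · subst hr
      rcases sample_rCount_zero (m := m) h with h1 | h1
      · exact Or.inl h1
      · right; rw [h1]; push_cast; simp; linarith
    · right
      rw [ind_not hr, zero_add]
      refine hz.trans ?_
      unfold Memory.sample
      split_ifs
      · push_cast; linarith
      · exact le_rfl

lemma verdict_congr {mem mem' : Memory} (h : mem.rSum = mem'.rSum) :
    verdict m K mem = verdict m K mem' := by simp [verdict, h]

/-! ### Propagation of the regimes along obedient histories -/

lemma regime_of_length_eq {r : Reward} {h : List Reward}
    (ho : Obedient (advice m β K ν cf) (r :: h)) (hK : (r :: h).length = K) :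
    Regime m β K ν cf r.arm (r :: h) := by
  have hlt : h.length < K := by simp at hK; omega
  have hc := switchCount_of_length_lt ho.2 hlt
  have ht := turnCount_of_length_lt ho.2 hlt
  have hA := after_of_length_eq ho hK
  by_cases he : Early m K cf (r :: h)
  · have hA := hA.1 he
    have hr : r.arm = .risky := he.1.1 r (by simp)
    refine .early (by rwa [base_self hK]) hr (by rw [hA]) (by rw [hA]) (fun s => ?_) (fun a => ?_)
      (by rw [hA]; simp [Memory.init])
    · rw [switchCount_cons, hc, hA]; simp
    · rw [turnCount_cons, ht, hA, hr]
      have : ¬ ((⟨.risky, .exploitation, 0⟩ : Message) = ⟨a, .exploitation, 0⟩ ∧ Arm.risky ≠ a) := by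
        rintro ⟨h1, h2⟩
        exact h2 (by simpa using h1)
      simp only [ind_not this, add_zero]
  · have hA := hA.2 he
    have hph : (after m β K ν cf (r :: h)).2.phase = .switching := by
      rw [hA, switchStep_phase]
    have hb : Balanced r.arm (Memory.init).switches 0 0 r.arm := ⟨0, Or.inl (by simp [Memory.init])⟩
    have hz := rCount_step (m := m) (β := β) (K := K) (mem := Memory.init) (r := r) (z := 0)
      (by simp [Memory.init]) (by simp [Memory.init])
    refine .switching (by rwa [base_self hK]) (by rw [hA, switchStep_exploit]; rfl) hph
      (by rw [hA]; exact switchStep_switches_le (by simp [Memory.init]; omega))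
      ?_ (fun a => ?_)
      (by rw [hA, (switchStep_sample _ _).1]; exact sample_rCount_le (by simp [Memory.init])) ?_
    · rw [switchCount_cons, switchCount_cons, hc, hc, hph, hA]
      simpa using hb.step
    · rw [turnCount_cons, ht]
      have : ¬ ((after m β K ν cf (r :: h)).2 = ⟨a, .exploitation, 0⟩ ∧ r.arm ≠ a) := by
        rintro ⟨h1, -⟩
        rw [h1] at hph; simp at hph
      rw [ind_not this, add_zero]
    · rw [switchCount_cons, hc, hph, hA]
      simpa using hz

lemma Regime.cons {start : Arm} {r : Reward} {h : List Reward}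
    (ho : Obedient (advice m β K ν cf) (r :: h)) (hK : K ≤ h.length)
    (H : Regime m β K ν cf start h) : Regime m β K ν cf start (r :: h) := by
  have hA := after_cons ho hK
  have hra : r.arm = (after m β K ν cf h).2.arm := ho.1
  cases H with
  | early he hs hx hg hc ht hr =>
    have hA := hA.1 _ hx
    rw [hg] at hra
    refine .early (by rwa [base_cons hK]) hs (by rw [hA, hx]) (by rw [hA]) (fun s => ?_)
      (fun a => ?_) (by rw [hA]; exact hr)
    · rw [switchCount_cons, hc, hA]; simp
    · rw [turnCount_cons, ht, hA, hra]
      have : ¬ ((⟨.risky, .exploitation, 0⟩ : Message) = ⟨a, .exploitation, 0⟩ ∧ Arm.risky ≠ a) := by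
        rintro ⟨h1, h2⟩
        exact h2 (by simpa using h1)
      simp only [ind_not this, add_zero]
  | exploiting a he hx hg hz hw ht hr ha =>
    have hA := hA.1 _ hx
    rw [hg] at hra
    refine .exploiting a (by rwa [base_cons hK]) (by rw [hA, hx]) (by rw [hA]) ?_ ?_
      (fun a' => ?_) (by rw [hA]; exact hr) (by rw [hA]; exact ha)
    · rw [switchCount_cons, hz, hA]; simp
    · rw [switchCount_cons, hw, hA]; simp
    · rw [turnCount_cons, ht, hA, hra]
      have : ¬ ((⟨a, .exploitation, 0⟩ : Message) = ⟨a', .exploitation, 0⟩ ∧ a ≠ a') := by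
        rintro ⟨h1, h2⟩
        exact h2 (by simpa using h1)
      simp only [ind_not this, zero_add]
  | switching he hx hg hs hb ht hr hz =>
    by_cases hlt : (after m β K ν cf h).1.switches < 2 * K
    · have hA := (hA.2 hx).1 hlt
      have hph : (after m β K ν cf (r :: h)).2.phase = .switching := by
        rw [hA, switchStep_phase]
      rw [← hra] at hb
      refine .switching (by rwa [base_cons hK]) (by rw [hA, switchStep_exploit, hx]) hph
        (by rw [hA]; exact switchStep_switches_le hlt) ?_ (fun a => ?_)
        (by rw [hA, (switchStep_sample _ _).1]; exact sample_rCount_le hr) ?_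
      · rw [switchCount_cons, switchCount_cons, hph, hA]
        simpa using hb.step
      · rw [turnCount_cons, ht]
        have : ¬ ((after m β K ν cf (r :: h)).2 = ⟨a, .exploitation, 0⟩ ∧ r.arm ≠ a) := by
          rintro ⟨h1, -⟩
          rw [h1] at hph; simp at hph
        rw [ind_not this, add_zero]
      · rw [switchCount_cons, hph, hA]
        simpa using rCount_step hr hz
    · have hA := (hA.2 hx).2 hlt
      -- Since 2K is even, only the first alternative of `Balanced` survives: both kinds of switches
      -- have occurred K times, and the current arm is again `start`.
      obtain ⟨hzK, hwK, hst⟩ : switchCount m β K ν cf .zero h = K ∧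
          switchCount m β K ν cf .safe h = K ∧ r.arm = start := by
        obtain ⟨k, ⟨h1, h2, h3, h4⟩ | ⟨h1, -⟩ | ⟨h1, -⟩⟩ := hb
        · have : k = K := by omega
          subst this
          exact ⟨h2, h3, hra.trans h4⟩
        · omega
        · omega
      refine .exploiting (verdict m K (after m β K ν cf h).1) (by rwa [base_cons hK]) (by rw [hA])
        (by rw [hA]) ?_ ?_ (fun a' => ?_) ?_ (by rw [hA]; exact verdict_congr rfl)
      · rw [switchCount_cons, hzK, hA]; simp
      · rw [switchCount_cons, hwK, hA]; simp
      · rw [turnCount_cons, ht, hA, hst, add_zero]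
        congr 1
        simp only [Message.mk.injEq, and_true, eq_iff_iff]
        constructor
        · rintro ⟨rfl, h2⟩; exact ⟨rfl, h2⟩
        · rintro ⟨rfl, h2⟩; exact ⟨rfl, h2⟩
      · rw [hA]
        show (after m β K ν cf h).1.rCount = K
        rcases hz with hz | hz
        · exact hz
        · rw [hzK] at hz
          have : K ≤ (after m β K ν cf h).1.rCount := by exact_mod_cast hz
          omega

/-- The arm pulled by the last of the first `K` agents. -/
def startArm (K : ℕ) (h : List Reward) : Arm :=
  match (base K h).head? with
  | some r => r.arm
  | none => .risky

lemma regime (hK0 : 0 < K) {h : List Reward} (ho : Obedient (advice m β K ν cf) h)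
    (hK : K ≤ h.length) : Regime m β K ν cf (startArm K h) h := by
  induction h with
  | nil => simp at hK; omega
  | cons r h ih =>
    rcases hK.eq_or_lt with h1 | h1
    · have : startArm K (r :: h) = r.arm := by rw [startArm, base_self h1.symm]; rfl
      rw [this]
      exact regime_of_length_eq ho h1.symm
    · have h2 : K ≤ h.length := by simp at h1; omega
      have : startArm K (r :: h) = startArm K h := by rw [startArm, base_cons h2]; rfl
      rw [this]
      exact (ih ho.2 h2).cons ho h2

end

/-! ### Consequences of the regimes -/

section

variable {m : Model} {β : ℝ} {K : ℕ} {ν : ℕ → Reward → ℝ} {cf : Bool} {p : ℝ} {n : ℕ}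

local notation "adv" => advice m β K ν cf
local notation "aft" => after m β K ν cf
local notation "cnt" => switchCount m β K ν cf

/-- Whether the next message belongs to the switching phase is settled before the next reward is
drawn. The martingale arguments rest on this predictability. -/
lemma phase_cons {r : Reward} {h : List Reward} (ho : Obedient adv (r :: h)) (hK : K ≤ h.length) :
    (aft (r :: h)).2.phase = .switching ↔
      (aft h).1.exploit = none ∧ (aft h).1.switches < 2 * K := by
  have hA := after_cons ho hK
  rcases hx : (aft h).1.exploit with _ | a
  · by_cases hs : (aft h).1.switches < 2 * K
    · simp [(hA.2 hx).1 hs, hs, switchStep_phase]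
    · simp [(hA.2 hx).2 hs, hs]
  · simp [hA.1 a hx]

/-- Whether the next reward is recorded is also settled before it is drawn, because obedience fixes
its arm. The selection therefore introduces no bias. -/
lemma sample_cons {r : Reward} {h : List Reward} (ho : Obedient adv (r :: h))
    (hK : K ≤ h.length) :
    (((aft h).1.exploit = none ∧ (aft h).1.switches < 2 * K ∧ (aft h).1.rCount < K) ∧
        r.arm = .risky → (aft (r :: h)).1.rCount = (aft h).1.rCount + 1 ∧
        (aft (r :: h)).1.rSum = (aft h).1.rSum + m.value r) ∧
    (¬ (((aft h).1.exploit = none ∧ (aft h).1.switches < 2 * K ∧ (aft h).1.rCount < K) ∧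
        r.arm = .risky) → (aft (r :: h)).1.rCount = (aft h).1.rCount ∧
        (aft (r :: h)).1.rSum = (aft h).1.rSum) := by
  have hA := after_cons ho hK
  rcases hx : (aft h).1.exploit with _ | a
  · by_cases hs : (aft h).1.switches < 2 * K
    · rw [(hA.2 hx).1 hs, (switchStep_sample _ _).1, (switchStep_sample _ _).2]
      constructor
      · rintro ⟨⟨-, -, h1⟩, h2⟩
        simp [Memory.sample, h1, h2]
      · intro hn
        unfold Memory.sample
        rw [if_neg fun h1 => hn ⟨⟨rfl, hs, h1.1⟩, h1.2⟩]
        exact ⟨rfl, rfl⟩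
    · rw [(hA.2 hx).2 hs]
      exact ⟨fun h1 => absurd h1.1.2.1 hs, fun _ => ⟨rfl, rfl⟩⟩
  · rw [hA.1 a hx]
    exact ⟨fun h1 => absurd h1.1.1 (by simp), fun _ => ⟨rfl, rfl⟩⟩

lemma exploit_msg (hK0 : 0 < K) {h : List Reward} (ho : Obedient adv h) (a : Arm) :
    (aft h).2 = ⟨a, .exploitation, 0⟩ ↔ (aft h).1.exploit = some a := by
  rcases lt_or_ge h.length K with hK | hK
  · simp [after_of_length_lt ho hK, Memory.init]
  · cases regime hK0 ho hK with
    | early he hs hx hg hc ht hr => simp [hx, hg]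
    | switching he hx hg hs hb ht hr hz =>
      rw [hx]
      constructor
      · intro h1; rw [h1] at hg; simp at hg
      · intro h1; simp at h1
    | exploiting a he hx hg hz hw ht hr ha => simp [hx, hg]

lemma exploit_cons {r : Reward} {h : List Reward} (ho : Obedient adv (r :: h))
    {a : Arm} (ha : (aft h).1.exploit = some a) : (aft (r :: h)).1.exploit = some a := by
  rcases lt_or_ge h.length K with hK | hK
  · simp [after_of_length_lt ho.2 hK, Memory.init] at ha
  · rw [(after_cons ho hK).1 a ha, ha]

lemma switchCount_nonneg (r : Reward) (h : List Reward) : 0 ≤ cnt r h := by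
  induction h with
  | nil => exact ind_nonneg _
  | cons s h ih => rw [switchCount_cons]; exact add_nonneg (ind_nonneg _) ih

lemma Balanced.le {start arm : Arm} {s : ℕ} {z w : ℝ} (h : Balanced start s z w arm)
    (hs : s ≤ 2 * K) : z ≤ K ∧ w ≤ K := by
  obtain ⟨k, ⟨h1, h2, h3, -⟩ | ⟨h1, -, -, h2, h3⟩ | ⟨h1, -, -, h2, h3⟩⟩ := h
  · have : (k : ℝ) ≤ K := by exact_mod_cast (by omega : k ≤ K)
    constructor <;> linarith
  · have : (k : ℝ) + 1 ≤ K := by exact_mod_cast (by omega : k + 1 ≤ K)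
    constructor <;> linarith
  · have : (k : ℝ) + 1 ≤ K := by exact_mod_cast (by omega : k + 1 ≤ K)
    constructor <;> linarith

/-- Both kinds of switches occur at most `K` times, and `K` times if switching is completed. -/
lemma switchCount_bounds (hK0 : 0 < K) {h : List Reward} (ho : Obedient adv h)
    (hK : K ≤ h.length) {r : Reward} (hr : r = .zero ∨ r = .safe) :
    cnt r h ≤ K * ind (¬ Early m K cf (base K h)) ∧
    K * (ind (¬ Early m K cf (base K h)) - ind ((aft h).1.exploit = none)) ≤ cnt r h := by
  cases regime hK0 ho hK with
  | early he hs hx hg hc ht hr => simp [hc, he, hx]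
  | switching he hx hg hs hb ht hr' hz =>
    have := switchCount_nonneg (m := m) (β := β) (K := K) (ν := ν) (cf := cf) r h
    have hb := hb.le hs
    rw [ind_of he, hx]
    simp only [ind_true, sub_self, mul_zero, mul_one]
    refine ⟨?_, this⟩
    rcases hr with rfl | rfl
    · exact hb.1
    · exact hb.2
  | exploiting a he hx hg hz hw ht hr' ha =>
    rw [ind_of he, hx]
    simp only [reduceCtorEq, ind_false, sub_zero, mul_one]
    rcases hr with rfl | rfl
    · rw [hz]; simp
    · rw [hw]; simp

lemma phase_of_exploit_none (hK0 : 0 < K) {h : List Reward} (ho : Obedient adv h)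
    (hK : K ≤ h.length) (hx : (aft h).1.exploit = none) : (aft h).2.phase = .switching := by
  cases regime hK0 ho hK with
  | early he hs hx' hg hc ht hr => simp [hx] at hx'
  | switching he hx hg hs hb ht hr hz => exact hg
  | exploiting a he hx' hg hz hw ht hr ha => simp [hx] at hx'

/-- Until exploitation begins, every message to an agent with at least K predecessors is a switching
message after 0, 1 or b. The `+ 1` counts the agent with exactly K predecessors. -/
lemma length_of_exploit_none (hK0 : 0 < K) {h : List Reward} (ho : Obedient adv h)
    (hK : K ≤ h.length) (hx : (aft h).1.exploit = none) :
    (h.length : ℝ) - K + 1 ≤ cnt .zero h + cnt .safe h + cnt .one h := by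
  have h0 := fun r h => switchCount_nonneg (m := m) (β := β) (K := K) (ν := ν) (cf := cf) r h
  induction h with
  | nil => simp at hK; omega
  | cons r h ih =>
    have hp := phase_of_exploit_none hK0 ho hK hx
    simp only [switchCount_cons, hp, true_and]
    have h1 : ind (r = .zero) + ind (r = .safe) + ind (r = .one) = 1 := by cases r <;> simp
    rcases hK.eq_or_lt with h2 | h2
    · have h3 : ((r :: h).length : ℝ) = K := by rw [← h2]
      have := h0 .zero h; have := h0 .one h; have := h0 .safe h
      linarith
    · have h3 : K ≤ h.length := by simp at h2; omega
      have h4 : (aft h).1.exploit = none := by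
        rcases h5 : (aft h).1.exploit with _ | a
        · rfl
        · rw [exploit_cons ho h5] at hx; simp at hx
      have := ih ho.2 h3 h4
      push_cast [List.length_cons]
      linarith

/-! ### Expectations for the innkeeper mediator -/

lemma advice_eq_preArm {h : List Reward} (ho : Obedient adv h) (hK : h.length < K) :
    adv h = preArm m h := by rw [advice, after_of_length_lt ho hK]

lemma expect_eq_pre (hn : n ≤ K) (F : List Reward → ℝ) :
    expect p adv n F = expect p (preArm m) n F :=
  expect_act_congr fun _ hl h => advice_eq_preArm hl (by omega)

/-- The mediator does not influence the first K stages, so functions of `base K h` have their law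
without intervention, whatever the coin. -/
lemma expect_base (hn : K ≤ n) (F : List Reward → ℝ) :
    expect p adv n (fun h => F (base K h)) = expect p (preArm m) K F := by
  induction n, hn using Nat.le_induction with
  | base =>
    rw [← expect_eq_pre (β := β) (ν := ν) (cf := cf) le_rfl]
    exact expect_congr fun l _ hl => by rw [base_self hl]
  | succ n hn ih =>
    rw [← ih]
    exact expect_succ_of_tail fun r l _ hl => by rw [base_cons (by omega)]

/-- As the safe arm is absorbing before the intervention, the arm of the last of the first K agents
tells whether all of them were risky. -/
lemma allRisky_base_iff (hm : m.Standing) (hK0 : 0 < K) {h : List Reward} (ho : Obedient adv h)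
    (hK : K ≤ h.length) : AllRisky (base K h) ↔ startArm K h = .risky := by
  induction h with
  | nil => simp at hK; omega
  | cons r h ih =>
    rcases hK.eq_or_lt with h1 | h1
    · rw [startArm, base_self h1.symm]
      exact allRisky_iff hm (obedient_congr
        (fun l hl h2 => advice_eq_preArm hl (by omega)) ho)
    · have h2 : K ≤ h.length := by simp at h1; omega
      rw [startArm, base_cons h2]
      exact ih ho.2 h2

lemma expect_startArm (hm : m.Standing) (hK0 : 0 < K) (hn : K ≤ n) (ω : State) :
    expect (m.success ω) adv n (fun h => ind (startArm K h = .risky)) = preRisky m K ω := by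
  rw [preRisky, ← expect_base (β := β) (ν := ν) (cf := cf) hn]
  refine expect_congr fun l ho hl => ?_
  rw [allRisky_base_iff hm hK0 ho (by omega)]

/-- Probability that the innkeeper does not exploit immediately after stage `K`. -/
def switchProb (m : Model) (K : ℕ) (cf : Bool) (p : ℝ) : ℝ :=
  expect p (preArm m) K fun h => ind (¬ Early m K cf h)

lemma expect_not_early (hn : K ≤ n) :
    expect p adv n (fun h => ind (¬ Early m K cf (base K h))) = switchProb m K cf p :=
  expect_base hn fun h => ind (¬ Early m K cf h)

/-- Successes and failures of the risky arm balance in the switching phase. -/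
lemma drift_switchCount (hn : K ≤ n) :
    expect p adv n (fun h => (1 - p) * cnt .one h - p * cnt .zero h)
      = expect p adv K (fun h => (1 - p) * cnt .one h - p * cnt .zero h) := by
  induction n, hn using Nat.le_induction with
  | base => rfl
  | succ n hn ih =>
    rw [← ih]
    refine expect_succ fun l hl hln => ?_
    have h : ∀ x, Obedient adv (payoff (adv l) x :: l) := fun x => ⟨payoff_arm _ _, hl⟩
    simp only [switchCount_cons, phase_cons (h _) (show K ≤ l.length by omega)]
    -- In the switching phase a success adds 1 - p with probability p and a failure subtracts p with
    -- probability 1 - p. After a safe pull neither counter moves.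
    by_cases hc : (aft l).1.exploit = none ∧ (aft l).1.switches < 2 * K
    · simp only [hc, true_and]
      cases adv l <;> simp [payoff] <;> ring
    · simp only [hc, false_and, ind_false]; ring

/-- At length K at most one message has been counted, the one following the last reward before the
intervention. That reward is not independent of the start of switching, so only the trivial bounds
are available. -/
lemma drift_switchCount_base (hp0 : 0 ≤ p) (hp1 : p ≤ 1) (hK0 : 0 < K) :
    -(p * switchProb m K cf p)
        ≤ expect p adv K (fun h => (1 - p) * cnt .one h - p * cnt .zero h) ∧
    expect p adv K (fun h => (1 - p) * cnt .one h - p * cnt .zero h)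
      ≤ (1 - p) * switchProb m K cf p := by
  have key : ∀ l, Obedient adv l → l.length = K →
      (-p) * ind (¬ Early m K cf (base K l)) ≤ (1 - p) * cnt .one l - p * cnt .zero l ∧
      (1 - p) * cnt .one l - p * cnt .zero l ≤ (1 - p) * ind (¬ Early m K cf (base K l)) := by
    intro l hl hlK
    cases l with
    | nil => simp at hlK; omega
    | cons r l =>
      have h0 := fun s => switchCount_of_length_lt (r := s) hl.2 (by simp at hlK; omega)
      rw [switchCount_cons, switchCount_cons, h0, h0]
      by_cases he : Early m K cf (r :: l)
      · simp [base_self hlK, he, (after_of_length_eq hl hlK).1 he]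
      · simp only [base_self hlK, he, (after_of_length_eq hl hlK).2 he, switchStep_phase, true_and,
          not_false_eq_true, ind_true]
        constructor <;> cases r <;> simp <;> linarith
  rw [← expect_not_early (β := β) (ν := ν) (cf := cf) (p := p) (le_refl K), ← neg_mul,
    ← expect_mul, ← expect_mul]
  exact ⟨expect_mono hp0 hp1 fun l h1 h2 => (key l h1 h2).1,
    expect_mono hp0 hp1 fun l h1 h2 => (key l h1 h2).2⟩

/-- Probability that the exploitation phase has not begun after `n` stages. -/
def pending (m : Model) (β : ℝ) (K : ℕ) (ν : ℕ → Reward → ℝ) (cf : Bool) (p : ℝ) (n : ℕ) : ℝ :=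
  expect p (advice m β K ν cf) n fun h => ind ((after m β K ν cf h).1.exploit = none)

local notation "pend" => pending m β K ν cf p

lemma expect_switchCount_bounds (hp0 : 0 ≤ p) (hp1 : p ≤ 1) (hK0 : 0 < K) (hn : K ≤ n)
    {r : Reward} (hr : r = .zero ∨ r = .safe) :
    expect p adv n (cnt r) ≤ K * switchProb m K cf p ∧
    K * (switchProb m K cf p - pend n) ≤ expect p adv n (cnt r) := by
  rw [← expect_not_early (β := β) (ν := ν) (cf := cf) (p := p) hn, pending, ← expect_sub,
    ← expect_mul, ← expect_mul]
  exact ⟨expect_mono hp0 hp1 fun l h1 h2 => (switchCount_bounds hK0 h1 (by omega) hr).1,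
    expect_mono hp0 hp1 fun l h1 h2 => (switchCount_bounds hK0 h1 (by omega) hr).2⟩

/-- The martingale makes the ones, weighted by 1 - p, balance the zeros, weighted by p, up to the
boundary term at length K. The number of zeros is close to K whenever switching takes place. -/
lemma expect_ones_bounds (hp0 : 0 ≤ p) (hp1 : p ≤ 1) (hK0 : 0 < K) (hn : K ≤ n) :
    (1 - p) * expect p adv n (cnt .one) ≤ (p * K + (1 - p)) * switchProb m K cf p ∧
    p * (K * (switchProb m K cf p - pend n) - switchProb m K cf p)
      ≤ (1 - p) * expect p adv n (cnt .one) := by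
  have h1 := drift_switchCount (m := m) (β := β) (ν := ν) (cf := cf) (p := p) hn
  rw [expect_sub, expect_mul, expect_mul] at h1
  have h2 := drift_switchCount_base (m := m) (β := β) (ν := ν) (cf := cf) hp0 hp1 hK0
  have h3 := expect_switchCount_bounds (m := m) (β := β) (ν := ν) (cf := cf) hp0 hp1 hK0 hn
    (r := .zero) (Or.inl rfl)
  have h4 := mul_le_mul_of_nonneg_left h3.1 hp0
  have h5 := mul_le_mul_of_nonneg_left h3.2 hp0
  constructor <;> linarith [h2.1, h2.2]

lemma switchProb_mem (hp0 : 0 ≤ p) (hp1 : p ≤ 1) :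
    0 ≤ switchProb m K cf p ∧ switchProb m K cf p ≤ 1 := by
  refine ⟨expect_nonneg hp0 hp1 fun _ _ _ => ind_nonneg _, ?_⟩
  rw [← expect_const (p := p) (act := preArm m) (n := K) 1]
  exact expect_mono hp0 hp1 fun _ _ _ => ind_le_one _

/-- The switching phase ends: the probability that it goes on is at most of order `1 / n`. -/
lemma pending_le (hp0 : 0 ≤ p) (hp1 : p < 1) (hK0 : 0 < K) (hn : K ≤ n) :
    (1 - p) * (((n : ℝ) - K + 1) * pend n) ≤ 2 * K + 1 := by
  -- Markov's inequality for the time spent switching: the messages after 0, b and 1 have means of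
  -- at most K, K and about K p/(1-p).
  have h1 : ((n : ℝ) - K + 1) * pend n
      ≤ expect p adv n (cnt .zero) + expect p adv n (cnt .safe) + expect p adv n (cnt .one) := by
    rw [pending, ← expect_mul, ← expect_add, ← expect_add]
    refine expect_mono hp0 hp1.le fun l hl hln => ?_
    by_cases hx : (aft l).1.exploit = none
    · rw [ind_of hx, mul_one, ← hln]
      exact length_of_exploit_none hK0 hl (by omega) hx
    · rw [ind_not hx, mul_zero]
      exact add_nonneg (add_nonneg (switchCount_nonneg _ _) (switchCount_nonneg _ _))
        (switchCount_nonneg _ _)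
  have h2 := (expect_switchCount_bounds (m := m) (β := β) (ν := ν) (cf := cf) hp0 hp1.le hK0 hn
    (r := .zero) (Or.inl rfl)).1
  have h3 := (expect_switchCount_bounds (m := m) (β := β) (ν := ν) (cf := cf) hp0 hp1.le hK0 hn
    (r := .safe) (Or.inr rfl)).1
  have h4 := (expect_ones_bounds (m := m) (β := β) (ν := ν) (cf := cf) hp0 hp1.le hK0 hn).1
  have h5 := switchProb_mem (m := m) (K := K) (cf := cf) hp0 hp1.le
  have hq : 0 ≤ 1 - p := by linarith
  have hKr : (0 : ℝ) ≤ K := by positivity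
  have h6 : (K : ℝ) * switchProb m K cf p ≤ K := mul_le_of_le_one_right hKr h5.2
  have h7 : (p * K + (1 - p)) * switchProb m K cf p ≤ p * K + (1 - p) :=
    mul_le_of_le_one_right (by positivity) h5.2
  have h8 := mul_le_mul_of_nonneg_left (h1.trans (add_le_add_left (add_le_add h2 h3) _)) hq
  nlinarith

/-! ### Concentration -/

lemma chebyshev {act : List Reward → Arm} (hp0 : 0 ≤ p) (hp1 : p ≤ 1) {Φ : List Reward → Prop}
    {Q : List Reward → ℝ} {t B : ℝ} (ht : 0 < t)
    (h : ∀ l, Obedient act l → l.length = n → Φ l → t ^ 2 ≤ Q l ^ 2)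
    (hQ : expect p act n (fun h => Q h ^ 2) ≤ B) :
    expect p act n (fun h => ind (Φ h)) ≤ B / t ^ 2 := by
  rw [le_div_iff₀ (by positivity), mul_comm, ← expect_mul]
  refine le_trans (expect_mono hp0 hp1 fun l h1 h2 => ?_) hQ
  by_cases hΦ : Φ l
  · rw [ind_of hΦ, mul_one]; exact h l h1 h2 hΦ
  · rw [ind_not hΦ, mul_zero]; positivity

/-- Sum of the deviations of the risky rewards from `p`. -/
def excess (m : Model) (p : ℝ) : List Reward → ℝ
  | [] => 0
  | r :: h => (m.value r - p) * ind (r.arm = .risky) + excess m p h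

lemma excess_of_allRisky {h : List Reward} (hr : AllRisky h) :
    excess m p h = (h.map m.value).sum - p * h.length := by
  induction h with
  | nil => simp [excess]
  | cons r h ih =>
    rw [allRisky_cons] at hr
    rw [excess, ih hr.2, ind_of hr.1]
    simp; ring

/-- The excess is a martingale. A risky pull adds p(1-p) ≤ 1 to its second moment, a safe pull adds
nothing. -/
lemma expect_excess_sq (act : List Reward → Arm) (hp0 : 0 ≤ p) (hp1 : p ≤ 1) (n : ℕ) :
    expect p act n (fun h => excess m p h ^ 2) ≤ n := by
  induction n with
  | zero => simp [expect, excess]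
  | succ n ih =>
    have h1 : expect p act n (fun h => excess m p h ^ 2 + 1) ≤ n + 1 := by
      rw [expect_add, expect_const]; linarith
    push_cast
    rw [expect]
    refine le_trans (expect_mono hp0 hp1 fun l _ _ => ?_) h1
    cases act l
    · simp only [payoff, excess, Model.value, Reward.arm, ind_true, mul_one]
      nlinarith
    · simp [payoff, excess, Reward.arm]
      nlinarith

/-- Centered sum of the rewards recorded in the switching phase. -/
def surplus (m : Model) (β : ℝ) (K : ℕ) (ν : ℕ → Reward → ℝ) (cf : Bool) (p : ℝ)
    (h : List Reward) : ℝ :=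
  (after m β K ν cf h).1.rSum - p * (after m β K ν cf h).1.rCount

lemma rCount_le (hK0 : 0 < K) {h : List Reward} (ho : Obedient adv h) (hK : K ≤ h.length) :
    (aft h).1.rCount ≤ K := by
  cases regime hK0 ho hK with
  | early he hs hx hg hc ht hr => exact hr
  | switching he hx hg hs hb ht hr hz => exact hr
  | exploiting a he hx hg hz hw ht hr ha => exact hr.le

lemma expect_surplus_sq (hp0 : 0 ≤ p) (hp1 : p ≤ 1) (hK0 : 0 < K) (hn : K ≤ n) :
    expect p adv n (fun h => surplus m β K ν cf p h ^ 2) ≤ 1 + K := by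
  -- The compensated square is a martingale from length K on. Its initial value is only bounded by
  -- 1: the first record may be a reward from before the intervention, whose law is biased by the
  -- event that switching begins.
  have key : expect p adv n (fun h => surplus m β K ν cf p h ^ 2
      - p * (1 - p) * (aft h).1.rCount) ≤ 1 := by
    induction n, hn using Nat.le_induction with
    | base =>
      refine le_trans (expect_mono (G := fun _ => 1) hp0 hp1 fun l hl hlK => ?_)
        (expect_const 1).le
      cases l with
      | nil => simp at hlK; omega
      | cons r l =>
        by_cases he : Early m K cf (r :: l)
        · simp [surplus, (after_of_length_eq hl hlK).1 he, Memory.init]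
        · simp only [surplus, (after_of_length_eq hl hlK).2 he, (switchStep_sample _ _).1,
            (switchStep_sample _ _).2]
          cases r <;> simp [Memory.sample, Memory.init, hK0, Reward.arm, Model.value] <;> nlinarith
    | succ n hn ih =>
      refine le_trans (le_of_eq (expect_succ fun l hl hln => ?_)) ih
      have h : ∀ x, Obedient adv (payoff (adv l) x :: l) := fun x => ⟨payoff_arm _ _, hl⟩
      have hs := fun x => sample_cons (h x) (show K ≤ l.length by omega)
      simp only [payoff_arm] at hs
      by_cases hc : ((aft l).1.exploit = none ∧ (aft l).1.switches < 2 * K ∧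
          (aft l).1.rCount < K) ∧ adv l = .risky
      · simp only [surplus, ((hs _).1 hc).1, ((hs _).1 hc).2]
        simp only [hc.2, payoff, Model.value]
        push_cast
        ring
      · simp only [surplus, ((hs _).2 hc).1, ((hs _).2 hc).2]
        ring
  rw [expect_sub] at key
  have h1 : expect p adv n (fun h => p * (1 - p) * (aft h).1.rCount) ≤ K := by
    rw [← expect_const (p := p) (act := adv) (n := n) (K : ℝ)]
    refine expect_mono hp0 hp1 fun l hl hln => ?_
    have h2 : ((aft l).1.rCount : ℝ) ≤ K := by
      exact_mod_cast rCount_le hK0 hl (by omega)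
    have h3 : (0 : ℝ) ≤ (aft l).1.rCount := by positivity
    have : p * (1 - p) ≤ 1 := by nlinarith
    have : 0 ≤ p * (1 - p) := mul_nonneg hp0 (by linarith)
    nlinarith
  linarith

/-- The bound for the probability of an error in estimating the state from `K` rewards. -/
def errorBound (m : Model) (K : ℕ) : ℝ := (1 + K) / (K * ((m.pH - m.pL) / 2)) ^ 2

lemma Model.Standing.gap_pos (hm : m.Standing) : 0 < (m.pH - m.pL) / 2 := by
  have := hm.pL_lt; have := hm.lt_pH; linarith

lemma pre_low_le (hm : m.Standing) (hK0 : 0 < K) :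
    expect m.pH (preArm m) K (fun h => ind (AllRisky h ∧
      ¬ (m.pH + m.pL) / 2 ≤ (h.map m.value).sum / K)) ≤ errorBound m K := by
  have hg := hm.gap_pos
  have hK : (0 : ℝ) < K := by exact_mod_cast hK0
  refine chebyshev (hm.success_pos .H).le (hm.success_lt .H).le (by positivity)
    (fun l hl hlK hΦ => ?_) ((expect_excess_sq (m := m) (preArm m) (hm.success_pos .H).le
      (hm.success_lt .H).le K).trans (by linarith))
  rw [excess_of_allRisky hΦ.1, hlK]
  have h1 := hΦ.2
  rw [not_le, div_lt_iff₀ hK] at h1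
  simp only [Model.success]
  rw [sq_le_sq, abs_of_pos (by positivity)]
  refine le_trans ?_ (neg_le_abs _)
  linarith

lemma pre_high_le (hm : m.Standing) (hK0 : 0 < K) :
    expect m.pL (preArm m) K (fun h => ind (AllRisky h ∧
      (m.pH + m.pL) / 2 ≤ (h.map m.value).sum / K)) ≤ errorBound m K := by
  have hg := hm.gap_pos
  have hK : (0 : ℝ) < K := by exact_mod_cast hK0
  refine chebyshev (hm.success_pos .L).le (hm.success_lt .L).le (by positivity)
    (fun l hl hlK hΦ => ?_) ((expect_excess_sq (m := m) (preArm m) (hm.success_pos .L).le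
      (hm.success_lt .L).le K).trans (by linarith))
  rw [excess_of_allRisky hΦ.1, hlK]
  have h1 := hΦ.2
  rw [le_div_iff₀ hK] at h1
  simp only [Model.success]
  rw [sq_le_sq, abs_of_pos (by positivity)]
  refine le_trans ?_ (le_abs_self _)
  linarith

/-- Probability that the arm `a` is being exploited after `n` stages. -/
def exploits (m : Model) (β : ℝ) (K : ℕ) (ν : ℕ → Reward → ℝ) (cf : Bool) (p : ℝ) (a : Arm)
    (n : ℕ) : ℝ :=
  expect p (advice m β K ν cf) n fun h => ind ((after m β K ν cf h).1.exploit = some a)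

local notation "expl" => exploits m β K ν cf

/-- The safe arm is exploited only after complete switching. By then exactly K rewards are recorded,
and their sum lies below K pH by at least K times half the gap. -/
lemma exploits_safe_le (hm : m.Standing) (hK0 : 0 < K) (hn : K ≤ n) :
    expl m.pH .safe n ≤ errorBound m K := by
  have hg := hm.gap_pos
  have hK : (0 : ℝ) < K := by exact_mod_cast hK0
  refine chebyshev (hm.success_pos .H).le (hm.success_lt .H).le (by positivity)
    (fun l hl hlK hΦ => ?_) (expect_surplus_sq (hm.success_pos .H).le (hm.success_lt .H).le hK0 hn)
  cases regime hK0 hl (by omega) with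
  | early he hs hx hg hc ht hr => simp [hx] at hΦ
  | switching he hx hg hs hb ht hr hz => simp [hx] at hΦ
  | exploiting a he hx hg hz hw ht hr ha =>
    have h1 : ¬ (m.pH + m.pL) / 2 ≤ (aft l).1.rSum / K := by
      intro h2
      rw [hx] at hΦ
      simp only [Option.some.injEq] at hΦ
      rw [ha, verdict, if_pos h2] at hΦ
      simp at hΦ
    rw [not_le, div_lt_iff₀ hK] at h1
    rw [surplus, hr, sq_le_sq, abs_of_pos (by positivity)]
    simp only [Model.success]
    refine le_trans ?_ (neg_le_abs _)
    linarith

/-- There are two sources of error, hence the factor 2: the sample of the switching phase, and the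
first K rewards when exploitation starts immediately. -/
lemma exploits_risky_le (hm : m.Standing) (hK0 : 0 < K) (hn : K ≤ n) :
    expl m.pL .risky n ≤ 2 * errorBound m K := by
  have hg := hm.gap_pos
  have hK : (0 : ℝ) < K := by exact_mod_cast hK0
  have h1 : expect m.pL adv n (fun h => ind ((aft h).1.exploit = some .risky ∧
      ¬ Early m K cf (base K h))) ≤ errorBound m K := by
    refine chebyshev (hm.success_pos .L).le (hm.success_lt .L).le (by positivity)
      (fun l hl hlK hΦ => ?_)
      (expect_surplus_sq (hm.success_pos .L).le (hm.success_lt .L).le hK0 hn)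
    cases regime hK0 hl (by omega) with
    | early he hs hx hg hc ht hr => exact absurd he hΦ.2
    | switching he hx hg hs hb ht hr hz => simp [hx] at hΦ
    | exploiting a he hx hg hz hw ht hr ha =>
      have h1 : (m.pH + m.pL) / 2 ≤ (aft l).1.rSum / K := by
        by_contra h2
        have hΦ := hΦ.1
        rw [hx] at hΦ
        simp only [Option.some.injEq] at hΦ
        rw [ha, verdict, if_neg h2] at hΦ
        simp at hΦ
      rw [le_div_iff₀ hK] at h1
      rw [surplus, hr, sq_le_sq, abs_of_pos (by positivity)]
      simp only [Model.success]
      refine le_trans ?_ (le_abs_self _)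
      linarith
  have h2 : expect m.pL adv n (fun h => ind (AllRisky (base K h) ∧
      (m.pH + m.pL) / 2 ≤ ((base K h).map m.value).sum / K)) ≤ errorBound m K := by
    rw [expect_base hn fun h => ind (AllRisky h ∧ (m.pH + m.pL) / 2 ≤ (h.map m.value).sum / K)]
    exact pre_high_le hm hK0
  have h3 : expl m.pL .risky n ≤ expect m.pL adv n (fun h =>
      ind ((aft h).1.exploit = some .risky ∧ ¬ Early m K cf (base K h)) +
      ind (AllRisky (base K h) ∧ (m.pH + m.pL) / 2 ≤ ((base K h).map m.value).sum / K)) := by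
    refine expect_mono (hm.success_pos .L).le (hm.success_lt .L).le fun l _ _ => ?_
    by_cases he : Early m K cf (base K l)
    · rw [ind_of he.1]
      have := ind_nonneg ((aft l).1.exploit = some .risky ∧ ¬ Early m K cf (base K l))
      have := ind_le_one ((aft l).1.exploit = some .risky)
      linarith
    · simp only [he, not_false_eq_true, and_true]
      have := ind_nonneg (AllRisky (base K l) ∧
        (m.pH + m.pL) / 2 ≤ ((base K l).map m.value).sum / K)
      linarith
  rw [expect_add] at h3
  linarith

lemma exploits_add : expl p .risky n + expl p .safe n + pend n = 1 := by
  rw [exploits, exploits, pending, ← expect_add, ← expect_add,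
    ← expect_const (p := p) (act := adv) (n := n) 1]
  congr 1
  funext h
  rcases (aft h).1.exploit with _ | _ | _ <;> simp

lemma exploits_mono (hp0 : 0 ≤ p) (hp1 : p ≤ 1) (a : Arm) : Monotone (expl p a) := by
  refine monotone_nat_of_le_succ fun n => ?_
  have h : expl p a n = expect p adv (n + 1) fun h => ind ((aft h.tail).1.exploit = some a) :=
    (expect_succ_of_tail (F := fun h => ind ((aft h.tail).1.exploit = some a))
      fun r l _ _ => rfl).symm
  rw [h]
  refine expect_mono hp0 hp1 fun l hl hln => ?_
  cases l with
  | nil => simp at hln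
  | cons r l => exact ind_mono fun h => exploit_cons hl h

end

section

variable {m : Model} {β : ℝ} {K : ℕ} {ν : ℕ → Reward → ℝ} {cf : Bool} {p : ℝ} {n : ℕ}

local notation "adv" => advice m β K ν cf
local notation "aft" => after m β K ν cf
local notation "cnt" => switchCount m β K ν cf
local notation "pend" => pending m β K ν cf p
local notation "expl" => exploits m β K ν cf

/-! ### Messages -/

/-- The message of the switching phase after the reward `r`. -/
def switchMessage (β : ℝ) (K : ℕ) : Reward → Message
  | .one => ⟨.risky, .switching, 0⟩
  | .zero => ⟨.safe, .switching, β / (2 * K)⟩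
  | .safe => ⟨.risky, .switching, β / (2 * K)⟩

/-- A positive subsidy separates the messages after 1 and after b, which recommend the same arm. So
a switching message determines the preceding reward. -/
lemma switchMessage_injective (hβ : 0 < β) (hK0 : 0 < K) :
    Function.Injective (switchMessage β K) := by
  have : β / (2 * K) ≠ 0 := by positivity
  intro r s h
  cases r <;> cases s <;> first
    | rfl
    | (simp only [switchMessage, Message.mk.injEq] at h; grind)

/-- All messages that the innkeeper may send, with the circumstances. -/
lemma after_cases (hK0 : 0 < K) (h : List Reward) :
    (Obedient adv h ∧ h.length < K ∧ (aft h).2 = ⟨preArm m h, .preIntervention, 0⟩) ∨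
    (Obedient adv h ∧ ∃ r l, h = r :: l ∧ (aft h).2 = switchMessage β K r) ∨
    (∃ a, (aft h).2 = ⟨a, .exploitation, 0⟩) ∨
    (∃ r l, h = r :: l ∧ ¬ Obedient adv h ∧
      (aft h).2 = ⟨if m.b < m.mean (ν h.length r) then .risky else .safe, .deviation, 0⟩) := by
  rcases h with _ | ⟨r, l⟩
  · exact Or.inl ⟨trivial, by simpa using hK0, rfl⟩
  rw [obedient_iff]
  have h0 : aft (r :: l) = step m β K ν cf (memory m β K ν cf (r :: l)) (r :: l) := rfl
  rw [h0]
  set mem := memory m β K ν cf (r :: l)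
  rcases hx : mem.exploit with _ | a
  · rcases hd : mem.deviated
    · simp only [step, hx]
      rw [if_neg (by simp [hd])]
      split_ifs with h1 h2 h3 h4
      · exact Or.inl ⟨trivial, h1, rfl⟩
      · exact Or.inr (Or.inr (Or.inl ⟨.risky, rfl⟩))
      · exact Or.inr (Or.inl ⟨trivial, r, l, rfl, by cases r <;> rfl⟩)
      · exact Or.inr (Or.inr (Or.inl ⟨.risky, rfl⟩))
      · exact Or.inr (Or.inr (Or.inl ⟨.safe, rfl⟩))
    · refine Or.inr (Or.inr (Or.inr ⟨r, l, rfl, by simp, ?_⟩))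
      simp only [step, hx]
      rw [if_pos hd]
  · exact Or.inr (Or.inr (Or.inl ⟨a, by simp [step, hx]⟩))

lemma switchMessage_phase (r : Reward) : (switchMessage β K r).phase = .switching := by
  cases r <;> rfl

lemma after_eq_switchMessage (hβ : 0 < β) (hK0 : 0 < K) (h : List Reward) (r : Reward) :
    (aft h).2 = switchMessage β K r ↔
      ((aft h).2.phase = .switching ∧ h.head? = some r) := by
  constructor
  · intro h1
    rcases after_cases (m := m) (β := β) (ν := ν) (cf := cf) hK0 h with
      ⟨-, -, h2⟩ | ⟨-, s, l, hs, h2⟩ | ⟨a, h2⟩ | ⟨s, l, -, -, h2⟩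
    · have := congrArg Message.phase (h1.symm.trans h2)
      simp [switchMessage_phase] at this
    · have := switchMessage_injective hβ hK0 (h1.symm.trans h2)
      subst this
      rw [h2, switchMessage_phase, hs]
      exact ⟨rfl, rfl⟩
    · have := congrArg Message.phase (h1.symm.trans h2)
      simp [switchMessage_phase] at this
    · have := congrArg Message.phase (h1.symm.trans h2)
      simp [switchMessage_phase] at this
  · rintro ⟨h1, h3⟩
    rcases after_cases (m := m) (β := β) (ν := ν) (cf := cf) hK0 h with
      ⟨-, -, h2⟩ | ⟨-, s, l, hs, h2⟩ | ⟨a, h2⟩ | ⟨s, l, -, -, h2⟩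
    · rw [h2] at h1; simp at h1
    · rw [hs] at h3
      simp only [List.head?_cons, Option.some.injEq] at h3
      rw [h2, h3]
    · rw [h2] at h1; simp at h1
    · rw [h2] at h1; simp at h1

/-! ### Expected numbers of messages, for a given coin -/

/-- Expected number of stages among the first `T + 1` with message `g` and preceding reward `r`. -/
def received (m : Model) (β : ℝ) (K : ℕ) (ν : ℕ → Reward → ℝ) (cf : Bool) (p : ℝ) (T : ℕ)
    (g : Message) (r : Option Reward) : ℝ :=
  ∑ n ∈ Finset.range (T + 1), expect p (advice m β K ν cf) n fun h =>
    ind ((after m β K ν cf h).2 = g ∧ h.head? = r)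

lemma received_switchMessage (hβ : 0 < β) (hK0 : 0 < K) (T : ℕ) (r : Reward) :
    received m β K ν cf p T (switchMessage β K r) (some r) = expect p adv T (cnt r) := by
  rw [received, switchCount, ← sum_expect]
  simp only [after_eq_switchMessage hβ hK0, and_assoc, and_self]

lemma received_switchMessage_ne (hβ : 0 < β) (hK0 : 0 < K) (T : ℕ) {r : Reward}
    {s : Option Reward} (hs : s ≠ some r) :
    received m β K ν cf p T (switchMessage β K r) s = 0 := by
  refine Finset.sum_eq_zero fun n _ => ?_
  rw [← expect_const (p := p) (act := adv) (n := n) 0]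
  congr 1
  funext h
  refine ind_not ?_
  rw [after_eq_switchMessage hβ hK0]
  rintro ⟨⟨-, h1⟩, h2⟩
  exact hs (h2.symm.trans h1)

lemma received_exploit_none (hK0 : 0 < K) (T : ℕ) (a : Arm) :
    received m β K ν cf p T ⟨a, .exploitation, 0⟩ none = 0 := by
  refine Finset.sum_eq_zero fun n _ => ?_
  rw [← expect_const (p := p) (act := adv) (n := n) 0]
  refine expect_congr fun l hl _ => ind_not ?_
  rintro ⟨h1, h2⟩
  rw [List.head?_eq_none_iff] at h2
  subst h2
  rw [after_of_length_lt hl (by simpa using hK0)] at h1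
  simp at h1

lemma received_exploit_le (hp0 : 0 ≤ p) (hp1 : p ≤ 1) (hK0 : 0 < K) (T : ℕ) (a : Arm)
    (r : Option Reward) :
    received m β K ν cf p T ⟨a, .exploitation, 0⟩ r ≤ (T + 1) * expl p a T := by
  have h : ∀ n ∈ Finset.range (T + 1), expect p adv n (fun h =>
      ind ((aft h).2 = ⟨a, .exploitation, 0⟩ ∧ h.head? = r)) ≤ expl p a T := by
    intro n hn
    refine le_trans ?_ (exploits_mono hp0 hp1 a (Finset.mem_range_succ_iff.1 hn))
    exact expect_mono hp0 hp1 fun l hl _ => ind_mono fun h => (exploit_msg hK0 hl a).1 h.1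
  refine (Finset.sum_le_sum h).trans ?_
  simp

/-- Probability that an arm gives the reward `r`. -/
def rewardProb (p : ℝ) : Reward → ℝ
  | .one => p
  | .zero => 1 - p
  | .safe => 1

lemma exploits_succ_head (hp0 : 0 ≤ p) (hp1 : p ≤ 1) (hK0 : 0 < K) (n : ℕ) (r : Reward) :
    rewardProb p r * expl p r.arm n ≤ expect p adv (n + 1) (fun h =>
      ind ((aft h).2 = ⟨r.arm, .exploitation, 0⟩ ∧ h.head? = some r)) := by
  rw [exploits, ← expect_mul, expect]
  refine expect_mono hp0 hp1 fun l hl _ => ?_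
  have hq : 0 ≤ 1 - p := by linarith
  by_cases hx : (aft l).1.exploit = some r.arm
  · have ha : adv l = r.arm := by rw [advice, (exploit_msg hK0 hl _).2 hx]
    have ho : ∀ x, Obedient adv (payoff (adv l) x :: l) := fun x => ⟨payoff_arm _ _, hl⟩
    have h1 : ∀ x, (aft (payoff (adv l) x :: l)).2 = ⟨r.arm, .exploitation, 0⟩ := fun x =>
      (exploit_msg hK0 (ho x) _).2 (exploit_cons (ho x) hx)
    simp only [h1, ind_of hx, true_and]
    rw [ha]
    cases r <;> simp [Reward.arm, payoff, rewardProb]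
  · rw [ind_not hx, mul_zero]
    exact add_nonneg (mul_nonneg hp0 (ind_nonneg _)) (mul_nonneg hq (ind_nonneg _))

lemma le_received_exploit (hp0 : 0 ≤ p) (hp1 : p ≤ 1) (hK0 : 0 < K) {M T : ℕ} (hMT : M ≤ T)
    (r : Reward) :
    ((T : ℝ) - M) * (rewardProb p r * expl p r.arm M)
      ≤ received m β K ν cf p T ⟨r.arm, .exploitation, 0⟩ (some r) := by
  have hr : 0 ≤ rewardProb p r := by cases r <;> simp [rewardProb] <;> linarith
  -- The agent without predecessor is split off; the others have an index of the form n + 1, as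
  -- needed for `exploits_succ_head`.
  rw [received, Finset.sum_range_succ']
  refine le_trans ?_ (le_add_of_nonneg_right
    (expect_nonneg hp0 hp1 fun _ _ _ => ind_nonneg _))
  have h1 : ∑ n ∈ Finset.Ico M T, rewardProb p r * expl p r.arm M
      ≤ ∑ n ∈ Finset.Ico M T, expect p adv (n + 1) (fun h =>
        ind ((aft h).2 = ⟨r.arm, .exploitation, 0⟩ ∧ h.head? = some r)) := by
    refine Finset.sum_le_sum fun n hn => ?_
    refine le_trans (mul_le_mul_of_nonneg_left ?_ hr) (exploits_succ_head hp0 hp1 hK0 n r)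
    exact exploits_mono hp0 hp1 _ (Finset.mem_Ico.1 hn).1
  rw [Finset.sum_const, Nat.card_Ico, nsmul_eq_mul, Nat.cast_sub hMT] at h1
  refine h1.trans (Finset.sum_le_sum_of_subset_of_nonneg (fun n hn => ?_) fun n _ _ =>
    expect_nonneg hp0 hp1 fun _ _ _ => ind_nonneg _)
  exact Finset.mem_range.2 (Finset.mem_Ico.1 hn).2

/-- Obedience leaves only the first exploitation message to come after the other arm. At that moment
there have been 2K switches or none, so the arm just pulled is that of the last of the first K
agents. -/
lemma turnCount_eq (hK0 : 0 < K) {h : List Reward} (ho : Obedient adv h) (hK : K ≤ h.length)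
    (a : Arm) : turnCount m β K ν cf a h
      = ind ((aft h).1.exploit = some a ∧ startArm K h ≠ a) := by
  cases regime hK0 ho hK with
  | early he hs hx hg hc ht hr =>
    rw [ht, hx, hs, ind_not]
    rintro ⟨h1, h2⟩
    exact h2 (by simpa using h1)
  | switching he hx hg hs hb ht hr hz => rw [ht, hx]; simp
  | exploiting a' he hx hg hz hw ht hr ha =>
    rw [ht, hx]
    congr 1
    simp only [Option.some.injEq, eq_iff_iff]
    constructor
    · rintro ⟨rfl, h2⟩; exact ⟨rfl, h2⟩
    · rintro ⟨rfl, h2⟩; exact ⟨rfl, h2⟩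

/-- Probability that after `n` stages the arm `a` is exploited although the last agent before the
intervention pulled the other one. -/
def turns (m : Model) (β : ℝ) (K : ℕ) (ν : ℕ → Reward → ℝ) (cf : Bool) (p : ℝ) (a : Arm)
    (n : ℕ) : ℝ :=
  expect p (advice m β K ν cf) n fun h =>
    ind ((after m β K ν cf h).1.exploit = some a ∧ startArm K h ≠ a)

local notation "turn" => turns m β K ν cf

lemma turns_le (hp0 : 0 ≤ p) (hp1 : p ≤ 1) (a : Arm) : turn p a n ≤ expl p a n :=
  expect_mono hp0 hp1 fun _ _ _ => ind_mono fun h => h.1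

lemma sum_turn {T : ℕ} (hK0 : 0 < K) (hT : K ≤ T) (a : Arm) :
    ∑ n ∈ Finset.range (T + 1), expect p adv n (fun h =>
      ind ((aft h).2 = ⟨a, .exploitation, 0⟩ ∧ ∃ r, h.head? = some r ∧ r.arm ≠ a))
      = turn p a T := by
  rw [sum_expect, turns]
  exact expect_congr fun l hl hlT => turnCount_eq hK0 hl (by omega) a

lemma received_risky_safe {T : ℕ} (hK0 : 0 < K) (hT : K ≤ T) :
    received m β K ν cf p T ⟨.risky, .exploitation, 0⟩ (some .safe) = turn p .risky T := by
  rw [← sum_turn hK0 hT, received]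
  refine Finset.sum_congr rfl fun n _ => ?_
  congr 1
  funext h
  congr 1
  rcases h with _ | ⟨_ | _ | _, l⟩ <;> simp [Reward.arm]

/-- The verdict is reached from the memory before the latest reward is looked at, and immediate
exploitation is always risky. So the onset of safe exploitation does not depend on whether the last
risky reward was 1 or 0. -/
lemma received_safe_one_zero (T : ℕ) :
    (1 - p) * received m β K ν cf p T ⟨.safe, .exploitation, 0⟩ (some .one)
      = p * received m β K ν cf p T ⟨.safe, .exploitation, 0⟩ (some .zero) := by
  rw [received, received, Finset.mul_sum, Finset.mul_sum]
  refine Finset.sum_congr rfl fun n _ => ?_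
  rw [← expect_mul, ← expect_mul]
  cases n with
  | zero => simp [expect]
  | succ n =>
    rw [expect, expect]
    refine expect_congr fun l hl hln => ?_
    have ho : ∀ x, Obedient adv (payoff (adv l) x :: l) := fun x => ⟨payoff_arm _ _, hl⟩
    have key : (aft (payoff (adv l) true :: l)).2 = ⟨.safe, .exploitation, 0⟩ ↔
        (aft (payoff (adv l) false :: l)).2 = ⟨.safe, .exploitation, 0⟩ := by
      rcases lt_or_ge l.length K with hK | hK
      · rcases (show l.length + 1 ≤ K from hK).lt_or_eq with h1 | h1
        · simp [after_of_length_lt (ho _) (show (payoff (adv l) _ :: l).length < K from h1)]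
        · have h2 : ∀ x, (aft (payoff (adv l) x :: l)).2 ≠ ⟨.safe, .exploitation, 0⟩ := by
            intro x
            have hA := after_of_length_eq (ho x) h1
            by_cases he : Early m K cf (payoff (adv l) x :: l)
            · simp [hA.1 he]
            · rw [hA.2 he]
              intro h3
              have := congrArg Message.phase h3
              rw [switchStep_phase] at this
              simp at this
          simp [h2]
      · have hA := fun x => after_cons (ho x) hK
        rcases hx : (aft l).1.exploit with _ | a
        · by_cases hs : (aft l).1.switches < 2 * K
          · have h2 : ∀ x, (aft (payoff (adv l) x :: l)).2 ≠ ⟨.safe, .exploitation, 0⟩ := by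
              intro x h3
              have := congrArg Message.phase h3
              rw [((hA x).2 hx).1 hs, switchStep_phase] at this
              simp at this
            simp [h2]
          · rw [((hA _).2 hx).2 hs, ((hA _).2 hx).2 hs]
        · rw [(hA _).1 a hx, (hA _).1 a hx]
    simp only [key]
    cases adv l
    · by_cases h1 : (aft (payoff .risky false :: l)).2 = ⟨.safe, .exploitation, 0⟩ <;>
        simp [payoff] <;> simp only [payoff] at h1 <;> simp [h1]
      ring
    · simp [payoff]

lemma received_safe_risky {T : ℕ} (hK0 : 0 < K) (hT : K ≤ T) :
    received m β K ν cf p T ⟨.safe, .exploitation, 0⟩ (some .one) = p * turn p .safe T ∧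
    received m β K ν cf p T ⟨.safe, .exploitation, 0⟩ (some .zero) = (1 - p) * turn p .safe T := by
  have h1 := received_safe_one_zero (m := m) (β := β) (ν := ν) (cf := cf) (p := p) (K := K) T
  have h2 : received m β K ν cf p T ⟨.safe, .exploitation, 0⟩ (some .one)
      + received m β K ν cf p T ⟨.safe, .exploitation, 0⟩ (some .zero) = turn p .safe T := by
    rw [← sum_turn hK0 hT, received, received, ← Finset.sum_add_distrib]
    refine Finset.sum_congr rfl fun n _ => ?_
    rw [← expect_add]
    congr 1
    funext h
    rcases h with _ | ⟨_ | _ | _, l⟩ <;> simp [Reward.arm]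
  rw [← h2]
  constructor <;> linarith

lemma turns_risky_bounds (hm : m.Standing) (hK0 : 0 < K) (hn : K ≤ n) (ω : State) :
    turn (m.success ω) .risky n ≤ 1 - preRisky m K ω ∧
    1 - preRisky m K ω - expl (m.success ω) .safe n - pending m β K ν cf (m.success ω) n
      ≤ turn (m.success ω) .risky n := by
  have h1 := expect_startArm (β := β) (ν := ν) (cf := cf) hm hK0 hn ω
  have h0 := (hm.success_pos ω).le
  have h2 := (hm.success_lt ω).le
  rw [← h1, ← expect_const (p := m.success ω) (act := adv) (n := n) 1, exploits, pending,
    ← expect_sub, ← expect_sub, ← expect_sub]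
  constructor
  · refine expect_mono h0 h2 fun l _ _ => ?_
    by_cases hs : startArm K l = .risky
    · simp [hs]
    · simp only [hs, ind_false, sub_zero]; exact ind_le_one _
  · refine expect_mono h0 h2 fun l _ _ => ?_
    by_cases hs : startArm K l = .risky
    · rcases (aft l).1.exploit with _ | _ | _ <;> simp [hs]
    · rcases (aft l).1.exploit with _ | _ | _ <;> simp [hs]

lemma le_turns_safe (hm : m.Standing) (hK0 : 0 < K) (hn : K ≤ n) (ω : State) :
    preRisky m K ω - expl (m.success ω) .risky n - pending m β K ν cf (m.success ω) n
      ≤ turn (m.success ω) .safe n := by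
  have h1 := expect_startArm (β := β) (ν := ν) (cf := cf) hm hK0 hn ω
  rw [← h1, exploits, pending, ← expect_sub, ← expect_sub]
  refine expect_mono (hm.success_pos ω).le (hm.success_lt ω).le fun l _ _ => ?_
  rcases hs : startArm K l with _ | _ <;> rcases (aft l).1.exploit with _ | _ | _ <;> simp

/-! ### Rewards -/

/-- Mean reward of an arm. -/
def armReward (m : Model) (p : ℝ) : Arm → ℝ
  | .risky => p
  | .safe => m.b

/-- Only rewards drawn after M stages while `a` is exploited are counted; all others are
nonnegative. Exploitation is absorbing, so its probability after M stages serves for all later ones.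
-/
lemma le_expect_total (hb : 0 ≤ m.b) (hp0 : 0 ≤ p) (hp1 : p ≤ 1) (hK0 : 0 < K) {M n : ℕ}
    (hn : M ≤ n) (a : Arm) :
    ((n : ℝ) - M) * (armReward m p a * expl p a M)
      ≤ expect p adv n fun h => (h.map m.value).sum := by
  have hw : 0 ≤ armReward m p a := by cases a <;> assumption
  have hv : ∀ r, 0 ≤ m.value r := by intro r; cases r <;> simp [Model.value, hb]
  induction n, hn using Nat.le_induction with
  | base =>
    rw [sub_self, zero_mul]
    refine expect_nonneg hp0 hp1 fun l _ _ => List.sum_nonneg fun x hx => ?_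
    obtain ⟨r, -, rfl⟩ := List.mem_map.1 hx
    exact hv r
  | succ n hn ih =>
    have h1 : expect p adv n (fun h => (h.map m.value).sum
        + armReward m p a * ind ((aft h).1.exploit = some a))
        ≤ expect p adv (n + 1) fun h => (h.map m.value).sum := by
      rw [expect.eq_2]
      refine expect_mono hp0 hp1 fun l hl _ => ?_
      have h2 : armReward m p a * ind ((aft l).1.exploit = some a)
          ≤ p * m.value (payoff (adv l) true) + (1 - p) * m.value (payoff (adv l) false) := by
        by_cases hx : (aft l).1.exploit = some a
        · have ha : adv l = a := by rw [advice, (exploit_msg hK0 hl _).2 hx]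
          rw [ind_of hx, ha]
          cases a <;> simp [payoff, Model.value, armReward]
          linarith
        · rw [ind_not hx, mul_zero]
          exact add_nonneg (mul_nonneg hp0 (hv _)) (mul_nonneg (by linarith) (hv _))
      simp only [List.map_cons, List.sum_cons]
      linarith
    rw [expect_add, expect_mul] at h1
    have h3 := exploits_mono (m := m) (β := β) (K := K) (ν := ν) (cf := cf) hp0 hp1 a hn
    have h4 := mul_le_mul_of_nonneg_left h3 hw
    rw [exploits] at h4 h3
    push_cast
    unfold exploits at *
    linarith

end

/-! ### Budget balance -/

lemma memory_switches (m : Model) (β : ℝ) (K : ℕ) (ν : ℕ → Reward → ℝ) (cf : Bool) (r : Reward)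
    (h : List Reward) :
    (memory m β K ν cf (r :: h)).switches = (after m β K ν cf h).1.switches := rfl

/-- Subsidies are offered exactly when the counter of switches goes up, and the counter stops at 2K.
Nothing is assumed about obedience, as budget balance requires. -/
lemma step_subsidy (m : Model) (β : ℝ) (K : ℕ) (ν : ℕ → Reward → ℝ) (cf : Bool) (mem : Memory)
    (h : List Reward) (hs : mem.switches ≤ 2 * K) :
    (step m β K ν cf mem h).1.switches ≤ 2 * K ∧
    (step m β K ν cf mem h).2.subsidy
      = β / (2 * K) * ((step m β K ν cf mem h).1.switches - mem.switches) := by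
  rcases h with _ | ⟨r, l⟩
  · exact ⟨hs, by simp [step]⟩
  rcases hx : mem.exploit with _ | a
  · simp only [step, hx]
    split_ifs with h1 h2 h3 h4 h5 h6
    · exact ⟨hs, by simp⟩
    · exact ⟨hs, by simp⟩
    · exact ⟨hs, by simp⟩
    · exact ⟨hs, by simp⟩
    · cases r <;> simp [Memory.switch, sample_switches] <;> omega
    · exact ⟨hs, by simp⟩
    · exact ⟨hs, by simp⟩
  · simp [step, hx, hs]

lemma cumul_subsidy (m : Model) (β : ℝ) (K : ℕ) (ν : ℕ → Reward → ℝ) (cf : Bool)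
    (h : List Reward) :
    (after m β K ν cf h).1.switches ≤ 2 * K ∧
    cumul (fun h => (after m β K ν cf h).2.subsidy) h
      = β / (2 * K) * (after m β K ν cf h).1.switches := by
  induction h with
  | nil => simp [cumul, after, step, memory, Memory.init]
  | cons r h ih =>
    have h1 := step_subsidy m β K ν cf (memory m β K ν cf (r :: h)) (r :: h)
      (by rw [memory_switches]; exact ih.1)
    refine ⟨h1.1, ?_⟩
    rw [cumul, ih.2]
    have h2 := h1.2
    rw [memory_switches] at h2
    change (after m β K ν cf (r :: h)).2.subsidy = _ at h2
    rw [h2]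
    change β / (2 * K) * ((after m β K ν cf (r :: h)).1.switches - _) + _ = _
    ring

lemma sum_play_eq_cumul (f : List Reward → ℝ) (act : List Reward → Arm) (t : ℕ → Bool) (n : ℕ) :
    ∑ j ∈ Finset.range (n + 1), f (play act t j) = cumul f (play act t n) := by
  induction n with
  | zero => simp [play, cumul]
  | succ n ih => rw [Finset.sum_range_succ, ih, play, cumul, add_comm]

lemma budgetBalanced (m : Model) {β : ℝ} (hβ : 0 < β) {K : ℕ} (hK0 : 0 < K)
    (ν : ℕ → Reward → ℝ) (N : ℕ) (δ : ℝ) : BudgetBalanced β (INKP m ν N β δ K) := by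
  intro cf t act
  cases N with
  | zero => simpa using hβ.le
  | succ T =>
    rw [Fin.sum_univ_eq_sum_range
      (fun j => ((INKP m ν (T + 1) β δ K).msg cf (play act (ext t) j)).subsidy)]
    change ∑ j ∈ Finset.range (T + 1), (after m β K ν cf (play act (ext t) j)).2.subsidy ≤ β
    rw [sum_play_eq_cumul (fun h => (after m β K ν cf h).2.subsidy)]
    have h := cumul_subsidy m β K ν cf (play act (ext t) T)
    rw [h.2]
    have h1 : ((after m β K ν cf (play act (ext t) T)).1.switches : ℝ) ≤ 2 * K := by
      exact_mod_cast h.1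
    have h2 : (0 : ℝ) < 2 * K := by positivity
    rw [div_mul_eq_mul_div, div_le_iff₀ h2]
    exact mul_le_mul_of_nonneg_left h1 hβ.le

/-! ### Average rewards -/

lemma condMean_averageReward {m : Model} (hm : m.Standing) {N : ℕ} (hN : 0 < N) (M : Mediator N)
    (ω : State) : condMean (law m M) (averageReward m M) {x | x.1 = ω}
      = ∑ cf, bern M.bias cf *
        (expect (m.success ω) (fun h => (M.msg cf h).arm) N (fun h => (h.map m.value).sum) / N) := by
  have hN' : (N : ℝ) ≠ 0 := by positivity
  have key : ∀ f : Bool → (Fin N → Bool) → ℝ,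
      ∑ x : Outcome N, {x : Outcome N | x.1 = ω}.indicator
        (fun x => law m M x * f x.2.1 x.2.2.1) x
      = m.prior ω * ∑ cf, bern M.bias cf *
          ∑ t, (∏ j, bern (m.success ω) (t j)) * f cf t := by
    intro f
    -- The order of arrival is irrelevant here; the first agent merely serves to apply `sum_law`,
    -- and the sum over her stage cancels the factor 1/N.
    have h := sum_law m M ⟨0, hN⟩ fun ω' cf t _ => ind (ω' = ω) * f cf t
    have h1 : ∀ x : Outcome N, {x : Outcome N | x.1 = ω}.indicator
        (fun x => law m M x * f x.2.1 x.2.2.1) x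
        = law m M x * (ind (x.1 = ω) * f x.2.1 x.2.2.1) := by
      intro x
      by_cases hx : x.1 = ω
      · rw [Set.indicator_of_mem (by exact hx), ind_of hx, one_mul]
      · rw [Set.indicator_of_notMem (by exact hx), ind_not hx, zero_mul, mul_zero]
    rw [Finset.sum_congr rfl fun x _ => h1 x, h]
    simp only [Finset.sum_const, Finset.card_univ, Fintype.card_fin, nsmul_eq_mul]
    rw [Finset.sum_eq_single ω]
    · simp only [ind_true, one_mul]
      simp_rw [mul_left_comm _ (N : ℝ)]
      rw [← Finset.mul_sum, mul_left_comm (m.prior ω), ← mul_assoc, one_div,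
        inv_mul_cancel₀ hN', one_mul]
    · intro ω' _ hne
      simp [hne]
    · simp
  have hden := key fun _ _ => 1
  have hnum := key fun cf t =>
    ((play (fun past => (M.msg cf past).arm) (ext t) N).map m.value).sum / N
  simp only [mul_one] at hden
  rw [condMean]
  unfold prob averageReward history
  rw [hnum, hden]
  have h1 : ∑ t : Fin N → Bool, ∏ j, bern (m.success ω) (t j) = 1 := by
    have := sum_play (N := N) le_rfl (m.success ω) (fun past => (M.msg true past).arm) fun _ => 1
    rw [expect_const] at this
    simpa using this
  have h2 : ∀ cf : Bool, ∑ t : Fin N → Bool, (∏ j, bern (m.success ω) (t j)) *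
      (((play (fun past => (M.msg cf past).arm) (ext t) N).map m.value).sum / N)
      = expect (m.success ω) (fun h => (M.msg cf h).arm) N (fun h => (h.map m.value).sum) / N :=
    fun cf => by
      have := sum_play (N := N) le_rfl (m.success ω) (fun past => (M.msg cf past).arm)
        fun h => (h.map m.value).sum
      rw [← this, Finset.sum_div]
      exact Finset.sum_congr rfl fun t _ => by ring
  simp only [h2, h1, mul_one, bern_sum]
  rw [mul_div_assoc, mul_div_cancel₀]
  exact (hm.prior_pos ω).ne'

/-! ### Incentive compatibility from the signs of the gains -/

lemma bern_nonneg {δ : ℝ} (h0 : 0 ≤ δ) (h1 : δ ≤ 1) (cf : Bool) : 0 ≤ bern δ cf := by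
  cases cf <;> simp [bern] <;> linarith

lemma bern_pos {δ : ℝ} (h0 : 0 < δ) (h1 : δ < 1) (cf : Bool) : 0 < bern δ cf := by
  cases cf <;> simp [bern] <;> linarith

lemma sum_bern_const (δ c : ℝ) : ∑ cf, bern δ cf * c = c := by
  rw [← Finset.sum_mul, bern_sum, one_mul]

lemma sum_bern_le {δ : ℝ} (h0 : 0 ≤ δ) (h1 : δ ≤ 1) {f g : Bool → ℝ} (h : ∀ cf, f cf ≤ g cf) :
    ∑ cf, bern δ cf * f cf ≤ ∑ cf, bern δ cf * g cf :=
  Finset.sum_le_sum fun cf _ => mul_le_mul_of_nonneg_left (h cf) (bern_nonneg h0 h1 cf)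

lemma gain_visits {N : ℕ} (m : Model) (M : Mediator N) (c : ℝ) (Φ : Bool → List Reward → Prop) :
    gain m c (fun ω => visits M (m.success ω) Φ) = ∑ cf, bern M.bias cf *
      ∑ n ∈ Finset.range N, gain m c fun ω =>
        expect (m.success ω) (fun h => (M.msg cf h).arm) n fun h => ind (Φ cf h) := by
  simp only [gain_eq, visits, Finset.sum_sub_distrib, ← Finset.mul_sum, Fintype.sum_bool]
  ring

section

variable {m : Model} {β : ℝ} {K : ℕ} {ν : ℕ → Reward → ℝ} {cf : Bool} {p δ : ℝ} {n T N : ℕ}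

local notation "adv" => advice m β K ν cf
local notation "aft" => after m β K ν cf

lemma gain_visits_INKP (c : ℝ) (Φ : Bool → List Reward → Prop) :
    gain m c (fun ω => visits (INKP m ν N β δ K) (m.success ω) Φ) = ∑ cf, bern δ cf *
      ∑ n ∈ Finset.range N, gain m c fun ω =>
        expect (m.success ω) (advice m β K ν cf) n fun h => ind (Φ cf h) :=
  gain_visits m (INKP m ν N β δ K) c Φ

lemma visits_nonneg (h0 : 0 ≤ δ) (h1 : δ ≤ 1) (hp0 : 0 ≤ p) (hp1 : p ≤ 1)
    (Φ : Bool → List Reward → Prop) : 0 ≤ visits (INKP m ν N β δ K) p Φ :=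
  Finset.sum_nonneg fun cf _ => mul_nonneg (bern_nonneg h0 h1 cf) <|
    Finset.sum_nonneg fun _ _ => expect_nonneg hp0 hp1 fun _ _ _ => ind_nonneg _

lemma prob_receives (i : Fin N) (g : Message) :
    prob (law m (INKP m ν N β δ K)) (receives (INKP m ν N β δ K) i g)
      = (1 / (N : ℝ)) * ∑ ω, m.prior ω *
          visits (INKP m ν N β δ K) (m.success ω) fun cf h => (after m β K ν cf h).2 = g :=
  prob_observation i fun g' _ => g' = g

lemma prob_receives_pos (hm : m.Standing) (h0 : 0 ≤ δ) (h1 : δ ≤ 1) (i : Fin N) (g : Message)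
    (ω : State) (hω : 0 < visits (INKP m ν N β δ K) (m.success ω)
      fun cf h => (after m β K ν cf h).2 = g) :
    0 < prob (law m (INKP m ν N β δ K)) (receives (INKP m ν N β δ K) i g) := by
  have hN : (0 : ℝ) < 1 / N := by
    have := i.pos
    positivity
  rw [prob_receives]
  refine mul_pos hN (Finset.sum_pos' (fun ω' _ => ?_)
    ⟨ω, Finset.mem_univ _, mul_pos (hm.prior_pos ω) hω⟩)
  exact mul_nonneg (hm.prior_pos ω').le
    (visits_nonneg h0 h1 (hm.success_pos ω').le (hm.success_lt ω').le _)

/-- Both sides of the coin and all obedient histories have positive probability. Hence so does every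
message that is sent at some obedient history. -/
lemma visits_pos_of_obedient (hp0 : 0 < p) (hp1 : p < 1) (h0 : 0 < δ) (h1 : δ < 1)
    {past : List Reward} (ho : Obedient adv past) (hN : past.length < N) :
    0 < visits (INKP m ν N β δ K) p fun cf' h => (after m β K ν cf' h).2 = (aft past).2 := by
  have hnn : ∀ cf' n, 0 ≤ expect p (advice m β K ν cf') n fun h =>
      ind ((after m β K ν cf' h).2 = (aft past).2) := fun cf' n =>
    expect_nonneg hp0.le hp1.le fun _ _ _ => ind_nonneg _
  refine Finset.sum_pos' (fun cf' _ => mul_nonneg (bern_nonneg h0.le h1.le cf') <|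
    Finset.sum_nonneg fun n _ => hnn cf' n) ⟨cf, Finset.mem_univ _, ?_⟩
  refine mul_pos (bern_pos h0 h1 cf) (Finset.sum_pos' (fun n _ => hnn cf n)
    ⟨past.length, Finset.mem_range.2 hN, ?_⟩)
  exact expect_pos hp0 hp1 ho (fun _ => ind_nonneg _) (by rw [ind_of rfl]; norm_num)

lemma phase_of_length_ge (hK0 : 0 < K) {h : List Reward} (ho : Obedient adv h)
    (hK : K ≤ h.length) :
    (aft h).2.phase = .switching ∨ (aft h).2.phase = .exploitation := by
  cases regime hK0 ho hK with
  | early he hs hx hg hc ht hr => right; rw [hg]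
  | switching he hx hg hs hb ht hr hz => exact Or.inl hg
  | exploiting a he hx hg hz hw ht hr ha => right; rw [hg]

lemma gain_const_mul (c x : ℝ) (f : State → ℝ) :
    gain m c (fun ω => x * f ω) = x * gain m c f := by
  simp only [gain_eq]; ring

/-- The advantage of the risky arm before the intervention has the sign of the recommendation. -/
lemma gain_pre (hm : m.Standing) (n : ℕ) (a : Arm) (r : Option Reward) :
    (a = .risky → 0 ≤ gain m m.b fun ω => expect (m.success ω) (preArm m) n fun h =>
      ind (preArm m h = a ∧ h.head? = r)) ∧
    (a = .safe → gain m m.b (fun ω => expect (m.success ω) (preArm m) n fun h =>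
      ind (preArm m h = a ∧ h.head? = r)) ≤ 0) := by
  rcases Nat.eq_zero_or_pos n with rfl | hn
  · have hd := hm.prior_mean
    constructor
    · rintro rfl
      simp only [expect, gain_eq, preArm_nil, true_and]
      have := ind_nonneg (([] : List Reward).head? = r)
      nlinarith
    · rintro rfl
      simp [expect, gain_eq, preArm_nil]
  -- At a given stage the preferred arm is a function of the preceding reward, so the event is
  -- either empty or all of `h.head? = r`.
  · have h1 : ∀ ω, expect (m.success ω) (preArm m) n (fun h => ind (preArm m h = a ∧ h.head? = r))
        = ind (0 < preGain m n r ↔ a = .risky) *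
          expect (m.success ω) (preArm m) n fun h => ind (h.head? = r) := fun ω => by
      rw [← expect_mul]
      refine expect_congr fun l _ hl => ?_
      rw [ind_and_mul]
      by_cases hr : l.head? = r
      · congr 2
        have := preArm_eq_risky_iff hm (past := l) (by rintro rfl; simp at hl; omega)
        rw [hl, hr] at this
        rw [← this, eq_iff_iff]
        cases preArm m l <;> cases a <;> simp
      · rw [ind_not hr]; simp
    simp only [h1, gain_const_mul]
    change (_ → 0 ≤ _ * preGain m n r) ∧ (_ → _ * preGain m n r ≤ 0)
    constructor
    · rintro rfl
      by_cases hg : 0 < preGain m n r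
      · exact mul_nonneg (ind_nonneg _) hg.le
      · simp [hg]
    · rintro rfl
      by_cases hg : 0 < preGain m n r
      · simp [hg]
      · exact mul_nonpos_of_nonneg_of_nonpos (ind_nonneg _) (not_lt.1 hg)

lemma expect_pre_message (hK0 : 0 < K) (ω : State) (a : Arm) (r : Option Reward) (n : ℕ) :
    expect (m.success ω) adv n (fun h =>
      ind ((aft h).2 = ⟨a, .preIntervention, 0⟩ ∧ h.head? = r))
      = ind (n < K) * expect (m.success ω) (preArm m) n fun h =>
        ind (preArm m h = a ∧ h.head? = r) := by
  by_cases hn : n < K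
  · rw [ind_of hn, one_mul, ← expect_eq_pre (β := β) (ν := ν) (cf := cf) hn.le]
    refine expect_congr fun l hl hln => ?_
    rw [after_of_length_lt hl (by omega)]
    simp
  · rw [ind_not hn, zero_mul, ← expect_const (p := m.success ω) (act := adv) (n := n) 0]
    refine expect_congr fun l hl hln => ind_not ?_
    rintro ⟨h1, -⟩
    have := phase_of_length_ge hK0 hl (by omega)
    rw [h1] at this
    simp at this

/-- The agent does not know her stage, but at every stage below K this message comes with a gain of
the same sign. -/
lemma gain_pre_message (hm : m.Standing) (h0 : 0 ≤ δ) (h1 : δ ≤ 1) (hK0 : 0 < K) (a : Arm)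
    (r : Option Reward) :
    (a = .risky → 0 ≤ gain m m.b fun ω => visits (INKP m ν N β δ K) (m.success ω)
      fun cf h => (after m β K ν cf h).2 = ⟨a, .preIntervention, 0⟩ ∧ h.head? = r) ∧
    (a = .safe → gain m m.b (fun ω => visits (INKP m ν N β δ K) (m.success ω)
      fun cf h => (after m β K ν cf h).2 = ⟨a, .preIntervention, 0⟩ ∧ h.head? = r) ≤ 0) := by
  rw [gain_visits_INKP]
  simp only [expect_pre_message hK0, gain_const_mul]
  constructor
  · intro ha
    exact Finset.sum_nonneg fun cf _ => mul_nonneg (bern_nonneg h0 h1 cf) <|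
      Finset.sum_nonneg fun n _ => mul_nonneg (ind_nonneg _) ((gain_pre hm n a r).1 ha)
  · intro ha
    exact Finset.sum_nonpos fun cf _ => mul_nonpos_of_nonneg_of_nonpos (bern_nonneg h0 h1 cf) <|
      Finset.sum_nonpos fun n _ =>
        mul_nonpos_of_nonneg_of_nonpos (ind_nonneg _) ((gain_pre hm n a r).2 ha)

/-- A deviation is never announced if everybody obeys. -/
lemma phase_ne_deviation (hK0 : 0 < K) {h : List Reward} (ho : Obedient adv h) :
    (aft h).2.phase ≠ .deviation := by
  rcases lt_or_ge h.length K with hK | hK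
  · rw [after_of_length_lt ho hK]; simp
  · rcases phase_of_length_ge hK0 ho hK with h1 | h1 <;> rw [h1] <;> simp

lemma visits_deviation (hK0 : 0 < K) (a : Arm) :
    visits (INKP m ν N β δ K) p (fun cf h => (after m β K ν cf h).2 = ⟨a, .deviation, 0⟩) = 0 := by
  refine Finset.sum_eq_zero fun cf _ => mul_eq_zero_of_right _ (Finset.sum_eq_zero fun n _ => ?_)
  change expect p (advice m β K ν cf) n _ = 0
  rw [← expect_const (p := p) (act := advice m β K ν cf) (n := n) 0]
  refine expect_congr fun l hl _ => ind_not fun h => ?_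
  exact phase_ne_deviation hK0 hl (by rw [h])

/-- Expected number of stages with message `g` and preceding reward `r`. -/
def meanReceived (m : Model) (β δ : ℝ) (K : ℕ) (ν : ℕ → Reward → ℝ) (p : ℝ) (T : ℕ)
    (g : Message) (r : Option Reward) : ℝ :=
  ∑ cf, bern δ cf * received m β K ν cf p T g r

lemma visits_eq_meanReceived (g : Message) (r : Option Reward) :
    visits (INKP m ν (T + 1) β δ K) p (fun cf h => (after m β K ν cf h).2 = g ∧ h.head? = r)
      = meanReceived m β δ K ν p T g r := rfl

lemma meanReceived_nonneg (h0 : 0 ≤ δ) (h1 : δ ≤ 1) (hp0 : 0 ≤ p) (hp1 : p ≤ 1) (g : Message)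
    (r : Option Reward) : 0 ≤ meanReceived m β δ K ν p T g r :=
  visits_nonneg (N := T + 1) h0 h1 hp0 hp1 _

/-- Messages of the first two phases are sent only at obedient histories, hence have positive
probability. Exploitation messages are also sent after ignored deviations, so `hRpos` and `hSpos`
are needed to ensure that they occur under obedience. Deviation messages are evaluated with the very
belief that determines their arm. -/
lemma incentiveCompatible_of_gain (hm : m.Standing) (hβ : 0 < β) (hK0 : 0 < K)
    (h0 : 0 < δ) (h1 : δ < 1)
    (hR : ∀ r, 0 ≤ gain m m.b fun ω =>
      meanReceived m β δ K ν (m.success ω) T ⟨.risky, .exploitation, 0⟩ r)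
    (hRpos : 0 < meanReceived m β δ K ν m.pH T ⟨.risky, .exploitation, 0⟩ (some .one))
    (hS : ∀ r, gain m m.b (fun ω =>
      meanReceived m β δ K ν (m.success ω) T ⟨.safe, .exploitation, 0⟩ r) ≤ 0)
    (hSpos : 0 < meanReceived m β δ K ν m.pL T ⟨.safe, .exploitation, 0⟩ (some .safe))
    (hone : 0 ≤ gain m m.b fun ω =>
      meanReceived m β δ K ν (m.success ω) T (switchMessage β K .one) (some .one))
    (hzero : gain m (m.b + β / (2 * K)) (fun ω =>
      meanReceived m β δ K ν (m.success ω) T (switchMessage β K .zero) (some .zero)) ≤ 0)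
    (hsafe : 0 ≤ gain m (m.b - β / (2 * K)) fun ω =>
      meanReceived m β δ K ν (m.success ω) T (switchMessage β K .safe) (some .safe)) :
    IncentiveCompatible m ν (INKP m ν (T + 1) β δ K) := by
  intro i cf past hpast a
  have hmsg : (INKP m ν (T + 1) β δ K).msg cf past = (after m β K ν cf past).2 := rfl
  set A := agentMean m ν (INKP m ν (T + 1) β δ K) i cf past with hA
  have suff : ∀ (a' : Arm) (s : ℝ), (INKP m ν (T + 1) β δ K).msg cf past
        = ⟨a', (after m β K ν cf past).2.phase, s⟩ →
      0 ≤ s → (a' = .risky → m.b - s ≤ A) → (a' = .safe → A ≤ m.b + s) →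
      armMean m ν (INKP m ν (T + 1) β δ K) i cf past a ≤
        armMean m ν (INKP m ν (T + 1) β δ K) i cf past ((INKP m ν (T + 1) β δ K).msg cf past).arm
          + ((INKP m ν (T + 1) β δ K).msg cf past).subsidy := by
    intro a' s hg hs hr hsf
    rw [hg]
    cases a' <;> cases a <;> simp only [armMean, ← hA]
    · linarith
    · linarith [hr rfl]
    · linarith [hsf rfl]
    · linarith
  have hτ : 0 ≤ β / (2 * K) := by positivity
  have noSwitch : ∀ (c : ℝ) (r : Reward) (s : Option Reward), s ≠ some r → gain m c (fun ω =>
      meanReceived m β δ K ν (m.success ω) T (switchMessage β K r) s) = 0 := by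
    intro c r s hs
    simp only [meanReceived, received_switchMessage_ne hβ hK0 T hs, gain_eq]
    simp
  rcases after_cases (m := m) (β := β) (ν := ν) (cf := cf) hK0 past with
    ⟨ho, -, hg⟩ | ⟨ho, r, l, hrl, hg⟩ | ⟨a', hg⟩ | ⟨r, l, hrl, -, hg⟩
  · have hpos := prob_receives_pos hm h0.le h1.le i _ .H
      (visits_pos_of_obedient (hm.success_pos .H) (hm.success_lt .H) h0 h1 ho hpast)
    refine suff (preArm m past) 0 (by rw [hmsg, hg]) le_rfl (fun ha => ?_) (fun ha => ?_)
    · rw [sub_zero]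
      refine le_agentMean hpos fun r => ?_
      rw [hmsg, hg]
      exact (gain_pre_message hm h0.le h1.le hK0 _ r).1 ha
    · rw [add_zero]
      refine agentMean_le hpos fun r => ?_
      rw [hmsg, hg]
      exact (gain_pre_message hm h0.le h1.le hK0 _ r).2 ha
  · have hpos := prob_receives_pos hm h0.le h1.le i _ .H
      (visits_pos_of_obedient (hm.success_pos .H) (hm.success_lt .H) h0 h1 ho hpast)
    cases r
    · refine suff .safe (β / (2 * K)) (by rw [hmsg, hg]; rfl) hτ (by simp) fun _ => ?_
      refine agentMean_le hpos fun s => ?_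
      rw [hmsg, hg]
      by_cases hs : s = some .zero
      · subst hs; exact hzero
      · exact (noSwitch _ _ _ hs).le
    · refine suff .risky 0 (by rw [hmsg, hg]; rfl) le_rfl (fun _ => ?_) (by simp)
      rw [sub_zero]
      refine le_agentMean hpos fun s => ?_
      rw [hmsg, hg]
      by_cases hs : s = some .one
      · subst hs; exact hone
      · exact (noSwitch _ _ _ hs).ge
    · refine suff .risky (β / (2 * K)) (by rw [hmsg, hg]; rfl) hτ (fun _ => ?_) (by simp)
      refine le_agentMean hpos fun s => ?_
      rw [hmsg, hg]
      by_cases hs : s = some .safe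
      · subst hs; exact hsafe
      · exact (noSwitch _ _ _ hs).ge
  · have split : ∀ ω r, 0 < meanReceived m β δ K ν (m.success ω) T ⟨a', .exploitation, 0⟩ (some r) →
        0 < prob (law m (INKP m ν (T + 1) β δ K))
          (receives (INKP m ν (T + 1) β δ K) i ((INKP m ν (T + 1) β δ K).msg cf past)) := by
      intro ω r hr
      refine prob_receives_pos hm h0.le h1.le i _ ω ?_
      rw [hmsg, hg, visits_split]
      simp only [visits_eq_meanReceived]
      have hnn := meanReceived_nonneg (m := m) (β := β) (K := K) (ν := ν) (T := T) h0.le h1.le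
        (hm.success_pos ω).le (hm.success_lt ω).le ⟨a', .exploitation, 0⟩
      have := hnn none; have := hnn (some .zero); have := hnn (some .one); have := hnn (some .safe)
      cases r <;> linarith
    cases a'
    · refine suff .risky 0 (by rw [hmsg, hg]) le_rfl (fun _ => ?_) (by simp)
      rw [sub_zero]
      refine le_agentMean (split .H .one hRpos) fun r => ?_
      rw [hmsg, hg]
      exact hR r
    · refine suff .safe 0 (by rw [hmsg, hg]) le_rfl (by simp) (fun _ => ?_)
      rw [add_zero]
      refine agentMean_le (split .L .safe hSpos) fun r => ?_
      rw [hmsg, hg]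
      exact hS r
  · have hz : prob (law m (INKP m ν (T + 1) β δ K))
        (receives (INKP m ν (T + 1) β δ K) i ((INKP m ν (T + 1) β δ K).msg cf past)) = 0 := by
      rw [prob_receives, hmsg, hg]
      simp [visits_deviation hK0]
    have hz' : ¬ 0 < prob (law m (INKP m ν (T + 1) β δ K))
        (observes (INKP m ν (T + 1) β δ K) i ((INKP m ν (T + 1) β δ K).msg cf past)
          past.head?) := by
      have h2 : ∑ ω, m.prior ω * visits (INKP m ν (T + 1) β δ K) (m.success ω) (fun cf' h =>
          (after m β K ν cf' h).2 = (after m β K ν cf past).2 ∧ h.head? = past.head?) = 0 := by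
        refine Finset.sum_eq_zero fun ω _ => mul_eq_zero_of_right _ ?_
        refine le_antisymm ?_ (visits_nonneg h0.le h1.le (hm.success_pos ω).le
          (hm.success_lt ω).le _)
        rw [hg]
        refine le_trans ?_ (visits_deviation (m := m) (β := β) (ν := ν) (N := T + 1) (δ := δ)
          (p := m.success ω) hK0 (if m.b < m.mean (ν past.length r) then .risky else .safe)).le
        refine sum_bern_le (δ := δ) h0.le h1.le fun cf' => Finset.sum_le_sum fun n _ => ?_
        exact expect_mono (hm.success_pos ω).le (hm.success_lt ω).le
          fun _ _ _ => ind_mono fun h => h.1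
      have h3 := prob_observation (m := m) (M := INKP m ν (T + 1) β δ K) i
        fun g r => g = (after m β K ν cf past).2 ∧ r = past.head?
      have h4 := h3.trans (by rw [show (∑ ω, m.prior ω * visits (INKP m ν (T + 1) β δ K)
        (m.success ω) fun cf' h => (INKP m ν (T + 1) β δ K).msg cf' h = (after m β K ν cf past).2 ∧
          h.head? = past.head?) = 0 from h2, mul_zero])
      exact h4.le.not_gt
    have hval : A = m.mean (ν past.length r) := by
      rw [hA]
      unfold agentMean
      simp only [hz, hz', lt_irrefl, if_false]
      subst hrl
      rfl
    refine suff (if m.b < m.mean (ν past.length r) then .risky else .safe) 0 (by rw [hmsg, hg])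
      le_rfl (fun h => ?_) (fun h => ?_)
    · split_ifs at h with h5
      rw [hval]; linarith
    · split_ifs at h with h5
      rw [hval]; linarith

end

/-! ### The choice of the parameters -/

/-- Advantage of the risky arm in state `H`, weighted by the prior. -/
def Model.up (m : Model) : ℝ := m.q * (m.pH - m.b)

/-- Disadvantage of the risky arm in state `L`, weighted by the prior. -/
def Model.down (m : Model) : ℝ := (1 - m.q) * (m.b - m.pL)

lemma Model.Standing.up_pos {m : Model} (hm : m.Standing) : 0 < m.up :=
  mul_pos hm.q_pos (sub_pos.2 hm.lt_pH)

lemma Model.Standing.down_pos {m : Model} (hm : m.Standing) : 0 < m.down :=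
  mul_pos (sub_pos.2 hm.q_lt) (sub_pos.2 hm.pL_lt)

lemma gain_b (m : Model) (f : State → ℝ) :
    gain m m.b f = m.up * f .H - m.down * f .L := gain_eq m m.b f

/-- An error probability `e` that is small enough. -/
structure Margin (m : Model) (ε c e : ℝ) : Prop where
  pos : 0 < e
  -- The factor 4 arises because in L the risky arm is exploited with probability at most 2e, while
  -- in H only half of all stages are counted.
  risky_one : 4 * m.down * e ≤ m.up * m.pH * (1 - 2 * e)
  risky_zero : 4 * m.down * e ≤ m.up * (1 - m.pH) * (1 - 2 * e)
  risky_safe : 2 * m.down * e ≤ m.up * (1 - m.pH - 2 * e)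
  safe_safe : 2 * m.up * e ≤ m.down * (1 - 3 * e)
  safe_one : m.up * m.pH * e ≤ m.down * m.pL * (c - 3 * e)
  safe_zero : m.up * (1 - m.pH) * e ≤ m.down * (1 - m.pL) * (c - 3 * e)
  eps : 6 * e ≤ ε
  -- This makes the weighted probability of switching without the help of the coin smaller in H than
  -- in L, so that a positive bias can restore balance.
  coin : (m.up + m.down) * e < m.down * c
  third : 3 * e < 1

open Filter Topology in
lemma eventually_mul_lt {A : ℝ} (hA : 0 < A) (B : ℝ) : ∀ᶠ e in 𝓝[>] (0 : ℝ), B * e < A := by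
  have : Tendsto (fun e : ℝ => B * e) (𝓝[>] 0) (𝓝 (B * 0)) :=
    ((continuous_const.mul continuous_id).tendsto 0).mono_left nhdsWithin_le_nhds
  rw [mul_zero] at this
  exact this.eventually_lt_const hA

open Filter Topology in
lemma exists_small {A₁ A₂ A₃ : ℝ} (h₁ : 0 < A₁) (h₂ : 0 < A₂) (h₃ : 0 < A₃) (B₁ B₂ B₃ : ℝ) :
    ∃ η, 0 < η ∧ B₁ * η < A₁ ∧ B₂ * η < A₂ ∧ B₃ * η < A₃ := by
  obtain ⟨η, ⟨⟨h1, h2⟩, h3⟩, h0⟩ := (((eventually_mul_lt h₁ B₁).and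
    (eventually_mul_lt h₂ B₂)).and (eventually_mul_lt h₃ B₃)).and self_mem_nhdsWithin |>.exists
  exact ⟨η, h0, h1, h2, h3⟩

open Filter Topology in
lemma exists_margin {m : Model} (hm : m.Standing) {ε c : ℝ} (hε : 0 < ε) (hc : 0 < c) :
    ∃ e, Margin m ε c e := by
  have hu := hm.up_pos
  have hd := hm.down_pos
  have h1 := hm.success_pos .H
  have h2 := sub_pos.2 (hm.success_lt .H)
  have h3 := hm.success_pos .L
  have h4 := sub_pos.2 (hm.success_lt .L)
  simp only [Model.success] at h1 h2 h3 h4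
  have := ((((((((((eventually_mul_lt (mul_pos hu h1) (4 * m.down + m.up * m.pH * 2)).and
    (eventually_mul_lt (mul_pos hu h2) (4 * m.down + m.up * (1 - m.pH) * 2))).and
    (eventually_mul_lt (mul_pos hu h2) (2 * m.down + m.up * 2))).and
    (eventually_mul_lt hd (2 * m.up + m.down * 3))).and
    (eventually_mul_lt (mul_pos (mul_pos hd h3) hc) (m.up * m.pH + m.down * m.pL * 3))).and
    (eventually_mul_lt (mul_pos (mul_pos hd h4) hc)
      (m.up * (1 - m.pH) + m.down * (1 - m.pL) * 3))).and
    (eventually_mul_lt hε 6)).and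
    (eventually_mul_lt (mul_pos hd hc) (m.up + m.down))).and
    (eventually_mul_lt one_pos 3)).and self_mem_nhdsWithin).exists
  obtain ⟨e, ⟨⟨⟨⟨⟨⟨⟨⟨⟨e1, e2⟩, e3⟩, e4⟩, e5⟩, e6⟩, e7⟩, e8⟩, e9⟩, e10⟩⟩ := this
  exact ⟨e, e10, by linarith, by linarith, by linarith, by linarith, by linarith, by linarith,
    e7.le, e8, e9⟩

lemma errorBound_le {m : Model} (hm : m.Standing) {e : ℝ} (he : 0 < e) :
    ∃ K₀ : ℕ, 0 < K₀ ∧ ∀ K, K₀ ≤ K → errorBound m K ≤ e := by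
  have hg := hm.gap_pos
  set g := (m.pH - m.pL) / 2 with hgdef
  obtain ⟨k, hk⟩ := exists_nat_ge (2 / (g ^ 2 * e))
  refine ⟨k + 1, by omega, fun K hK => ?_⟩
  have hK1 : (1 : ℝ) ≤ K := by exact_mod_cast (by omega : 1 ≤ K)
  have hk2 : (k : ℝ) ≤ K := by exact_mod_cast (by omega : k ≤ K)
  rw [errorBound, div_le_iff₀ (by positivity)]
  rw [div_le_iff₀ (by positivity)] at hk
  have : 2 ≤ K * (g ^ 2 * e) := hk.trans (mul_le_mul_of_nonneg_right hk2 (by positivity))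
  have h2 : (K : ℝ) * 2 ≤ K * (K * (g ^ 2 * e)) := mul_le_mul_of_nonneg_left this (by linarith)
  calc (1 : ℝ) + K ≤ K * 2 := by linarith
    _ ≤ K * (K * (g ^ 2 * e)) := h2
    _ = e * (K * g) ^ 2 := by ring

/-- The bound of order 1/n in `pending_le` involves neither β nor ν, so the number of agents can be
fixed before the beliefs are given. -/
lemma exists_pending_le {m : Model} (hm : m.Standing) {K : ℕ} (hK0 : 0 < K) {x : ℝ} (hx : 0 < x) :
    ∃ M, K ≤ M ∧ ∀ (β : ℝ) (ν : ℕ → Reward → ℝ) (cf : Bool) (ω : State) (n : ℕ), M ≤ n →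
      pending m β K ν cf (m.success ω) n ≤ x := by
  have hq := sub_pos.2 hm.pH_lt
  obtain ⟨k, hk⟩ := exists_nat_ge ((2 * K + 1) / ((1 - m.pH) * x))
  rw [div_le_iff₀ (by positivity)] at hk
  refine ⟨K + k, by omega, fun β ν cf ω n hn => ?_⟩
  have h1 := pending_le (m := m) (β := β) (ν := ν) (cf := cf) (n := n) (hm.success_pos ω).le
    (hm.success_lt ω) hK0 (by omega)
  have hω : 1 - m.pH ≤ 1 - m.success ω := by
    have := hm.pL_lt; have := hm.lt_pH
    cases ω <;> simp only [Model.success] <;> linarith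
  have hn' : (K : ℝ) + k ≤ n := by exact_mod_cast hn
  by_contra hlt
  rw [not_le] at hlt
  have h2 : (k : ℝ) * ((1 - m.pH) * x) < ((n : ℝ) - K + 1) * ((1 - m.success ω) *
      pending m β K ν cf (m.success ω) n) := by
    have h3 : (1 - m.pH) * x ≤ (1 - m.success ω) * pending m β K ν cf (m.success ω) n :=
      mul_le_mul hω hlt.le hx.le (hq.le.trans hω)
    have h4 : (0 : ℝ) < (1 - m.pH) * x := by positivity
    have h5 : (k : ℝ) < (n : ℝ) - K + 1 := by linarith
    have h6 : (0 : ℝ) ≤ k := by positivity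
    calc (k : ℝ) * ((1 - m.pH) * x) < ((n : ℝ) - K + 1) * ((1 - m.pH) * x) :=
          mul_lt_mul_of_pos_right h5 h4
      _ ≤ _ := mul_le_mul_of_nonneg_left h3 (by linarith)
  linarith

/-- Probability that switching begins. -/
def totalSwitchProb (m : Model) (K : ℕ) (δ p : ℝ) : ℝ := ∑ cf, bern δ cf * switchProb m K cf p

lemma totalSwitchProb_eq (m : Model) (K : ℕ) (δ p : ℝ) :
    totalSwitchProb m K δ p = δ + (1 - δ) * switchProb m K false p := by
  have h : switchProb m K true p = 1 := by
    rw [switchProb, ← expect_const (p := p) (act := preArm m) (n := K) 1]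
    congr 1
    funext h
    simp [Early]
  simp [totalSwitchProb, bern, h]

lemma le_totalSwitchProb {m : Model} (hm : m.Standing) (K : ℕ) {δ : ℝ} (h1 : δ ≤ 1) (ω : State) :
    δ ≤ totalSwitchProb m K δ (m.success ω) := by
  rw [totalSwitchProb_eq]
  have := (switchProb_mem (m := m) (K := K) (cf := false) (hm.success_pos ω).le
    (hm.success_lt ω).le).1
  have := mul_nonneg (sub_nonneg.2 h1) this
  linarith

/-- The bias of the coin can be chosen such that the belief at the beginning of switching makes
both arms equally attractive. -/
lemma exists_bias {m : Model} (hm : m.Standing) {ε c e : ℝ} (he : Margin m ε c e) {K : ℕ}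
    (hK0 : 0 < K) (hc : c ≤ preRisky m K .L) (hK : errorBound m K ≤ e) :
    ∃ δ, 0 < δ ∧ δ < 1 ∧
      m.up * totalSwitchProb m K δ m.pH = m.down * totalSwitchProb m K δ m.pL := by
  have hu := hm.up_pos
  have hd := hm.down_pos
  have h1 : switchProb m K false m.pH ≤ 1 - preRisky m K .H + e := by
    refine le_trans ?_ (add_le_add_right ((pre_low_le hm hK0).trans hK) _)
    rw [← expect_const (p := m.pH) (act := preArm m) (n := K) 1, preRisky]
    simp only [Model.success]
    rw [← expect_sub, ← expect_add]
    refine expect_mono (hm.success_pos .H).le (hm.success_lt .H).le fun l _ _ => ?_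
    by_cases h : AllRisky l
    · simp [Early, h]
    · simp [Early, h]
  have h2 : 1 - e ≤ switchProb m K false m.pL := by
    have := (pre_high_le hm hK0).trans hK
    refine le_trans (sub_le_sub_left this 1) ?_
    rw [← expect_const (p := m.pL) (act := preArm m) (n := K) 1, ← expect_sub]
    refine expect_mono (hm.success_pos .L).le (hm.success_lt .L).le fun l _ _ => ?_
    by_cases h : AllRisky l ∧ (m.pH + m.pL) / 2 ≤ (l.map m.value).sum / K
    · simp [Early, h]
    · simp only [h, ind_false, sub_zero]
      rw [ind_of]
      exact fun h' => h h'.1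
  have h3 := preRisky_gain hm K
  change m.up - m.down ≤ m.up * _ - m.down * _ at h3
  have h4 : 0 < m.up - m.down := by
    have := hm.prior_mean
    simp only [Model.up, Model.down]; linarith
  have h5 := he.coin
  have h6 := mul_le_mul_of_nonneg_left hc hd.le
  have h7 := mul_le_mul_of_nonneg_left h1 hu.le
  have h8 := mul_le_mul_of_nonneg_left h2 hd.le
  set sH := switchProb m K false m.pH
  set sL := switchProb m K false m.pL
  -- Equivalently `m.up * sH < m.down * sL`. By `preRisky_gain` the weighted probability of a safe
  -- pull in H is at most that in L, which is at most `m.down * (1 - c)`; the remaining errors are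
  -- below `m.down * c`.
  have hD : m.up - m.down < m.up * (1 - sH) - m.down * (1 - sL) := by linarith
  set D := m.up * (1 - sH) - m.down * (1 - sL) with hDdef
  have hD0 : 0 < D := h4.trans hD
  -- Since the probability of switching is 1 - (1-δ)(1-s), the balance equation reads (1-δ) D =
  -- `m.up - m.down`.
  refine ⟨1 - (m.up - m.down) / D, ?_, ?_, ?_⟩
  · rw [sub_pos, div_lt_one hD0]; exact hD
  · have := div_pos h4 hD0
    linarith
  · rw [totalSwitchProb_eq, totalSwitchProb_eq]
    have h9 : (m.up - m.down) / D * D = m.up - m.down := div_mul_cancel₀ _ hD0.ne'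
    set y := (m.up - m.down) / D
    have : y * D = y * (m.up * (1 - sH) - m.down * (1 - sL)) := rfl
    linarith

section

variable {m : Model} {β δ ε c e : ℝ} {K : ℕ} {ν : ℕ → Reward → ℝ} {T : ℕ}

local notation "rec" => meanReceived m β δ K ν

lemma meanReceived_le (h0 : 0 ≤ δ) (h1 : δ ≤ 1) {p B : ℝ} {g : Message} {r : Option Reward}
    (h : ∀ cf, received m β K ν cf p T g r ≤ B) : meanReceived m β δ K ν p T g r ≤ B :=
  (sum_bern_le h0 h1 h).trans (sum_bern_const δ B).le

lemma le_meanReceived (h0 : 0 ≤ δ) (h1 : δ ≤ 1) {p B : ℝ} {g : Message} {r : Option Reward}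
    (h : ∀ cf, B ≤ received m β K ν cf p T g r) : B ≤ meanReceived m β δ K ν p T g r :=
  (sum_bern_const δ B).ge.trans (sum_bern_le h0 h1 h)

/-! ### The exploitation phase -/

/-- The error probabilities are at most `e`, for the estimate from `K` rewards and for switching to
last longer than `M` stages; `T + 1`, the number of agents, is much larger than `M`. -/
structure Tuned (m : Model) (β : ℝ) (K : ℕ) (ν : ℕ → Reward → ℝ) (e : ℝ) (M T : ℕ) : Prop where
  K_pos : 0 < K
  K_le : K ≤ M
  error : errorBound m K ≤ e
  pending_le : ∀ cf ω n, M ≤ n → pending m β K ν cf (m.success ω) n ≤ e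
  long : 2 * (M + 1) ≤ T + 1

variable {M : ℕ}

namespace Tuned

lemma M_le (ht : Tuned m β K ν e M T) : M ≤ T := by have := ht.long; omega

lemma K_le_T (ht : Tuned m β K ν e M T) : K ≤ T := ht.K_le.trans ht.M_le

lemma half (ht : Tuned m β K ν e M T) : ((T : ℝ) + 1) / 2 ≤ T - M := by
  have : (2 : ℝ) * (M + 1) ≤ T + 1 := by exact_mod_cast ht.long
  linarith

lemma exploits_risky (hm : m.Standing) (ht : Tuned m β K ν e M T) (cf : Bool) :
    1 - 2 * e ≤ exploits m β K ν cf m.pH .risky M := by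
  have h1 := exploits_safe_le (β := β) (ν := ν) (cf := cf) hm ht.K_pos ht.K_le
  have h2 := ht.pending_le cf .H M le_rfl
  have h3 := exploits_add (m := m) (β := β) (K := K) (ν := ν) (cf := cf) (p := m.pH) (n := M)
  have h4 := ht.error
  simp only [Model.success] at h2
  linarith

lemma exploits_safe (hm : m.Standing) (ht : Tuned m β K ν e M T) (cf : Bool) :
    1 - 3 * e ≤ exploits m β K ν cf m.pL .safe M := by
  have h1 := exploits_risky_le (β := β) (ν := ν) (cf := cf) hm ht.K_pos ht.K_le
  have h2 := ht.pending_le cf .L M le_rfl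
  have h3 := exploits_add (m := m) (β := β) (K := K) (ν := ν) (cf := cf) (p := m.pL) (n := M)
  have h4 := ht.error
  simp only [Model.success] at h2
  linarith

lemma le_received_risky (hm : m.Standing) (ht : Tuned m β K ν e M T) (he : Margin m ε c e)
    (cf : Bool) (r : Reward) (hr : r.arm = .risky) :
    ((T : ℝ) + 1) / 2 * (rewardProb m.pH r * (1 - 2 * e))
      ≤ received m β K ν cf m.pH T ⟨.risky, .exploitation, 0⟩ (some r) := by
  have hp0 := (hm.success_pos .H).le
  have hp1 := (hm.success_lt .H).le
  simp only [Model.success] at hp0 hp1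
  have h1 := le_received_exploit (m := m) (β := β) (ν := ν) (cf := cf) hp0 hp1 ht.K_pos ht.M_le r
  rw [hr] at h1
  have hw : 0 ≤ rewardProb m.pH r := by cases r <;> simp [rewardProb] <;> linarith
  have h2 : 0 ≤ 1 - 2 * e := by linarith [he.third, he.pos]
  refine le_trans ?_ h1
  have := ht.half
  have h3 : (0 : ℝ) ≤ (T + 1) / 2 := by positivity
  exact mul_le_mul this (mul_le_mul_of_nonneg_left (ht.exploits_risky hm cf) hw)
    (mul_nonneg hw h2) (h3.trans this)

lemma gain_risky (hm : m.Standing) (ht : Tuned m β K ν e M T) (he : Margin m ε c e)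
    (h0 : 0 ≤ δ) (h1 : δ ≤ 1) (r : Option Reward) :
    0 ≤ gain m m.b fun ω => rec (m.success ω) T ⟨.risky, .exploitation, 0⟩ r := by
  have hu := hm.up_pos
  have hd := hm.down_pos
  have hH0 := (hm.success_pos .H).le
  have hH1 := (hm.success_lt .H).le
  have hL0 := (hm.success_pos .L).le
  have hL1 := (hm.success_lt .L).le
  simp only [Model.success] at hH0 hH1 hL0 hL1
  have hT : (0 : ℝ) < T + 1 := by positivity
  rw [gain_b]
  simp only [Model.success]
  have hL : ∀ r, rec m.pL T ⟨.risky, .exploitation, 0⟩ r ≤ (T + 1) * (2 * e) := fun r =>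
    meanReceived_le h0 h1 fun cf =>
      (received_exploit_le hL0 hL1 ht.K_pos T .risky r).trans
        (mul_le_mul_of_nonneg_left ((exploits_risky_le hm ht.K_pos ht.K_le_T).trans
          (by linarith [ht.error])) hT.le)
  have risky : ∀ r : Reward, r.arm = .risky →
      4 * m.down * e ≤ m.up * rewardProb m.pH r * (1 - 2 * e) →
      0 ≤ m.up * rec m.pH T ⟨.risky, .exploitation, 0⟩ (some r)
        - m.down * rec m.pL T ⟨.risky, .exploitation, 0⟩ (some r) := by
    intro r hr hmar
    have h2 : ((T : ℝ) + 1) / 2 * (rewardProb m.pH r * (1 - 2 * e))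
        ≤ rec m.pH T ⟨.risky, .exploitation, 0⟩ (some r) :=
      le_meanReceived h0 h1 fun cf => ht.le_received_risky hm he cf r hr
    have h3 := mul_le_mul_of_nonneg_left h2 hu.le
    have h4 := mul_le_mul_of_nonneg_left (hL (some r)) hd.le
    have h5 := mul_le_mul_of_nonneg_left hmar hT.le
    linarith
  rcases r with _ | r
  · have : ∀ p, rec p T ⟨.risky, .exploitation, 0⟩ none = 0 := fun p => by
      simp [meanReceived, received_exploit_none ht.K_pos]
    rw [this, this]; simp
  cases r
  · exact risky .zero rfl he.risky_zero
  · exact risky .one rfl he.risky_one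
  -- A large number of agents is of no help here, as this observation occurs at most once. If nobody
  -- pulls the safe arm without intervention, it never occurs; otherwise its probability in H is at
  -- least 1 - pH - 2e.
  · rcases preRisky_dichotomy hm K with h2 | h2
    · have h3 : rec m.pL T ⟨.risky, .exploitation, 0⟩ (some .safe) ≤ 0 :=
        meanReceived_le h0 h1 fun cf => by
          rw [received_risky_safe ht.K_pos ht.K_le_T]
          refine (turns_risky_bounds hm ht.K_pos ht.K_le_T .L).1.trans ?_
          rw [h2]; simp
      have h4 := meanReceived_nonneg (m := m) (β := β) (K := K) (ν := ν) (T := T) h0 h1 hH0 hH1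
        ⟨.risky, .exploitation, 0⟩ (some .safe)
      have h5 := mul_nonneg hu.le h4
      have h6 := mul_nonpos_of_nonneg_of_nonpos hd.le h3
      linarith
    · have h3 : rec m.pL T ⟨.risky, .exploitation, 0⟩ (some .safe) ≤ 2 * e :=
        meanReceived_le h0 h1 fun cf => by
          rw [received_risky_safe ht.K_pos ht.K_le_T]
          exact (turns_le hL0 hL1 _).trans ((exploits_risky_le hm ht.K_pos ht.K_le_T).trans
            (by linarith [ht.error]))
      have h4 : 1 - m.pH - 2 * e ≤ rec m.pH T ⟨.risky, .exploitation, 0⟩ (some .safe) :=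
        le_meanReceived h0 h1 fun cf => by
          rw [received_risky_safe ht.K_pos ht.K_le_T]
          have h5 := (turns_risky_bounds (β := β) (ν := ν) (cf := cf) hm ht.K_pos ht.K_le_T .H).2
          have h6 := exploits_safe_le (β := β) (ν := ν) (cf := cf) hm ht.K_pos ht.K_le_T
          have h7 := ht.pending_le cf .H T ht.M_le
          have h8 := ht.error
          simp only [Model.success] at h5 h7
          linarith
      have h5 := mul_le_mul_of_nonneg_left h4 hu.le
      have h6 := mul_le_mul_of_nonneg_left h3 hd.le
      linarith [he.risky_safe]

lemma received_risky_pos (hm : m.Standing) (ht : Tuned m β K ν e M T) (he : Margin m ε c e)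
    (h0 : 0 ≤ δ) (h1 : δ ≤ 1) :
    0 < rec m.pH T ⟨.risky, .exploitation, 0⟩ (some .one) := by
  have h2 : ((T : ℝ) + 1) / 2 * (rewardProb m.pH .one * (1 - 2 * e))
      ≤ rec m.pH T ⟨.risky, .exploitation, 0⟩ (some .one) :=
    le_meanReceived h0 h1 fun cf => ht.le_received_risky hm he cf .one rfl
  have h3 := hm.success_pos .H
  have h4 : 0 < 1 - 2 * e := by linarith [he.third, he.pos]
  simp only [Model.success] at h3
  simp only [rewardProb] at h2
  exact lt_of_lt_of_le (by positivity) h2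

lemma le_received_safe (hm : m.Standing) (ht : Tuned m β K ν e M T) (he : Margin m ε c e)
    (h0 : 0 ≤ δ) (h1 : δ ≤ 1) :
    ((T : ℝ) + 1) / 2 * (1 - 3 * e) ≤ rec m.pL T ⟨.safe, .exploitation, 0⟩ (some .safe) := by
  refine le_meanReceived h0 h1 fun cf => ?_
  have h2 := le_received_exploit (m := m) (β := β) (ν := ν) (cf := cf) (hm.success_pos .L).le
    (hm.success_lt .L).le ht.K_pos ht.M_le .safe
  simp only [Reward.arm, rewardProb, one_mul] at h2
  have h3 : (0 : ℝ) ≤ (T + 1) / 2 := by positivity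
  refine le_trans ?_ h2
  exact mul_le_mul ht.half (ht.exploits_safe hm cf) (by linarith [he.third]) (h3.trans ht.half)

lemma gain_safe (hm : m.Standing) (ht : Tuned m β K ν e M T) (he : Margin m ε c e)
    (hc : c ≤ preRisky m K .L) (h0 : 0 ≤ δ) (h1 : δ ≤ 1) (r : Option Reward) :
    gain m m.b (fun ω => rec (m.success ω) T ⟨.safe, .exploitation, 0⟩ r) ≤ 0 := by
  have hu := hm.up_pos
  have hd := hm.down_pos
  have hH0 := (hm.success_pos .H).le
  have hH1 := (hm.success_lt .H).le
  have hL0 := (hm.success_pos .L).le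
  have hL1 := (hm.success_lt .L).le
  simp only [Model.success] at hH0 hH1 hL0 hL1
  have hT : (0 : ℝ) < T + 1 := by positivity
  rw [gain_b]
  simp only [Model.success]
  have turnH : ∀ cf, turns m β K ν cf m.pH .safe T ≤ e := fun cf =>
    (turns_le hH0 hH1 _).trans ((exploits_safe_le hm ht.K_pos ht.K_le_T).trans ht.error)
  -- A reward 0 or 1 precedes this message at most once, so again the number of agents does not
  -- help. The bound c does not depend on K, so K can be taken large enough to make the error small
  -- in comparison.
  have turnL : ∀ cf, c - 3 * e ≤ turns m β K ν cf m.pL .safe T := fun cf => by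
    have h5 := le_turns_safe (β := β) (ν := ν) (cf := cf) hm ht.K_pos ht.K_le_T .L
    have h6 := exploits_risky_le (β := β) (ν := ν) (cf := cf) hm ht.K_pos ht.K_le_T
    have h7 := ht.pending_le cf .L T ht.M_le
    have h8 := ht.error
    simp only [Model.success] at h5 h7
    linarith
  rcases r with _ | r
  · have : ∀ p, rec p T ⟨.safe, .exploitation, 0⟩ none = 0 := fun p => by
      simp [meanReceived, received_exploit_none ht.K_pos]
    rw [this, this]; simp
  cases r
  · have h2 : rec m.pH T ⟨.safe, .exploitation, 0⟩ (some .zero) ≤ (1 - m.pH) * e :=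
      meanReceived_le h0 h1 fun cf => by
        rw [(received_safe_risky ht.K_pos ht.K_le_T).2]
        exact mul_le_mul_of_nonneg_left (turnH cf) (by linarith)
    have h3 : (1 - m.pL) * (c - 3 * e) ≤ rec m.pL T ⟨.safe, .exploitation, 0⟩ (some .zero) :=
      le_meanReceived h0 h1 fun cf => by
        rw [(received_safe_risky ht.K_pos ht.K_le_T).2]
        exact mul_le_mul_of_nonneg_left (turnL cf) (by linarith)
    have h5 := mul_le_mul_of_nonneg_left h2 hu.le
    have h6 := mul_le_mul_of_nonneg_left h3 hd.le
    linarith [he.safe_zero]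
  · have h2 : rec m.pH T ⟨.safe, .exploitation, 0⟩ (some .one) ≤ m.pH * e :=
      meanReceived_le h0 h1 fun cf => by
        rw [(received_safe_risky ht.K_pos ht.K_le_T).1]
        exact mul_le_mul_of_nonneg_left (turnH cf) hH0
    have h3 : m.pL * (c - 3 * e) ≤ rec m.pL T ⟨.safe, .exploitation, 0⟩ (some .one) :=
      le_meanReceived h0 h1 fun cf => by
        rw [(received_safe_risky ht.K_pos ht.K_le_T).1]
        exact mul_le_mul_of_nonneg_left (turnL cf) hL0
    have h5 := mul_le_mul_of_nonneg_left h2 hu.le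
    have h6 := mul_le_mul_of_nonneg_left h3 hd.le
    linarith [he.safe_one]
  · have h2 : rec m.pH T ⟨.safe, .exploitation, 0⟩ (some .safe) ≤ (T + 1) * e :=
      meanReceived_le h0 h1 fun cf =>
        (received_exploit_le hH0 hH1 ht.K_pos T .safe _).trans
          (mul_le_mul_of_nonneg_left ((exploits_safe_le hm ht.K_pos ht.K_le_T).trans ht.error) hT.le)
    have h5 := mul_le_mul_of_nonneg_left h2 hu.le
    have h6 := mul_le_mul_of_nonneg_left (ht.le_received_safe (δ := δ) hm he h0 h1) hd.le
    have h7 := mul_le_mul_of_nonneg_left he.safe_safe hT.le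
    linarith

/-! ### The switching phase -/

lemma switch_bounds (hm : m.Standing) (hβ : 0 < β) (hK0 : 0 < K) (hT : K ≤ T) {η : ℝ}
    (hη : ∀ cf ω, pending m β K ν cf (m.success ω) T ≤ η) (h0 : 0 ≤ δ) (h1 : δ ≤ 1)
    (ω : State) {r : Reward} (hr : r = .zero ∨ r = .safe) :
    rec (m.success ω) T (switchMessage β K r) (some r)
      ≤ K * totalSwitchProb m K δ (m.success ω) ∧
    K * (totalSwitchProb m K δ (m.success ω) - η)
      ≤ rec (m.success ω) T (switchMessage β K r) (some r) := by
  have h := fun cf => expect_switchCount_bounds (m := m) (β := β) (ν := ν) (cf := cf)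
    (hm.success_pos ω).le (hm.success_lt ω).le hK0 hT hr
  have hKr : (0 : ℝ) ≤ K := by positivity
  simp only [meanReceived, received_switchMessage hβ hK0]
  constructor
  · refine (sum_bern_le h0 h1 fun cf => (h cf).1).trans (le_of_eq ?_)
    rw [totalSwitchProb, Finset.mul_sum]
    exact Finset.sum_congr rfl fun _ _ => by ring
  · refine le_trans (le_of_eq ?_) (sum_bern_le h0 h1
      (f := fun cf => K * (switchProb m K cf (m.success ω) - η)) fun cf =>
        (mul_le_mul_of_nonneg_left (sub_le_sub_left (hη cf ω) _) hKr).trans (h cf).2)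
    rw [totalSwitchProb, ← sum_bern_const δ η, ← Finset.sum_sub_distrib, Finset.mul_sum]
    exact Finset.sum_congr rfl fun _ _ => by rw [sum_bern_const]; ring

lemma ones_bounds (hm : m.Standing) (hβ : 0 < β) (hK0 : 0 < K) (hT : K ≤ T) {η : ℝ}
    (hη : ∀ cf ω, pending m β K ν cf (m.success ω) T ≤ η) (h0 : 0 ≤ δ) (h1 : δ ≤ 1)
    (ω : State) :
    (1 - m.success ω) * rec (m.success ω) T (switchMessage β K .one) (some .one)
      ≤ (m.success ω * K + (1 - m.success ω)) * totalSwitchProb m K δ (m.success ω) ∧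
    m.success ω * (K * (totalSwitchProb m K δ (m.success ω) - η)
        - totalSwitchProb m K δ (m.success ω))
      ≤ (1 - m.success ω) * rec (m.success ω) T (switchMessage β K .one) (some .one) := by
  have h := fun cf => expect_ones_bounds (m := m) (β := β) (ν := ν) (cf := cf)
    (hm.success_pos ω).le (hm.success_lt ω).le hK0 hT
  have hKr : (0 : ℝ) ≤ K := by positivity
  have hp := (hm.success_pos ω).le
  have e1 : (1 - m.success ω) * rec (m.success ω) T (switchMessage β K .one) (some .one)
      = ∑ cf, bern δ cf * ((1 - m.success ω) *
        expect (m.success ω) (advice m β K ν cf) T (switchCount m β K ν cf .one)) := by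
    simp only [meanReceived, received_switchMessage hβ hK0, Finset.mul_sum]
    exact Finset.sum_congr rfl fun _ _ => by ring
  rw [e1]
  constructor
  · refine (sum_bern_le h0 h1 fun cf => (h cf).1).trans (le_of_eq ?_)
    rw [totalSwitchProb, Finset.mul_sum]
    exact Finset.sum_congr rfl fun _ _ => by ring
  · have e2 : m.success ω * (K * (totalSwitchProb m K δ (m.success ω) - η)
        - totalSwitchProb m K δ (m.success ω))
        = ∑ cf, bern δ cf * (m.success ω * (K * (switchProb m K cf (m.success ω) - η)
        - switchProb m K cf (m.success ω))) := by
      simp only [totalSwitchProb, Fintype.sum_bool, bern]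
      simp
      ring
    rw [e2]
    refine sum_bern_le h0 h1 fun cf => le_trans ?_ (h cf).2
    refine mul_le_mul_of_nonneg_left ?_ hp
    have := mul_le_mul_of_nonneg_left (sub_le_sub_left (hη cf ω) (switchProb m K cf (m.success ω)))
      hKr
    linarith

/-- After 0 and after b, the count in either state is K times the probability of switching, up to K
η. The main terms cancel by `hbal`, and the subsidy, weighted by at least δ - η, covers the rest.
After 1, the main terms differ in favour of H in proportion to K (pH - pL), which dominates the
boundary terms by `hKgap`. -/
lemma gain_switch (hm : m.Standing) (hβ : 0 < β) (hK0 : 0 < K) (hT : K ≤ T) {η : ℝ}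
    (hη : ∀ cf ω, pending m β K ν cf (m.success ω) T ≤ η) (h0 : 0 < δ) (h1 : δ ≤ 1)
    (hbal : m.up * totalSwitchProb m K δ m.pH = m.down * totalSwitchProb m K δ m.pL)
    (hηK : K * η ≤ δ) (hKgap : 2 ≤ K * (m.pH - m.pL))
    (hη1 : m.down * η ≤ β / (2 * K) * (1 - m.q) * (δ - η))
    (hη2 : m.up * η ≤ β / (2 * K) * m.q * (δ - η)) :
    (0 ≤ gain m m.b fun ω => rec (m.success ω) T (switchMessage β K .one) (some .one)) ∧
    (gain m (m.b + β / (2 * K)) (fun ω =>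
      rec (m.success ω) T (switchMessage β K .zero) (some .zero)) ≤ 0) ∧
    (0 ≤ gain m (m.b - β / (2 * K)) fun ω =>
      rec (m.success ω) T (switchMessage β K .safe) (some .safe)) := by
  have hu := hm.up_pos
  have hd := hm.down_pos
  have hq0 := hm.q_pos
  have hq1 := hm.q_lt
  have hKr : (0 : ℝ) < K := by exact_mod_cast hK0
  have hτ : 0 < β / (2 * K) := by positivity
  have hSH := le_totalSwitchProb hm K h1 .H
  have hSL := le_totalSwitchProb hm K h1 .L
  simp only [Model.success] at hSH hSL
  have hg : ∀ τ f, gain m (m.b + τ) f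
      = m.up * f .H - m.down * f .L - τ * (m.q * f .H + (1 - m.q) * f .L) := fun τ f => by
    rw [gain_eq, Model.up, Model.down]; ring
  refine ⟨?_, ?_, ?_⟩
  · have hH := (ones_bounds hm hβ hK0 hT hη h0.le h1 .H).2
    have hL := (ones_bounds hm hβ hK0 hT hη h0.le h1 .L).1
    rw [gain_b]
    simp only [Model.success] at hH hL ⊢
    set SH := totalSwitchProb m K δ m.pH
    set SL := totalSwitchProb m K δ m.pL
    set OH := rec m.pH T (switchMessage β K .one) (some .one)
    set OL := rec m.pL T (switchMessage β K .one) (some .one)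
    have hqH := sub_pos.2 hm.pH_lt
    have hqL : 0 < 1 - m.pL := sub_pos.2 (hm.success_lt .L)
    have hpL := hm.pL_pos
    have hpH := hm.pH_lt
    -- Both inequalities are multiplied by the failure probability of the other state, which avoids
    -- the denominators 1 - p.
    have h2 := mul_le_mul_of_nonneg_left hH (mul_nonneg hqL.le hu.le)
    have h3 := mul_le_mul_of_nonneg_left hL (mul_nonneg hqH.le hd.le)
    have h4 : (1 - m.pH) * m.down * ((m.pL * K + (1 - m.pL)) * SL)
        = (1 - m.pH) * (m.pL * K + (1 - m.pL)) * (m.up * SH) := by rw [hbal]; ring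
    rw [h4] at h3
    have h5 : (1 - m.pL) * m.up * (m.pH * (K * (SH - η) - SH))
        - (1 - m.pH) * (m.pL * K + (1 - m.pL)) * (m.up * SH)
        = m.up * (SH * (K * (m.pH - m.pL) - (1 - m.pL)) - (1 - m.pL) * m.pH * (K * η)) := by ring
    have h6 : δ ≤ SH * (K * (m.pH - m.pL) - (1 - m.pL)) := by
      have : 1 ≤ K * (m.pH - m.pL) - (1 - m.pL) := by linarith
      nlinarith
    have h7 : (1 - m.pL) * m.pH * (K * η) ≤ δ := by
      have h8 : (1 - m.pL) * m.pH ≤ 1 := by nlinarith [hm.success_pos .H]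
      have h9 : 0 ≤ (1 - m.pL) * m.pH := mul_nonneg hqL.le (hm.success_pos .H).le
      calc (1 - m.pL) * m.pH * (K * η) ≤ (1 - m.pL) * m.pH * δ := mul_le_mul_of_nonneg_left hηK h9
        _ ≤ 1 * δ := mul_le_mul_of_nonneg_right h8 h0.le
        _ = δ := one_mul δ
    have h8 : 0 ≤ m.up * (SH * (K * (m.pH - m.pL) - (1 - m.pL)) - (1 - m.pL) * m.pH * (K * η)) :=
      mul_nonneg hu.le (by linarith)
    have h9 : 0 ≤ (1 - m.pH) * (1 - m.pL) * (m.up * OH - m.down * OL) := by linarith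
    exact nonneg_of_mul_nonneg_right h9 (mul_pos hqH hqL)
  · have hH := (switch_bounds hm hβ hK0 hT hη h0.le h1 .H (Or.inl rfl)).1
    have hL := (switch_bounds hm hβ hK0 hT hη h0.le h1 .L (Or.inl rfl)).2
    have hH0 := meanReceived_nonneg (m := m) (β := β) (K := K) (ν := ν) (T := T) h0.le h1
      (hm.success_pos .H).le (hm.success_lt .H).le (switchMessage β K .zero) (some .zero)
    rw [hg]
    simp only [Model.success] at hH hL hH0 ⊢
    have h2 := mul_le_mul_of_nonneg_left hH hu.le
    have h3 := mul_le_mul_of_nonneg_left hL hd.le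
    have h4 := mul_le_mul_of_nonneg_left hL (mul_nonneg hτ.le (sub_pos.2 hq1).le)
    have h5 := mul_nonneg (mul_nonneg hτ.le hq0.le) hH0
    have h6 : β / (2 * K) * (1 - m.q) * (K * (δ - η))
        ≤ β / (2 * K) * (1 - m.q) * (K * (totalSwitchProb m K δ m.pL - η)) :=
      mul_le_mul_of_nonneg_left (mul_le_mul_of_nonneg_left (by linarith) hKr.le)
        (mul_nonneg hτ.le (sub_pos.2 hq1).le)
    have h7 := mul_le_mul_of_nonneg_left hη1 hKr.le
    have h8 : m.up * (K * totalSwitchProb m K δ m.pH)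
        = K * (m.down * totalSwitchProb m K δ m.pL) := by rw [← hbal]; ring
    linarith
  · have hH := (switch_bounds hm hβ hK0 hT hη h0.le h1 .H (Or.inr rfl)).2
    have hL := (switch_bounds hm hβ hK0 hT hη h0.le h1 .L (Or.inr rfl)).1
    have hL0 := meanReceived_nonneg (m := m) (β := β) (K := K) (ν := ν) (T := T) h0.le h1
      (hm.success_pos .L).le (hm.success_lt .L).le (switchMessage β K .safe) (some .safe)
    rw [sub_eq_add_neg, hg]
    simp only [Model.success] at hH hL hL0 ⊢
    have h2 := mul_le_mul_of_nonneg_left hH hu.le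
    have h3 := mul_le_mul_of_nonneg_left hL hd.le
    have h4 := mul_le_mul_of_nonneg_left hH (mul_nonneg hτ.le hq0.le)
    have h5 := mul_nonneg (mul_nonneg hτ.le (sub_pos.2 hq1).le) hL0
    have h6 : β / (2 * K) * m.q * (K * (δ - η))
        ≤ β / (2 * K) * m.q * (K * (totalSwitchProb m K δ m.pH - η)) :=
      mul_le_mul_of_nonneg_left (mul_le_mul_of_nonneg_left (by linarith) hKr.le)
        (mul_nonneg hτ.le hq0.le)
    have h7 := mul_le_mul_of_nonneg_left hη2 hKr.le
    have h8 : m.down * (K * totalSwitchProb m K δ m.pL)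
        = K * (m.up * totalSwitchProb m K δ m.pH) := by rw [hbal]; ring
    linarith

/-! ### Optimality -/

/-- At most a share ε/2 of the stages lies before M, and a share 3e ≤ ε/2 of the rest is lost by not
exploiting the right arm. -/
lemma le_averageReward (hm : m.Standing) (ht : Tuned m β K ν e M T) (he : Margin m ε c e)
    (hM : (M : ℝ) ≤ ε / 2 * (T + 1)) (h0 : 0 ≤ δ) (h1 : δ ≤ 1) (ω : State) (a : Arm)
    (ha : ∀ cf, 1 - 3 * e ≤ exploits m β K ν cf (m.success ω) a M) :
    (1 - ε) * armReward m (m.success ω) a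
      ≤ condMean (law m (INKP m ν (T + 1) β δ K)) (averageReward m (INKP m ν (T + 1) β δ K))
        {x | x.1 = ω} := by
  rw [condMean_averageReward hm (by omega)]
  change _ ≤ ∑ cf, bern δ cf * (expect (m.success ω) (advice m β K ν cf) (T + 1) _ / _)
  rw [← sum_bern_const δ ((1 - ε) * armReward m (m.success ω) a)]
  refine sum_bern_le h0 h1 fun cf => ?_
  have hw : 0 ≤ armReward m (m.success ω) a := by
    cases a
    · exact (hm.success_pos ω).le
    · exact hm.b_pos.le
  have hT : (0 : ℝ) < T + 1 := by positivity
  have h2 := le_expect_total (m := m) (β := β) (ν := ν) (cf := cf) hm.b_pos.le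
    (hm.success_pos ω).le (hm.success_lt ω).le ht.K_pos (show M ≤ T + 1 by have := ht.M_le; omega) a
  push_cast at h2 ⊢
  rw [le_div_iff₀ hT]
  refine le_trans ?_ h2
  have h3 : 0 ≤ 1 - 3 * e := by linarith [he.third]
  have h4 : 0 ≤ (T : ℝ) + 1 - M := by linarith [ht.half]
  calc (1 - ε) * armReward m (m.success ω) a * (T + 1)
      ≤ ((1 - ε / 2) * (1 - 3 * e)) * armReward m (m.success ω) a * (T + 1) := by
        have h5 : 1 - ε ≤ (1 - ε / 2) * (1 - 3 * e) := by nlinarith [he.eps, he.pos]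
        exact mul_le_mul_of_nonneg_right (mul_le_mul_of_nonneg_right h5 hw) hT.le
    _ = ((1 - ε / 2) * (T + 1)) * (armReward m (m.success ω) a * (1 - 3 * e)) := by ring
    _ ≤ ((T : ℝ) + 1 - M) * (armReward m (m.success ω) a * (1 - 3 * e)) :=
        mul_le_mul_of_nonneg_right (by linarith) (mul_nonneg hw h3)
    _ ≤ _ := mul_le_mul_of_nonneg_left (mul_le_mul_of_nonneg_left (ha cf) hw) h4

end Tuned

end

end Innkeeper

end

/-! ### The theorem: order of the choices -/

theorem theorem1 (m : Model)
    (hpL : 0 < m.pL) (hLb : m.pL < m.b) (hbH : m.b < m.pH) (hpH : m.pH < 1)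
    (hq0 : 0 < m.q) (hq1 : m.q < 1)
    (hprior : m.b < m.q * m.pH + (1 - m.q) * m.pL)
    (ε β : ℝ) (hε : 0 < ε) (hβ : 0 < β) :
    ∃ K N' : ℕ, 0 < K ∧ K ≤ N' ∧ ∃ δ ∈ Set.Icc (0 : ℝ) 1,
      ∀ N : ℕ, N' ≤ N →
        ∀ ν : ℕ → Reward → ℝ, (∀ n r, ν n r ∈ Set.Icc (0 : ℝ) 1) →
          IncentiveCompatible m ν (INKP m ν N β δ K) ∧
          BudgetBalanced β (INKP m ν N β δ K) ∧
          EpsOptimal m ν ε (INKP m ν N β δ K) := by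
  have hm : m.Standing := ⟨hpL, hLb, hbH, hpH, hq0, hq1, hprior⟩
  -- The constant c bounds a probability for all K at once, so e may depend on c, and K on e.
  obtain ⟨c, hc0, hc⟩ := exists_preRisky_ge hm
  obtain ⟨e, he⟩ := exists_margin hm hε hc0
  obtain ⟨K₀, hK₀, hK₁⟩ := errorBound_le hm he.pos
  obtain ⟨K₂, hK₂⟩ := exists_nat_ge (2 / (m.pH - m.pL))
  have hgap : 0 < m.pH - m.pL := by linarith
  set K := max K₀ K₂
  have hK0 : 0 < K := lt_of_lt_of_le hK₀ (le_max_left _ _)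
  have hKr : (0 : ℝ) < K := by exact_mod_cast hK0
  have hKe : errorBound m K ≤ e := hK₁ K (le_max_left _ _)
  have hKgap : 2 ≤ K * (m.pH - m.pL) := by
    rw [div_le_iff₀ hgap] at hK₂
    refine hK₂.trans (mul_le_mul_of_nonneg_right ?_ hgap.le)
    exact_mod_cast le_max_right K₀ K₂
  obtain ⟨δ, hδ0, hδ1, hbal⟩ := exists_bias hm he hK0 (hc K) hKe
  have hτ : 0 < β / (2 * K) := by positivity
  have hq1' : 0 < 1 - m.q := by linarith
  -- Unlike e, the error η has to be small compared with δ/K and with δ times the subsidy β/(2K), so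
  -- it comes after K and δ.
  obtain ⟨η, hη0, η1, η2, η3⟩ := exists_small hδ0 (mul_pos (mul_pos hτ hq1') hδ0)
    (mul_pos (mul_pos hτ hq0) hδ0) K (m.down + β / (2 * K) * (1 - m.q)) (m.up + β / (2 * K) * m.q)
  -- Two horizons: M suffices for exploitation and for the average rewards, M₁ gives the finer bound
  -- needed for the switching messages.
  obtain ⟨M, hKM, hM⟩ := exists_pending_le hm hK0 he.pos
  obtain ⟨M₁, -, hM₁⟩ := exists_pending_le hm hK0 hη0
  obtain ⟨M₂, hM₂⟩ := exists_nat_ge (M / (ε / 2))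
  refine ⟨K, max (max (2 * (M + 1)) (M₁ + 1)) M₂, hK0, ?_, δ, ⟨hδ0.le, hδ1.le⟩,
    fun N hN ν _ => ?_⟩
  · have : 2 * (M + 1) ≤ max (max (2 * (M + 1)) (M₁ + 1)) M₂ :=
      (le_max_left _ _).trans (le_max_left _ _)
    omega
  obtain ⟨T, rfl⟩ : ∃ T, N = T + 1 := ⟨N - 1, by omega⟩
  have hT1 : 2 * (M + 1) ≤ T + 1 := by omega
  have hT2 : M₁ ≤ T := by omega
  have hT3 : (M : ℝ) ≤ ε / 2 * (T + 1) := by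
    rw [div_le_iff₀ (by positivity)] at hM₂
    have : (M₂ : ℝ) ≤ T + 1 := by exact_mod_cast (by omega : M₂ ≤ T + 1)
    refine hM₂.trans ?_
    rw [mul_comm]
    exact mul_le_mul_of_nonneg_left this (by positivity)
  have ht : Tuned m β K ν e M T := ⟨hK0, hKM, hKe, fun cf ω n hn => hM β ν cf ω n hn, hT1⟩
  have hsw := Tuned.gain_switch hm hβ hK0 ht.K_le_T (fun cf ω => hM₁ β ν cf ω T hT2) hδ0 hδ1.le
    hbal η1.le hKgap (by linarith) (by linarith)
  have hSpos : 0 < meanReceived m β δ K ν m.pL T ⟨.safe, .exploitation, 0⟩ (some .safe) := by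
    refine lt_of_lt_of_le ?_ (ht.le_received_safe hm he hδ0.le hδ1.le)
    have := he.third
    have : 0 < 1 - 3 * e := by linarith
    positivity
  have hIC := incentiveCompatible_of_gain hm hβ hK0 hδ0 hδ1
    (fun r => ht.gain_risky hm he hδ0.le hδ1.le r) (ht.received_risky_pos hm he hδ0.le hδ1.le)
    (fun r => ht.gain_safe hm he (hc K) hδ0.le hδ1.le r) hSpos hsw.1 hsw.2.1 hsw.2.2
  refine ⟨hIC, budgetBalanced m hβ hK0 ν (T + 1) δ, hIC, ?_, ?_⟩
  · exact ht.le_averageReward hm he hT3 hδ0.le hδ1.le .H .risky fun cf =>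
      le_trans (by linarith [he.pos]) (ht.exploits_risky hm cf)
  · exact ht.le_averageReward hm he hT3 hδ0.le hδ1.le .L .safe fun cf => ht.exploits_safe hm cf
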